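/- Let $M$ be a smooth $n$-dimensional manifold (Hausdorff, second countable, without boundary) and let $g,\bar g$ be $C^2$ Riemannian metrics on $M$ which are geodesically equivalent, i.e. have the same geodesics considered as unparameterized curves. Let $G=g^{-1}\bar g$ be the endomorphism of $TM$ with matrix $G^i_j=g^{i\alpha}\bar g_{\alpha j}$, write $\det(G-\mu E)=c_0\mu^n+c_1\mu^{n-1}+\dots+c_n$, and for $k=0,\dots,n-1$ put $$S_k=\left(\frac{\det g}{\det\bar g}\right)^{\frac{k+2}{n+1}}\sum_{i=0}^{k}c_i\,G^{k-i+1},\qquad \mathcal I_k=\frac1{\sqrt{\det g}}\,\frac{\partial}{\partial x^i}\,(S_k)^i_\alpha\sqrt{\det g}\,g^{\alpha j}\frac{\partial}{\partial x^j}\;:\;C^2(M)\to C^0(M).$$ Then the operators $\mathcal I_0,\dots,\mathcal I_{n-1}$ pairwise commute: $\mathcal I_k(\mathcal I_l f)=\mathcal I_l(\mathcal I_k f)$ for all $k,l$ and every $f\in C^2(M)$ for which both compositions are defined, that is, $\mathcal I_kf,\mathcal I_lf\in C^2(M)$. In particular, they commute in this sense with the Beltrami–Laplace operator $$\Delta=-\frac1{\sqrt{\det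 g}}\,\frac{\partial}{\partial x^i}\,\sqrt{\det g}\,g^{ij}\frac{\partial}{\partial x^j},$$ and $\mathcal I_{n-1}=\Delta$ (for $n\ge1$). If $M$ is closed (compact), then each $\mathcal I_k$ is self-adjoint on $C^2(M)$ with respect to the $L^2$ inner product of the Riemannian volume $dv_g$: $\int_M(\mathcal I_kf)\,h\,dv_g=\int_M f\,(\mathcal I_kh)\,dv_g$ for all $f,h\in C^2(M)$. -/

import Mathlib

open scoped Manifold ContDiff
open Bundle MeasureTheory Polynomial

noncomputable section

namespace ProjEquiv

/-- A `C^2` Riemannian metric on an `n`-dimensional manifold `M` (without boundary). -/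
abbrev Metric (n : ℕ) (M : Type*) [TopologicalSpace M]
    [ChartedSpace (EuclideanSpace ℝ (Fin n)) M] [IsManifold (𝓡 n) ∞ M] :=
  ContMDiffRiemannianMetric (𝓡 n) 2 (EuclideanSpace ℝ (Fin n))
    (fun x : M => TangentSpace (𝓡 n) x)

/-- The `i`-th standard basis vector of `ℝⁿ`. -/
def stdVec {n : ℕ} (i : Fin n) : EuclideanSpace ℝ (Fin n) := EuclideanSpace.single i 1

/-- The partial derivative `∂F/∂x^i` at the point `z` of `ℝⁿ`. -/
def pd {n : ℕ} (i : Fin n) (F : EuclideanSpace ℝ (Fin n) → ℝ)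
    (z : EuclideanSpace ℝ (Fin n)) : ℝ :=
  fderiv ℝ F z (stdVec i)

variable {n : ℕ} {M : Type*} [TopologicalSpace M] [ChartedSpace (EuclideanSpace ℝ (Fin n)) M]
  [IsManifold (𝓡 n) ∞ M]

/-- The matrix `(g_ij)` of the metric `g` in the chart `e`, at the point of `M` with coordinates
`z ∈ e.target`. The coordinate vector fields are the images of the standard basis vectors under the
derivative of `e⁻¹`. -/
def gram (g : Metric n M) (e : OpenPartialHomeomorph M (EuclideanSpace ℝ (Fin n)))
    (z : EuclideanSpace ℝ (Fin n)) : Matrix (Fin n) (Fin n) ℝ :=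
  Matrix.of fun i j =>
    g.inner (e.symm z) (mfderiv (𝓡 n) (𝓡 n) e.symm z (stdVec i))
      (mfderiv (𝓡 n) (𝓡 n) e.symm z (stdVec j))

/-! ### Geodesics and geodesic equivalence -/

/-- The Christoffel symbols `Γ^k_ij` of `g` in the chart `e`. -/
def christoffel (g : Metric n M) (e : OpenPartialHomeomorph M (EuclideanSpace ℝ (Fin n)))
    (k i j : Fin n) (z : EuclideanSpace ℝ (Fin n)) : ℝ :=
  (1 / 2) * ∑ m : Fin n, (gram g e z)⁻¹ k m *
    (pd i (fun y => gram g e y m j) z + pd j (fun y => gram g e y m i) z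
      - pd m (fun y => gram g e y i j) z)

/-- The `k`-th component `γ''^k + Γ^k_ij γ'^i γ'^j` of the left-hand side of the geodesic equation for
the curve `γ`, at the parameter `t`, in the chart `e`. -/
def geodesicLHS (g : Metric n M) (e : OpenPartialHomeomorph M (EuclideanSpace ℝ (Fin n)))
    (γ : ℝ → M) (t : ℝ) (k : Fin n) : ℝ :=
  deriv (deriv (fun s => e (γ s) k)) t
    + ∑ i : Fin n, ∑ j : Fin n, christoffel g e k i j (e (γ t)) *
        deriv (fun s => e (γ s) i) t * deriv (fun s => e (γ s) j) t

/-- `γ` is an (affinely parameterized) geodesic of `g` on the open set `J` of parameters: it is of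
class `C^2` there and satisfies the geodesic equation in local coordinates. -/
def IsGeodesicOn (g : Metric n M) (γ : ℝ → M) (J : Set ℝ) : Prop :=
  ContMDiffOn 𝓘(ℝ, ℝ) (𝓡 n) 2 γ J ∧
  ∀ t ∈ J, ∀ k : Fin n, geodesicLHS g (chartAt (EuclideanSpace ℝ (Fin n)) (γ t)) γ t k = 0

/-- Every geodesic of `g` (on an open interval `J`) becomes a geodesic of `g'` after a regular
`C^2` change of the parameter. -/
def GeodesicsOfAreGeodesicsOf (g g' : Metric n M) : Prop :=
  ∀ (γ : ℝ → M) (J : Set ℝ), IsOpen J → J.OrdConnected → IsGeodesicOn g γ J →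
    ∃ (J' : Set ℝ) (τ : ℝ → ℝ), IsOpen J' ∧ J'.OrdConnected ∧ Set.BijOn τ J' J ∧
      ContDiffOn ℝ 2 τ J' ∧ (∀ s ∈ J', deriv τ s ≠ 0) ∧ IsGeodesicOn g' (γ ∘ τ) J'

/-- `g` and `g'` are geodesically equivalent: they have the same geodesics, considered as
unparameterized curves. -/
def GeodesicallyEquivalent (g g' : Metric n M) : Prop :=
  GeodesicsOfAreGeodesicsOf g g' ∧ GeodesicsOfAreGeodesicsOf g' g

/-! ### The endomorphisms `S_k` and the operators `𝓘_k` -/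

/-- The coefficient `c_i` of `det (G - μ E) = c_0 μ^n + c_1 μ^(n-1) + ⋯ + c_n` (for `i ≤ n`). -/
def charCoeff (G : Matrix (Fin n) (Fin n) ℝ) (i : ℕ) : ℝ :=
  (Matrix.det (G.map (C : ℝ →+* ℝ[X]) - (X : ℝ[X]) • (1 : Matrix (Fin n) (Fin n) ℝ[X]))).coeff
    (n - i)

/-- The matrix of the endomorphism `G = g⁻¹ g'` of the tangent bundle in the chart `e`. -/
def matG (g g' : Metric n M) (e : OpenPartialHomeomorph M (EuclideanSpace ℝ (Fin n)))
    (z : EuclideanSpace ℝ (Fin n)) : Matrix (Fin n) (Fin n) ℝ :=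
  (gram g e z)⁻¹ * gram g' e z

/-- The matrix of
`S_k = (det g / det g') ^ ((k + 2) / (n + 1)) * ∑_{i = 0}^k c_i G ^ (k - i + 1)`
in the chart `e`. -/
def matS (g g' : Metric n M) (k : ℕ) (e : OpenPartialHomeomorph M (EuclideanSpace ℝ (Fin n)))
    (z : EuclideanSpace ℝ (Fin n)) : Matrix (Fin n) (Fin n) ℝ :=
  (((gram g e z).det / (gram g' e z).det) ^ (((k : ℝ) + 2) / ((n : ℝ) + 1))) •
    ∑ i ∈ Finset.range (k + 1), charCoeff (matG g g' e z) i • matG g g' e z ^ (k - i + 1)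

/-- The expression `(1 / √det g) ∂_i ((S_k)^i_α √det g g^{αj} ∂_j u)` in the chart `e`, for a function
`u` of the coordinates. -/
def localI (g g' : Metric n M) (k : ℕ) (e : OpenPartialHomeomorph M (EuclideanSpace ℝ (Fin n)))
    (u : EuclideanSpace ℝ (Fin n) → ℝ) (z : EuclideanSpace ℝ (Fin n)) : ℝ :=
  (1 / √(gram g e z).det) *
    ∑ i : Fin n, pd i (fun y => ∑ a : Fin n, ∑ j : Fin n,
      matS g g' k e y i a * √(gram g e y).det * (gram g e y)⁻¹ a j * pd j u y) z

/-- The operator `𝓘_k`, evaluated at every point in the local coordinates around this point. -/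
def opI (g g' : Metric n M) (k : ℕ) (f : M → ℝ) (x : M) : ℝ :=
  localI g g' k (chartAt (EuclideanSpace ℝ (Fin n)) x)
    (f ∘ (chartAt (EuclideanSpace ℝ (Fin n)) x).symm) (chartAt (EuclideanSpace ℝ (Fin n)) x x)

/-- The expression `- (1 / √det g) ∂_i (√det g g^{ij} ∂_j u)` in the chart `e`, for a function `u` of
the coordinates. -/
def localLaplace (g : Metric n M) (e : OpenPartialHomeomorph M (EuclideanSpace ℝ (Fin n)))
    (u : EuclideanSpace ℝ (Fin n) → ℝ) (z : EuclideanSpace ℝ (Fin n)) : ℝ :=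
  -((1 / √(gram g e z).det) *
    ∑ i : Fin n, pd i (fun y => ∑ j : Fin n,
      √(gram g e y).det * (gram g e y)⁻¹ i j * pd j u y) z)

/-- The Beltrami–Laplace operator `Δ` (with the sign that makes it nonnegative), evaluated at every
point in the local coordinates around this point. -/
def laplaceBeltrami (g : Metric n M) (f : M → ℝ) (x : M) : ℝ :=
  localLaplace g (chartAt (EuclideanSpace ℝ (Fin n)) x)
    (f ∘ (chartAt (EuclideanSpace ℝ (Fin n)) x).symm) (chartAt (EuclideanSpace ℝ (Fin n)) x x)

/-- Functions of class `C^2` on `M`. -/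
def IsC2 (n : ℕ) {M : Type*} [TopologicalSpace M] [ChartedSpace (EuclideanSpace ℝ (Fin n)) M]
    (f : M → ℝ) : Prop :=
  ContMDiff (𝓡 n) 𝓘(ℝ, ℝ) 2 f

/-- Two operators defined on `C^2` functions commute: `P (Q f) = Q (P f)` for all `f` in the common
natural domain of the two compositions. -/
def OperatorsCommute (n : ℕ) {M : Type*} [TopologicalSpace M]
    [ChartedSpace (EuclideanSpace ℝ (Fin n)) M] (P Q : (M → ℝ) → (M → ℝ)) : Prop :=
  ∀ f : M → ℝ, IsC2 n f → IsC2 n (P f) → IsC2 n (Q f) → P (Q f) = Q (P f)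

/-! ### The Riemannian volume and self-adjointness -/

/-- The part of the Riemannian volume that lives on the domain of the chart `e`:
`√det g dx¹ ⋯ dxⁿ`, transported to `M`. -/
def chartVolume [MeasurableSpace M] (g : Metric n M)
    (e : OpenPartialHomeomorph M (EuclideanSpace ℝ (Fin n))) : Measure M :=
  (((volume : Measure (EuclideanSpace ℝ (Fin n))).restrict e.target).withDensity
    (fun z => ENNReal.ofReal √(gram g e z).det)).map e.symm

/-- The Riemannian volume measure of `g`: the least measure that dominates `√det g dx¹ ⋯ dxⁿ` on
every chart of the atlas. (These local measures agree on overlaps, so on the domain of each chart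
it equals `√det g dx¹ ⋯ dxⁿ`.) -/
def riemannianVolume [MeasurableSpace M] (g : Metric n M) : Measure M :=
  ⨆ e ∈ atlas (EuclideanSpace ℝ (Fin n)) M, chartVolume g e

/-- The operator `P`, defined on `C^2(M)`, is self-adjoint with respect to the inner product
`⟨f, h⟩ = ∫ f h dvol_g` (all the integrals being convergent). -/
def IsSelfAdjointOp [MeasurableSpace M] (g : Metric n M) (P : (M → ℝ) → (M → ℝ)) : Prop :=
  ∀ f h : M → ℝ, IsC2 n f → IsC2 n h →
    Integrable (fun x => P f x * h x) (riemannianVolume g) ∧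
    Integrable (fun x => f x * P h x) (riemannianVolume g) ∧
    ∫ x, P f x * h x ∂(riemannianVolume g) = ∫ x, f x * P h x ∂(riemannianVolume g)

end ProjEquiv

end

/-!
The argument has three parts: geodesic equivalence is turned into a differential equation for one
endomorphism field `L`, the operators are shown to commute weakly by an integral identity for the
resolvents of `L`, and regularity makes weak commutation pointwise.

Geodesics exist in every direction by the Picard–Lindelöf theorem, and a geodesic of `g` is a
geodesic of `g'` after a change of parameter. Hence the difference of the two Levi-Civita
connections maps `(v, v)` to a multiple of `v` (`exists_conn_sub_conn_eq_smul`), and by polarization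
`Γ' = Γ + ψ ⊗ id + id ⊗ ψ` for a one-form `ψ` (`eq_smul_add_smul_of_forall_smul`,
`exists_projective_form`). Put `D = (det g' / det g) ^ (1 / (n + 1))` and `L = D G⁻¹`. Then
`dD = 2 D ψ`, and `L` is `g`-self-adjoint with `∇ₓ L = l ⊗ x♭ + x ⊗ l♭` for a vector field `l`
(`MetricGeometry.bmGeometry`, `exists_bmGeometry`). By the Cayley–Hamilton identity
`∑ tᵏ Sₖ = -A_t` with `A_t = det (t - L) (t - L)⁻¹` (`sum_sMat_mul`), and `Sₙ₋₁ = -1`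
(`sMat_last`); the latter gives `𝓘ₙ₋₁ = Δ`. In a chart `𝓘ₖ f = div (Sₖ ∇f)` (`sum_pd_eq_divOp`), an
expression which is independent of the chart (`MetricGeometry.divOp_comp`, `opI_symm`).

The key identity (`BMGeometry.divC_commField`) states that
`div (A_s ∇f) div (A_t ∇φ) - div (A_t ∇f) div (A_s ∇φ)` is the divergence of an explicit vector
field. Exchanging the two derivatives in a product of divergences produces, up to a divergence,
`tr (∇X ∇Y) + Ric (X, Y)` (`divC_bochner`). The Ricci terms cancel because `L` is self-adjoint for the
Ricci form (`BMGeometry.ricci_L`), and the remaining traces combine into another divergence by an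
algebraic identity for two resolvents of one endomorphism (`trL_resGrad_comp_sub`). The identity
takes two derivatives of `f` and three of `φ`, so it applies to `f` of class `C²` and a test function
`φ`.

The eigenvalues of `L` are positive, so `t - L` is invertible for `t < 0`. Integrating the identity
and comparing the coefficients of the powers of `s` and `t` gives the same relation for each pair
`Sₖ`, `Sₘ` in place of `A_s`, `A_t` (`BMGeometry.integral_divOp_coeff`). When both compositions are
defined, Green's formula (`MetricGeometry.green`) moves the operator that acts on `φ` to the other
factor, and the commutator, being continuous and orthogonal to all test functions, vanishes
(`BMGeometry.divOp_comm`, `operatorsCommute_opI`).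

On a closed manifold the Riemannian volume is `√det g dx` on the domain of each chart
(`riemannianVolume_restrict`), so a partition of unity reduces self-adjointness to Green's formula in
charts (`isSelfAdjointOp_opI`).
-/

open scoped Manifold ContDiff
open Bundle MeasureTheory Polynomial
open Filter Topology

noncomputable section

namespace ProjEquiv

set_option linter.unusedSectionVars false

/-! ### Divergence, covariant derivative and curvature of a connection -/

section LocalGeometry

variable {E : Type*} [NormedAddCommGroup E] [NormedSpace ℝ E] [FiniteDimensional ℝ E]

/-- The trace of an endomorphism, as a continuous linear functional. -/
def trL : (E →L[ℝ] E) →L[ℝ] ℝ :=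
  LinearMap.toContinuousLinearMap ((LinearMap.trace ℝ E).comp (ContinuousLinearMap.coeLM ℝ))

lemma trL_eq_trace (T : E →L[ℝ] E) : trL T = LinearMap.trace ℝ E (T : E →ₗ[ℝ] E) := rfl

lemma trL_comm (S T : E →L[ℝ] E) : trL (S ∘L T) = trL (T ∘L S) := by
  rw [trL_eq_trace, trL_eq_trace]
  exact LinearMap.trace_mul_comm ℝ (S : E →ₗ[ℝ] E) (T : E →ₗ[ℝ] E)

lemma trL_smulRight (φ : E →L[ℝ] ℝ) (x : E) : trL (φ.smulRight x) = φ x := by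
  rw [trL_eq_trace]
  exact LinearMap.trace_smulRight (φ : E →ₗ[ℝ] ℝ) x

/-- The divergence `∂ᵢXⁱ + Γʲⱼᵢ Xⁱ` of a vector field with respect to the connection `Γ`. -/
def divC (Γ : E → E →L[ℝ] E →L[ℝ] E) (X : E → E) (z : E) : ℝ :=
  trL (fderiv ℝ X z) + trL (Γ z (X z))

/-- The covariant derivative `∇Y`, an endomorphism at every point. -/
def cov (Γ : E → E →L[ℝ] E →L[ℝ] E) (Y : E → E) (z : E) : E →L[ℝ] E :=
  fderiv ℝ Y z + (Γ z).flip (Y z)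

/-- The curvature `R(x, y)` of the connection `Γ`, as an endomorphism. -/
def curv (Γ : E → E →L[ℝ] E →L[ℝ] E) (z x y : E) : E →L[ℝ] E :=
  fderiv ℝ Γ z x y - fderiv ℝ Γ z y x + (Γ z x ∘L Γ z y - Γ z y ∘L Γ z x)

/-- The endomorphism `j ↦ R(j, x) y`, whose trace is the Ricci curvature. -/
def curvFlip (Γ : E → E →L[ℝ] E →L[ℝ] E) (z x y : E) : E →L[ℝ] E :=
  ((fderiv ℝ Γ z).flip x).flip y - (fderiv ℝ Γ z x).flip y
    + ((Γ z).flip (Γ z x y) - Γ z x ∘L (Γ z).flip y)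

omit [FiniteDimensional ℝ E] in
lemma curvFlip_apply (Γ : E → E →L[ℝ] E →L[ℝ] E) (z x y j : E) :
    curvFlip Γ z x y j = curv Γ z j x y := by
  simp [curvFlip, curv]

/-- The Ricci curvature of the connection `Γ`. -/
def ricci (Γ : E → E →L[ℝ] E →L[ℝ] E) (z x y : E) : ℝ := trL (curvFlip Γ z x y)

lemma differentiableAt_divC {Γ : E → E →L[ℝ] E →L[ℝ] E} {Y : E → E} {z : E}
    (hY : ContDiffAt ℝ 2 Y z) (hΓ : DifferentiableAt ℝ Γ z) :
    DifferentiableAt ℝ (divC Γ Y) z := by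
  have h1 : DifferentiableAt ℝ (fderiv ℝ Y) z :=
    (hY.fderiv_right (m := 1) (by norm_num)).differentiableAt (by norm_num)
  have h0 : DifferentiableAt ℝ Y z := hY.differentiableAt (by norm_num)
  exact (trL.differentiableAt.comp z h1).add (trL.differentiableAt.comp z (hΓ.clm_apply h0))

lemma fderiv_divC {Γ : E → E →L[ℝ] E →L[ℝ] E} {Y : E → E} {z : E}
    (hY : ContDiffAt ℝ 2 Y z) (hΓ : DifferentiableAt ℝ Γ z) (x : E) :
    fderiv ℝ (divC Γ Y) z x = trL (fderiv ℝ (fderiv ℝ Y) z x) + trL (fderiv ℝ Γ z x (Y z))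
      + trL (Γ z (fderiv ℝ Y z x)) := by
  have h1 : HasFDerivAt (fderiv ℝ Y) (fderiv ℝ (fderiv ℝ Y) z) z :=
    ((hY.fderiv_right (m := 1) (by norm_num)).differentiableAt (by norm_num)).hasFDerivAt
  have h0 : HasFDerivAt Y (fderiv ℝ Y z) z := (hY.differentiableAt (by norm_num)).hasFDerivAt
  have h := (trL.hasFDerivAt.comp z h1).add (trL.hasFDerivAt.comp z (hΓ.hasFDerivAt.clm_apply h0))
  have h' : HasFDerivAt (divC Γ Y) _ z := h
  rw [h'.fderiv]
  simp
  ring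

lemma divC_smul {Γ : E → E →L[ℝ] E →L[ℝ] E} {h : E → ℝ} {X : E → E} {z : E}
    (hh : DifferentiableAt ℝ h z) (hX : DifferentiableAt ℝ X z) :
    divC Γ (fun y => h y • X y) z = h z * divC Γ X z + fderiv ℝ h z (X z) := by
  have h1 := hh.hasFDerivAt.smul hX.hasFDerivAt
  have h1' : HasFDerivAt (fun y => h y • X y) _ z := h1
  rw [divC, h1'.fderiv, divC, map_add, trL_smulRight, map_smul]
  simp only [map_smul, smul_eq_mul]
  ring

lemma divC_sub {Γ : E → E →L[ℝ] E →L[ℝ] E} {X Y : E → E} {z : E}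
    (hX : DifferentiableAt ℝ X z) (hY : DifferentiableAt ℝ Y z) :
    divC Γ (fun y => X y - Y y) z = divC Γ X z - divC Γ Y z := by
  rw [divC, fderiv_fun_sub hX hY, divC, divC]
  simp only [map_sub]
  ring

lemma divC_add {Γ : E → E →L[ℝ] E →L[ℝ] E} {X Y : E → E} {z : E}
    (hX : DifferentiableAt ℝ X z) (hY : DifferentiableAt ℝ Y z) :
    divC Γ (fun y => X y + Y y) z = divC Γ X z + divC Γ Y z := by
  rw [divC, fderiv_fun_add hX hY, divC, divC]
  simp only [map_add]
  ring

omit [FiniteDimensional ℝ E] in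
lemma differentiableAt_cov_apply {Γ : E → E →L[ℝ] E →L[ℝ] E} {X Y : E → E} {z : E}
    (hX : DifferentiableAt ℝ X z) (hY : ContDiffAt ℝ 2 Y z) (hΓ : DifferentiableAt ℝ Γ z) :
    DifferentiableAt ℝ (fun y => cov Γ Y y (X y)) z := by
  have h1 : DifferentiableAt ℝ (fderiv ℝ Y) z :=
    (hY.fderiv_right (m := 1) (by norm_num)).differentiableAt (by norm_num)
  have h0 : DifferentiableAt ℝ Y z := hY.differentiableAt (by norm_num)
  exact (h1.clm_apply hX).add ((hΓ.clm_apply hX).clm_apply h0)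

omit [FiniteDimensional ℝ E] in
/-- The derivative of a torsion-free connection is symmetric in the last two arguments. -/
lemma fderiv_symm_of_eventually {Γ : E → E →L[ℝ] E →L[ℝ] E} {z : E}
    (hΓs : ∀ᶠ w in 𝓝 z, ∀ x y, Γ w x y = Γ w y x) (hΓ : DifferentiableAt ℝ Γ z) (j x y : E) :
    fderiv ℝ Γ z j x y = fderiv ℝ Γ z j y x := by
  have h1 : ∀ a b : E, HasFDerivAt (fun w => Γ w a b)
      (((fderiv ℝ Γ z).flip a).flip b) z := by
    intro a b
    have := (hΓ.hasFDerivAt.clm_apply (hasFDerivAt_const a z)).clm_apply (hasFDerivAt_const b z)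
    refine this.congr_fderiv ?_
    ext k
    simp only [add_apply, ContinuousLinearMap.comp_apply,
      ContinuousLinearMap.flip_apply, zero_apply, map_zero, zero_add]
  have h2 := (h1 y x).congr_of_eventuallyEq (hΓs.mono fun w hw => hw x y)
  simpa using DFunLike.congr_fun ((h1 x y).unique h2) j

/-- The Bochner-type identity which exchanges the two derivatives in `div X · div Y`: up to a
divergence this product is `tr (∇X ∇Y) + Ric (X, Y)`. -/
lemma divC_bochner {Γ : E → E →L[ℝ] E →L[ℝ] E} {X Y : E → E} {z : E}
    (hΓs : ∀ᶠ w in 𝓝 z, ∀ x y, Γ w x y = Γ w y x)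
    (hX : DifferentiableAt ℝ X z) (hY : ContDiffAt ℝ 2 Y z) (hΓ : DifferentiableAt ℝ Γ z) :
    divC Γ (fun y => divC Γ Y y • X y - cov Γ Y y (X y)) z
      = divC Γ X z * divC Γ Y z - trL (cov Γ X z ∘L cov Γ Y z) - ricci Γ z (X z) (Y z) := by
  have h0 : HasFDerivAt Y (fderiv ℝ Y z) z := (hY.differentiableAt (by norm_num)).hasFDerivAt
  have h1 : HasFDerivAt (fderiv ℝ Y) (fderiv ℝ (fderiv ℝ Y) z) z :=
    ((hY.fderiv_right (m := 1) (by norm_num)).differentiableAt (by norm_num)).hasFDerivAt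
  have hsymm : ∀ x y, fderiv ℝ (fderiv ℝ Y) z x y = fderiv ℝ (fderiv ℝ Y) z y x := by
    intro x y
    exact (hY.isSymmSndFDerivAt (by simp)).eq x y
  have hN := (h1.clm_apply hX.hasFDerivAt).add
    ((hΓ.hasFDerivAt.clm_apply hX.hasFDerivAt).clm_apply h0)
  have hN' : HasFDerivAt (fun y => cov Γ Y y (X y)) _ z := hN
  have hd := differentiableAt_divC hY hΓ
  have hdG := fderiv_symm_of_eventually hΓs hΓ
  have hG := hΓs.self_of_nhds
  rw [divC_sub (hd.fun_smul hX) hN'.differentiableAt, divC_smul hd hX, fderiv_divC hY hΓ]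
  have hcov : cov Γ Y z (X z) = fderiv ℝ Y z (X z) + Γ z (X z) (Y z) := rfl
  rw [divC, divC, divC, hN'.fderiv, hcov]
  have e1 : trL (cov Γ X z ∘L cov Γ Y z) = trL (fderiv ℝ Y z ∘L fderiv ℝ X z)
      + trL (fderiv ℝ Y z ∘L Γ z (X z)) + trL ((Γ z).flip (Y z) ∘L fderiv ℝ X z)
      + trL (Γ z (Y z) ∘L Γ z (X z)) := by
    rw [trL_comm, ← map_add, ← map_add, ← map_add]
    congr 1
    ext x; simp [cov, hG (X z), hG (Y z)]; abel
  have e2 : ricci Γ z (X z) (Y z) = trL (((fderiv ℝ Γ z).flip (X z)).flip (Y z))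
      - trL (fderiv ℝ Γ z (X z) (Y z))
      + trL (Γ z (Γ z (X z) (Y z))) - trL (Γ z (X z) ∘L Γ z (Y z)) := by
    rw [ricci, ← map_sub, ← map_add, ← map_sub]
    congr 1
    ext x; simp [curvFlip, hG (Y z), hG (Γ z (X z) (Y z)), hdG (X z) (Y z)]; abel
  have e3 : fderiv ℝ (fderiv ℝ Y) z (X z) = (fderiv ℝ (fderiv ℝ Y) z).flip (X z) := by
    ext x; simp [hsymm (X z) x]
  have e4 : (Γ z ∘L fderiv ℝ X z + (fderiv ℝ Γ z).flip (X z)).flip (Y z)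
      = (Γ z).flip (Y z) ∘L fderiv ℝ X z + ((fderiv ℝ Γ z).flip (X z)).flip (Y z) := by
    ext x; simp
  rw [e1, e2, e3, e4, trL_comm (Γ z (X z)) (Γ z (Y z))]
  simp only [map_add, trL_comm (Γ z (X z)) (fderiv ℝ Y z)]
  ring

end LocalGeometry

/-! ### The algebraic identity behind the commutation -/

section ResolventAlgebra

variable {E : Type*} [NormedAddCommGroup E] [NormedSpace ℝ E] [FiniteDimensional ℝ E]

/-- The rank-one endomorphism `w ↦ B(y, w) x`. -/
def rk (B : E →L[ℝ] E →L[ℝ] ℝ) (x y : E) : E →L[ℝ] E := (B y).smulRight x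

omit [FiniteDimensional ℝ E] in
@[simp] lemma rk_apply (B : E →L[ℝ] E →L[ℝ] ℝ) (x y w : E) : rk B x y w = B y w • x := rfl

lemma trL_comp_rk (B : E →L[ℝ] E →L[ℝ] ℝ) (T : E →L[ℝ] E) (x y : E) :
    trL (T ∘L rk B x y) = B y (T x) := by
  have : T ∘L rk B x y = (B y).smulRight (T x) := by ext; simp
  rw [this, trL_smulRight]

lemma trL_rk_comp (B : E →L[ℝ] E →L[ℝ] ℝ) (T : E →L[ℝ] E) (x y : E) :
    trL (rk B x y ∘L T) = B y (T x) := by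
  rw [trL_comm, trL_comp_rk]

/-- For the resolvent `M` at a point of the endomorphism `L`, the covariant derivative of the vector
field `δ M a`, where `U = ∇a`, up to the factor `δ`. -/
def resGrad (B : E →L[ℝ] E →L[ℝ] ℝ) (M U : E →L[ℝ] E) (l a : E) : E →L[ℝ] E :=
  M ∘L U + rk B (M l) (M a) + B (M l) a • M - (2 : ℝ) • rk B (M a) (M l)

/-- The differential of `B(b, M l)` where `W = ∇b` and `Λ = ∇l`. -/
def resPair (B : E →L[ℝ] E →L[ℝ] ℝ) (M W Λ : E →L[ℝ] E) (l b x : E) : ℝ :=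
  B (W x) (M l) + B (M x) l * B b (M l) + B (M l) l * B b (M x) + B b (M (Λ x))

/-- The divergence of `M a` where `U = ∇a`. -/
def resDiv (B : E →L[ℝ] E →L[ℝ] ℝ) (M U : E →L[ℝ] E) (l a : E) : ℝ :=
  trL (M ∘L U) + B (M l) (M a) + B (M l) a * trL M

/-- The trace of `∇(δ M a) ∘ ∇(δ' N b)` for self-adjoint `M`, `N`, `U`, `W`, expanded
into the traces and scalar products of its sixteen terms. -/
lemma trL_resGrad_comp (B : E →L[ℝ] E →L[ℝ] ℝ) (hB : ∀ x y, B x y = B y x)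
    (M N U W : E →L[ℝ] E) (l a b : E)
    (hM : ∀ x y, B (M x) y = B x (M y)) (hN : ∀ x y, B (N x) y = B x (N y))
    (hU : ∀ x y, B (U x) y = B x (U y)) (hW : ∀ x y, B (W x) y = B x (W y)) :
    trL (resGrad B M U l a ∘L resGrad B N W l b)
      = trL ((M ∘L U) ∘L (N ∘L W)) + B b (N (M (U (N l)))) - 2 * B b (N (U (M (N l))))
        + B a (M (N (W (M l)))) - 2 * B a (M (W (N (M l))))
        + B b (N l) * trL (N ∘L (M ∘L U)) + B a (M l) * trL (M ∘L (N ∘L W))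
        - B b (N l) * B a (M (N (M l))) - B a (M l) * B b (N (M (N l)))
        + B a (M l) * B b (N l) * trL (M ∘L N)
        + 5 * (B a (M (N l)) * B b (N (M l)))
        - 2 * (B a (M (N b)) * B l (N (M l))) - 2 * (B a (M (N b)) * B l (M (N l))) := by
  have e : resGrad B M U l a ∘L resGrad B N W l b
    = (M ∘L U) ∘L (N ∘L W) + (M ∘L U) ∘L rk B (N l) (N b) + B (N l) b • ((M ∘L U) ∘L N)
      - (2 : ℝ) • ((M ∘L U) ∘L rk B (N b) (N l))
      + rk B (M l) (M a) ∘L (N ∘L W) + rk B (M l) (M a) ∘L rk B (N l) (N b)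
      + B (N l) b • (rk B (M l) (M a) ∘L N) - (2 : ℝ) • (rk B (M l) (M a) ∘L rk B (N b) (N l))
      + B (M l) a • (M ∘L (N ∘L W)) + B (M l) a • (M ∘L rk B (N l) (N b))
      + (B (M l) a * B (N l) b) • (M ∘L N) - (2 * B (M l) a) • (M ∘L rk B (N b) (N l))
      - (2 : ℝ) • (rk B (M a) (M l) ∘L (N ∘L W)) - (2 : ℝ) • (rk B (M a) (M l) ∘L rk B (N l) (N b))
      - (2 * B (N l) b) • (rk B (M a) (M l) ∘L N)
      + (4 : ℝ) • (rk B (M a) (M l) ∘L rk B (N b) (N l)) := by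
    ext x
    simp only [resGrad, ContinuousLinearMap.comp_apply, add_apply, sub_apply, smul_apply, rk_apply,
      map_add, map_sub, map_smul]
    module
  rw [e]
  simp only [map_add, map_sub, map_smul, trL_comp_rk, trL_rk_comp, smul_eq_mul,
    ContinuousLinearMap.comp_apply, rk_apply, map_smul, smul_eq_mul, hM, hN]
  have s1 : B l (N b) = B b (N l) := by rw [hB, hN]
  have s2 : B l (M a) = B a (M l) := by rw [hB, hM]
  have s3 : B l (M (N (M a))) = B a (M (N (M l))) := by rw [hB, hM, hN, hM]
  have s4 : B l (N (M (U (N b)))) = B b (N (U (M (N l)))) := by rw [hB, hN, hM, hU, hN]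
  have s5 : B l (N (M (N b))) = B b (N (M (N l))) := by rw [hB, hN, hM, hN]
  have s6 : B l (M (N (W (M a)))) = B a (M (W (N (M l)))) := by rw [hB, hM, hN, hW, hM]
  have s7 : B b (N (M a)) = B a (M (N b)) := by rw [hB, hN, hM]
  have s8 : B l (M (N b)) = B b (N (M l)) := by rw [hB, hM, hN]
  have s9 : B l (N (M a)) = B a (M (N l)) := by rw [hB, hN, hM]
  have s10 : trL ((M ∘L U) ∘L N) = trL (N ∘L (M ∘L U)) := trL_comm _ _
  rw [s1, s2, s3, s4, s5, s6, s7, s8, s9, s10]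
  ring

/-- The trace is invariant under passing to adjoints with respect to a nondegenerate form. -/
lemma trL_eq_of_adjoint (B : E →L[ℝ] E →L[ℝ] ℝ)
    (hnd : ∀ x, (∀ y, B x y = 0) → x = 0) (S T : E →L[ℝ] E)
    (hST : ∀ x y, B (S x) y = B x (T y)) : trL S = trL T := by
  have hinj : Function.Injective ((ContinuousLinearMap.coeLM ℝ).comp (B : E →ₗ[ℝ] E →L[ℝ] ℝ)) := by
    rw [← LinearMap.ker_eq_bot, LinearMap.ker_eq_bot']
    intro x hx
    exact hnd x fun y => by simpa using DFunLike.congr_fun hx y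
  have hfr : Module.finrank ℝ E = Module.finrank ℝ (Module.Dual ℝ E) :=
    Subspace.dual_finrank_eq.symm
  let e : E ≃ₗ[ℝ] Module.Dual ℝ E := LinearEquiv.ofInjectiveOfFinrankEq _ hinj hfr
  have he : ∀ x y, e x y = B x y := fun x y => rfl
  have h1 : e.conj (S : E →ₗ[ℝ] E) = Module.Dual.transpose (R := ℝ) (T : E →ₗ[ℝ] E) := by
    ext φ y
    obtain ⟨x, rfl⟩ := e.surjective φ
    simp [LinearEquiv.conj_apply, Module.Dual.transpose, he, hST]
  rw [trL_eq_trace, trL_eq_trace, ← LinearMap.trace_conj' (S : E →ₗ[ℝ] E) e, h1]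
  exact LinearMap.trace_transpose' (T : E →ₗ[ℝ] E)

/-- Passing to the adjoint reverses the order of the factors, so that for self-adjoint factors `M`
and `N` may be exchanged. -/
lemma trL_comp_symm (B : E →L[ℝ] E →L[ℝ] ℝ)
    (hnd : ∀ x, (∀ y, B x y = 0) → x = 0) (M N U W : E →L[ℝ] E)
    (hM : ∀ x y, B (M x) y = B x (M y)) (hN : ∀ x y, B (N x) y = B x (N y))
    (hU : ∀ x y, B (U x) y = B x (U y)) (hW : ∀ x y, B (W x) y = B x (W y)) :
    trL ((M ∘L U) ∘L (N ∘L W)) = trL ((N ∘L U) ∘L (M ∘L W)) := by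
  rw [trL_eq_of_adjoint B hnd ((M ∘L U) ∘L (N ∘L W)) (W ∘L (N ∘L (U ∘L M)))
    (fun x y => by simp [hM, hN, hU, hW]), trL_comm]
  rfl

/-- The algebraic core of the commutation: for two resolvents `M`, `N` of the same endomorphism the
antisymmetrization of `tr (∇(δ M a) ∇(δ' N b))` is (minus) the divergence of
`c (B(b, P l) P a - B(a, P l) P b)` with `P = M - N`. -/
lemma trL_resGrad_comp_sub (B : E →L[ℝ] E →L[ℝ] ℝ) (hB : ∀ x y, B x y = B y x)
    (M N U W Λ : E →L[ℝ] E) (l a b : E) (c : ℝ)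
    (hM : ∀ x y, B (M x) y = B x (M y)) (hN : ∀ x y, B (N x) y = B x (N y))
    (hU : ∀ x y, B (U x) y = B x (U y)) (hW : ∀ x y, B (W x) y = B x (W y))
    (hΛ : ∀ x y, B (Λ x) y = B x (Λ y))
    (hnd : ∀ x, (∀ y, B x y = 0) → x = 0)
    (hMN : M ∘L N = c • (M - N)) (hNM : N ∘L M = c • (M - N)) :
    trL (resGrad B M U l a ∘L resGrad B N W l b) - trL (resGrad B N U l a ∘L resGrad B M W l b)
      = -(c * (
        (-2 * (B (M l) (M a - N a) + B (N l) (M a - N a)) * (B b (M l) - B b (N l))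
          + (resPair B M W Λ l b (M a - N a) - resPair B N W Λ l b (M a - N a))
          + (B b (M l) - B b (N l)) * (resDiv B M U l a - resDiv B N U l a))
        - (-2 * (B (M l) (M b - N b) + B (N l) (M b - N b)) * (B a (M l) - B a (N l))
          + (resPair B M U Λ l a (M b - N b) - resPair B N U Λ l a (M b - N b))
          + (B a (M l) - B a (N l)) * (resDiv B M W l b - resDiv B N W l b)))) := by
  have hMN' : ∀ x, M (N x) = c • (M x - N x) := fun x => by
    simpa using DFunLike.congr_fun hMN x
  have hNM' : ∀ x, N (M x) = c • (M x - N x) := fun x => by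
    simpa using DFunLike.congr_fun hNM x
  have t1 : ∀ V : E →L[ℝ] E, trL (N ∘L (M ∘L V)) = c * (trL (M ∘L V) - trL (N ∘L V)) := by
    intro V
    rw [← ContinuousLinearMap.comp_assoc, hNM]
    simp [ContinuousLinearMap.sub_comp]
  have t2 : ∀ V : E →L[ℝ] E, trL (M ∘L (N ∘L V)) = c * (trL (M ∘L V) - trL (N ∘L V)) := by
    intro V
    rw [← ContinuousLinearMap.comp_assoc, hMN]
    simp [ContinuousLinearMap.sub_comp]
  rw [trL_resGrad_comp B hB M N U W l a b hM hN hU hW,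
    trL_resGrad_comp B hB N M U W l a b hN hM hU hW, trL_comp_symm B hnd M N U W hM hN hU hW,
    t1, t2, t1, t2, hMN, hNM]
  simp only [resPair, resDiv, hMN', hNM', map_sub, map_smul, smul_eq_mul, hM, hN, hU, hW,
    sub_apply, smul_apply]
  have s : ∀ x y, B x (M y) = B y (M x) := fun x y => by rw [hB, hM]
  have s' : ∀ x y, B x (N y) = B y (N x) := fun x y => by rw [hB, hN]
  have m2 : ∀ x y, B x (M (M y)) = B y (M (M x)) := fun x y => by rw [hB, hM, hM]
  have n2 : ∀ x y, B x (N (N y)) = B y (N (N x)) := fun x y => by rw [hB, hN, hN]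
  have r1 : B b (M (Λ (M a))) = B a (M (Λ (M b))) := by rw [hB, hM, hΛ, hM]
  have r2 : B b (M (Λ (N a))) = B a (N (Λ (M b))) := by rw [hB, hM, hΛ, hN]
  have r3 : B b (N (Λ (M a))) = B a (M (Λ (N b))) := by rw [hB, hN, hΛ, hM]
  have r4 : B b (N (Λ (N a))) = B a (N (Λ (N b))) := by rw [hB, hN, hΛ, hN]
  rw [r1, r2, r3, r4, s l a, s l b, s' l a, s' l b, s b a, s' b a, m2 l a, m2 l b, n2 l a, n2 l b,
    m2 b a, n2 b a]
  ring

end ResolventAlgebra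

/-! ### The derivative of the determinant -/

section Jacobi

variable {E : Type*} [NormedAddCommGroup E] [NormedSpace ℝ E] [FiniteDimensional ℝ E]

lemma contDiff_det {m : WithTop ℕ∞} : ContDiff ℝ m (fun A : E →L[ℝ] E => A.det) := by
  let b := Module.finBasis ℝ E
  have h : (fun A : E →L[ℝ] E => A.det)
      = fun A : E →L[ℝ] E => ∑ σ : Equiv.Perm (Fin (Module.finrank ℝ E)),
        ((Equiv.Perm.sign σ : ℤ) : ℝ)
        * ∏ i, LinearMap.toMatrix b b (A : E →ₗ[ℝ] E) (σ i) i := by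
    funext A
    rw [ContinuousLinearMap.det, ← LinearMap.det_toMatrix b, Matrix.det_apply']
  rw [h]
  have hentry : ∀ i j, ContDiff ℝ m
      (fun A : E →L[ℝ] E => LinearMap.toMatrix b b (A : E →ₗ[ℝ] E) i j) := by
    intro i j
    have e : (fun A : E →L[ℝ] E => LinearMap.toMatrix b b (A : E →ₗ[ℝ] E) i j)
        = fun A => LinearMap.toContinuousLinearMap (b.coord i) (A (b j)) := by
      funext A
      simp [LinearMap.toMatrix_apply]
    rw [e]
    exact (ContinuousLinearMap.contDiff _).comp (contDiff_id.clm_apply contDiff_const)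
  exact ContDiff.sum fun σ _ => contDiff_const.mul (contDiff_prod fun i _ => hentry _ _)

/-- The expansion of `det (1 + t K)` to first order in `t`. -/
lemma det_one_add_smul_eq (K : E →L[ℝ] E) : ∃ q : ℝ[X], ∀ t : ℝ,
    (ContinuousLinearMap.id ℝ E + t • K).det = 1 + trL K * t + q.eval t * t ^ 2 := by
  let b := Module.finBasis ℝ E
  let N := LinearMap.toMatrix b b (K : E →ₗ[ℝ] E)
  refine ⟨(Matrix.det (1 + (X : ℝ[X]) • N.map C)).divX.divX, fun t => ?_⟩
  have h : (ContinuousLinearMap.id ℝ E + t • K).det = Matrix.det (1 + t • N) := by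
    rw [ContinuousLinearMap.det, ← LinearMap.det_toMatrix b]
    congr 1
    simp [N]
  rw [h, Matrix.det_one_add_smul, trL_eq_trace, LinearMap.trace_eq_matrix_trace ℝ b]

/-- Jacobi's formula for the derivative of the determinant at an invertible endomorphism. -/
lemma hasFDerivAt_det {A A' : E →L[ℝ] E} (hA : A ∘L A' = ContinuousLinearMap.id ℝ E) :
    ∃ D : (E →L[ℝ] E) →L[ℝ] ℝ, HasFDerivAt (fun A : E →L[ℝ] E => A.det) D A ∧
      ∀ H, D H = A.det * trL (A' ∘L H) := by
  have hd : DifferentiableAt ℝ (fun A : E →L[ℝ] E => A.det) A :=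
    (contDiff_det (m := 1)).contDiffAt.differentiableAt (by norm_num)
  refine ⟨_, hd.hasFDerivAt, fun H => ?_⟩
  have hline : HasDerivAt (fun t : ℝ => A + t • H) H 0 := by
    simpa using ((hasDerivAt_id (0 : ℝ)).smul_const H).const_add A
  have h1 : HasDerivAt (fun t : ℝ => (A + t • H).det)
      (fderiv ℝ (fun A : E →L[ℝ] E => A.det) A H) 0 := by
    have hd' : HasFDerivAt (fun A : E →L[ℝ] E => A.det)
        (fderiv ℝ (fun A : E →L[ℝ] E => A.det) A) (A + (0 : ℝ) • H) := by
      simpa using hd.hasFDerivAt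
    exact hd'.comp_hasDerivAt (0 : ℝ) hline
  obtain ⟨q, hq⟩ := det_one_add_smul_eq (A' ∘L H)
  have h2 : (fun t : ℝ => (A + t • H).det)
      = fun t => A.det * (1 + trL (A' ∘L H) * t + q.eval t * t ^ 2) := by
    funext t
    rw [← hq t]
    have : A + t • H = A ∘L (ContinuousLinearMap.id ℝ E + t • (A' ∘L H)) := by
      rw [ContinuousLinearMap.comp_add, ContinuousLinearMap.comp_smul,
        ← ContinuousLinearMap.comp_assoc, hA]
      simp
    rw [this]
    exact LinearMap.det_comp _ _
  have h3 : HasDerivAt (fun t : ℝ => A.det * (1 + trL (A' ∘L H) * t + q.eval t * t ^ 2))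
      (A.det * trL (A' ∘L H)) 0 := by
    have h := ((((hasDerivAt_id (0 : ℝ)).const_mul (trL (A' ∘L H))).const_add 1).add
      ((q.hasDerivAt 0).mul ((hasDerivAt_id (0 : ℝ)).pow 2))).const_mul A.det
    refine (h.congr_deriv ?_).congr_of_eventuallyEq ?_
    · simp
    · exact Eventually.of_forall fun t => by simp
  exact (h1.congr_of_eventuallyEq (Eventually.of_forall fun t => (congrFun h2 t).symm)).unique h3

end Jacobi

/-! ### Metrics with a Benenti tensor and their resolvents -/

section ResolventFields

variable {E : Type*} [NormedAddCommGroup E] [NormedSpace ℝ E] [FiniteDimensional ℝ E]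

/-- Local data on an open set `U` of a vector space: a `C²` metric `B` with its Levi-Civita
connection `Γ` and its volume density `ρ`. The density enters through `d log ρ = tr Γ`, which
fixes it only up to a locally constant factor. -/
structure MetricGeometry (U : Set E) (B : E → E →L[ℝ] E →L[ℝ] ℝ) (Γ : E → E →L[ℝ] E →L[ℝ] E)
    (ρ : E → ℝ) : Prop where
  isOpen : IsOpen U
  contDiffAt_B : ∀ z ∈ U, ContDiffAt ℝ 2 B z
  symm : ∀ z ∈ U, ∀ x y, B z x y = B z y x
  pos : ∀ z ∈ U, ∀ x, x ≠ 0 → 0 < B z x x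
  contDiffAt_Γ : ∀ z ∈ U, ContDiffAt ℝ 1 Γ z
  torsion_free : ∀ z ∈ U, ∀ x y, Γ z x y = Γ z y x
  compat : ∀ z ∈ U, ∀ x y w, fderiv ℝ B z x y w = B z (Γ z x y) w + B z y (Γ z x w)
  contDiffAt_ρ : ∀ z ∈ U, ContDiffAt ℝ 2 ρ z
  pos_ρ : ∀ z ∈ U, 0 < ρ z
  fderiv_ρ : ∀ z ∈ U, ∀ x, fderiv ℝ ρ z x = ρ z * trL (Γ z x)

/-- A metric geometry together with a `C²` endomorphism field `L`, self-adjoint for `B`, which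
satisfies `∇ₓ L = l ⊗ x♭ + x ⊗ l♭` for a vector field `l`. -/
structure BMGeometry (U : Set E) (B : E → E →L[ℝ] E →L[ℝ] ℝ) (Γ : E → E →L[ℝ] E →L[ℝ] E)
    (ρ : E → ℝ) (L : E → E →L[ℝ] E) (l : E → E) : Prop extends MetricGeometry U B Γ ρ where
  contDiffAt_L : ∀ z ∈ U, ContDiffAt ℝ 2 L z
  symm_L : ∀ z ∈ U, ∀ x y, B z (L z x) y = B z x (L z y)
  contDiffAt_l : ∀ z ∈ U, ContDiffAt ℝ 1 l z
  fderiv_L : ∀ z ∈ U, ∀ x y, fderiv ℝ L z x y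
    = B z (l z) y • x + B z x y • l z - Γ z x (L z y) + L z (Γ z x y)

/-- The resolvent `(s - L)⁻¹` of an endomorphism field. -/
def resolv (L : E → E →L[ℝ] E) (s : ℝ) (z : E) : E →L[ℝ] E :=
  Ring.inverse (s • (1 : E →L[ℝ] E) - L z)

/-- The function `det (s - L)` of an endomorphism field `L`. -/
def resDet (L : E → E →L[ℝ] E) (s : ℝ) (z : E) : ℝ := (s • (1 : E →L[ℝ] E) - L z).det

omit [FiniteDimensional ℝ E] in
lemma resolv_apply_sub {L : E → E →L[ℝ] E} {s : ℝ} {z : E}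
    (hs : IsUnit (s • (1 : E →L[ℝ] E) - L z)) (x : E) :
    resolv L s z (s • x - L z x) = x := by
  have := DFunLike.congr_fun (Ring.inverse_mul_cancel _ hs) x
  simpa [resolv] using this

omit [FiniteDimensional ℝ E] in
lemma L_resolv_apply {L : E → E →L[ℝ] E} {s : ℝ} {z : E}
    (hs : IsUnit (s • (1 : E →L[ℝ] E) - L z)) (x : E) :
    L z (resolv L s z x) = s • resolv L s z x - x := by
  have := DFunLike.congr_fun (Ring.mul_inverse_cancel _ hs) x
  have h : s • resolv L s z x - L z (resolv L s z x) = x := by simpa [resolv] using this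
  rw [← sub_eq_iff_eq_add.2 (sub_eq_iff_eq_add'.1 h)]

omit [FiniteDimensional ℝ E] in
lemma resolv_L_apply {L : E → E →L[ℝ] E} {s : ℝ} {z : E}
    (hs : IsUnit (s • (1 : E →L[ℝ] E) - L z)) (x : E) :
    resolv L s z (L z x) = s • resolv L s z x - x := by
  have h := resolv_apply_sub hs x
  rw [map_sub, map_smul] at h
  rw [← sub_eq_iff_eq_add.2 (sub_eq_iff_eq_add'.1 h)]

omit [FiniteDimensional ℝ E] in
/-- The resolvent identity. -/
lemma resolv_comp_resolv {L : E → E →L[ℝ] E} {s t : ℝ} {z : E} (hst : s ≠ t)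
    (hs : IsUnit (s • (1 : E →L[ℝ] E) - L z)) (ht : IsUnit (t • (1 : E →L[ℝ] E) - L z)) :
    resolv L s z ∘L resolv L t z = (t - s)⁻¹ • (resolv L s z - resolv L t z) := by
  ext x
  have h := L_resolv_apply ht x
  have h2 := resolv_L_apply hs (resolv L t z x)
  rw [h, map_sub, map_smul] at h2
  have hne : t - s ≠ 0 := sub_ne_zero.2 hst.symm
  have h3 : (t - s) • resolv L s z (resolv L t z x) = resolv L s z x - resolv L t z x := by
    rw [sub_smul]
    rw [sub_eq_iff_eq_add] at h2
    rw [h2]; abel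
  simp only [ContinuousLinearMap.comp_apply, smul_apply, sub_apply]
  rw [← h3, smul_smul, inv_mul_cancel₀ hne, one_smul]

variable {U : Set E} {B : E → E →L[ℝ] E →L[ℝ] ℝ} {Γ : E → E →L[ℝ] E →L[ℝ] E}
  {ρ : E → ℝ} {L : E → E →L[ℝ] E} {l : E → E}

lemma MetricGeometry.nondeg (hG : MetricGeometry U B Γ ρ) {z : E} (hz : z ∈ U) (x : E)
    (hx : ∀ y, B z x y = 0) : x = 0 := by
  by_contra h
  exact (hG.pos z hz x h).ne' (hx x)

namespace BMGeometry

lemma symm_resolv (hG : BMGeometry U B Γ ρ L l) {z : E} (hz : z ∈ U) {s : ℝ}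
    (hs : IsUnit (s • (1 : E →L[ℝ] E) - L z)) (x y : E) :
    B z (resolv L s z x) y = B z x (resolv L s z y) := by
  have hy : s • resolv L s z y - L z (resolv L s z y) = y := by rw [L_resolv_apply hs]; abel
  have hx : s • resolv L s z x - L z (resolv L s z x) = x := by rw [L_resolv_apply hs]; abel
  conv_lhs => rw [← hy]
  conv_rhs => rw [← hx]
  simp [hG.symm_L z hz]

lemma resolv_swap (hG : BMGeometry U B Γ ρ L l) {z : E} (hz : z ∈ U) {s : ℝ}
    (hs : IsUnit (s • (1 : E →L[ℝ] E) - L z)) (x y : E) :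
    B z (resolv L s z x) y = B z (resolv L s z y) x := by
  rw [hG.symm_resolv hz hs, hG.symm z hz]

lemma contDiffAt_resolv (hG : BMGeometry U B Γ ρ L l) {z : E} (hz : z ∈ U) {s : ℝ}
    (hs : IsUnit (s • (1 : E →L[ℝ] E) - L z)) : ContDiffAt ℝ 2 (resolv L s) z := by
  obtain ⟨u, hu⟩ := hs
  have h1 : ContDiffAt ℝ 2 (fun z => s • (1 : E →L[ℝ] E) - L z) z :=
    contDiffAt_const.sub (hG.contDiffAt_L z hz)
  have h2 := contDiffAt_ringInverse (n := 2) ℝ u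
  rw [hu] at h2
  exact h2.comp z h1

lemma contDiffAt_resDet (hG : BMGeometry U B Γ ρ L l) {z : E} (hz : z ∈ U) (s : ℝ) :
    ContDiffAt ℝ 2 (resDet L s) z := by
  have h1 : ContDiffAt ℝ 2 (fun z => s • (1 : E →L[ℝ] E) - L z) z :=
    contDiffAt_const.sub (hG.contDiffAt_L z hz)
  exact contDiff_det.contDiffAt.comp z h1

lemma fderiv_resolv (hG : BMGeometry U B Γ ρ L l) {z : E} (hz : z ∈ U) {s : ℝ}
    (hs : IsUnit (s • (1 : E →L[ℝ] E) - L z)) (x y : E) :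
    fderiv ℝ (resolv L s) z x y
      = B z (resolv L s z (l z)) y • resolv L s z x
        + B z (resolv L s z x) y • resolv L s z (l z)
        + resolv L s z (Γ z x y) - Γ z x (resolv L s z y) := by
  have hs' := hs
  obtain ⟨u, hu⟩ := hs'
  have h1 : HasFDerivAt (fun z => s • (1 : E →L[ℝ] E) - L z) (-fderiv ℝ L z) z :=
    (((hG.contDiffAt_L z hz).differentiableAt (by norm_num)).hasFDerivAt).const_sub _
  have h2 := hasFDerivAt_ringInverse (𝕜 := ℝ) u
  rw [hu] at h2
  have h3 : HasFDerivAt (resolv L s) _ z := h2.comp z h1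
  have hM : (↑u⁻¹ : E →L[ℝ] E) = resolv L s z := by
    rw [resolv, ← hu, Ring.inverse_unit]
  have h4 : fderiv ℝ (resolv L s) z x y
      = resolv L s z (fderiv ℝ L z x (resolv L s z y)) := by
    rw [h3.fderiv, hM]
    simp [ContinuousLinearMap.mulLeftRight_apply]
  rw [h4, hG.fderiv_L z hz]
  simp only [map_add, map_sub, map_smul, L_resolv_apply hs, resolv_L_apply hs,
    hG.symm_resolv hz hs]
  abel

lemma fderiv_resDet (hG : BMGeometry U B Γ ρ L l) {z : E} (hz : z ∈ U) {s : ℝ}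
    (hs : IsUnit (s • (1 : E →L[ℝ] E) - L z)) (x : E) :
    fderiv ℝ (resDet L s) z x = -2 * resDet L s z * B z (resolv L s z (l z)) x := by
  have h1 : HasFDerivAt (fun z => s • (1 : E →L[ℝ] E) - L z) (-fderiv ℝ L z) z :=
    (((hG.contDiffAt_L z hz).differentiableAt (by norm_num)).hasFDerivAt).const_sub _
  obtain ⟨D, hD, hD'⟩ := hasFDerivAt_det (A := s • (1 : E →L[ℝ] E) - L z) (A' := resolv L s z)
    (Ring.mul_inverse_cancel _ hs)
  have h3 : HasFDerivAt (resDet L s) _ z := hD.comp z h1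
  have e : resolv L s z ∘L fderiv ℝ L z x = resolv L s z ∘L rk (B z) x (l z)
      + resolv L s z ∘L rk (B z) (l z) x - (resolv L s z ∘L Γ z x) ∘L L z
      + L z ∘L (resolv L s z ∘L Γ z x) := by
    ext y
    simp only [ContinuousLinearMap.comp_apply, add_apply, sub_apply, rk_apply,
      hG.fderiv_L z hz, map_add, map_sub, map_smul, L_resolv_apply hs, resolv_L_apply hs]
  rw [h3.fderiv, ContinuousLinearMap.comp_apply, hD']
  have e2 : trL (resolv L s z ∘L fderiv ℝ L z x) = 2 * B z (resolv L s z (l z)) x := by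
    rw [e, map_add, map_sub, map_add, trL_comp_rk, trL_comp_rk,
      trL_comm (resolv L s z ∘L Γ z x) (L z), hG.symm z hz x, ← hG.symm_resolv hz hs]
    ring
  rw [neg_apply, ContinuousLinearMap.comp_neg, map_neg, e2, resDet]
  ring

/-- `∇ (δ M a)` for the resolvent `M` and `δ = det (s - L)`. -/
lemma cov_resDet_smul (hG : BMGeometry U B Γ ρ L l) {z : E} (hz : z ∈ U) {s : ℝ}
    (hs : IsUnit (s • (1 : E →L[ℝ] E) - L z)) {a : E → E} (ha : DifferentiableAt ℝ a z) :
    cov Γ (fun y => resDet L s y • resolv L s y (a y)) z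
      = resDet L s z • resGrad (B z) (resolv L s z) (cov Γ a z) (l z) (a z) := by
  have h1 := ((hG.contDiffAt_resDet hz s).differentiableAt (by norm_num)).hasFDerivAt
  have h2 := ((hG.contDiffAt_resolv hz hs).differentiableAt (by norm_num)).hasFDerivAt
  have h3 := h1.fun_smul (h2.clm_apply ha.hasFDerivAt)
  ext x
  rw [cov, h3.fderiv]
  simp only [resGrad, cov, add_apply, smul_apply, sub_apply, ContinuousLinearMap.comp_apply,
    ContinuousLinearMap.flip_apply, ContinuousLinearMap.smulRight_apply, rk_apply, map_add,
    map_smul, hG.fderiv_resolv hz hs, hG.fderiv_resDet hz hs, hG.resolv_swap hz hs x]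
  module

lemma divC_resolv (hG : BMGeometry U B Γ ρ L l) {z : E} (hz : z ∈ U) {s : ℝ}
    (hs : IsUnit (s • (1 : E →L[ℝ] E) - L z)) {a : E → E} (ha : DifferentiableAt ℝ a z) :
    divC Γ (fun y => resolv L s y (a y)) z
      = resDiv (B z) (resolv L s z) (cov Γ a z) (l z) (a z) := by
  have h2 := ((hG.contDiffAt_resolv hz hs).differentiableAt (by norm_num)).hasFDerivAt
  have h3 := h2.clm_apply ha.hasFDerivAt
  have hflip : trL (Γ z (resolv L s z (a z))) = trL ((Γ z).flip (resolv L s z (a z))) := by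
    congr 1; ext x; simp [hG.torsion_free z hz x]
  have e : (resolv L s z ∘L fderiv ℝ a z + (fderiv ℝ (resolv L s) z).flip (a z))
      + (Γ z).flip (resolv L s z (a z))
      = resolv L s z ∘L cov Γ a z + ContinuousLinearMap.id ℝ E ∘L
        rk (B z) (resolv L s z (l z)) (resolv L s z (a z))
        + B z (resolv L s z (l z)) (a z) • resolv L s z := by
    ext x
    simp only [cov, add_apply, smul_apply, ContinuousLinearMap.comp_apply,
      ContinuousLinearMap.flip_apply, rk_apply, map_add, hG.fderiv_resolv hz hs,
      hG.resolv_swap hz hs x, ContinuousLinearMap.id_apply]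
    abel
  rw [divC, h3.fderiv, hflip, ← map_add, e, map_add, map_add, trL_comp_rk, map_smul, resDiv,
    smul_eq_mul, ContinuousLinearMap.id_apply, hG.symm z hz (resolv L s z (a z))]

/-- The differential of `B(b, M l)`. -/
lemma fderiv_pairing (hG : BMGeometry U B Γ ρ L l) {z : E} (hz : z ∈ U) {s : ℝ}
    (hs : IsUnit (s • (1 : E →L[ℝ] E) - L z)) {b : E → E} (hb : DifferentiableAt ℝ b z) (x : E) :
    fderiv ℝ (fun y => B y (b y) (resolv L s y (l y))) z x
      = resPair (B z) (resolv L s z) (cov Γ b z) (cov Γ l z) (l z) (b z) x := by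
  have h0 := ((hG.contDiffAt_B z hz).differentiableAt (by norm_num)).hasFDerivAt
  have h1 := ((hG.contDiffAt_l z hz).differentiableAt (by norm_num)).hasFDerivAt
  have h2 := ((hG.contDiffAt_resolv hz hs).differentiableAt (by norm_num)).hasFDerivAt
  have h3 := (h0.clm_apply hb.hasFDerivAt).clm_apply (h2.clm_apply h1)
  rw [h3.fderiv]
  simp only [resPair, cov, add_apply, ContinuousLinearMap.comp_apply,
    ContinuousLinearMap.flip_apply, map_add, map_sub, map_smul, smul_eq_mul,
    hG.fderiv_resolv hz hs, hG.compat z hz]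
  ring

end BMGeometry

/-- Projectively equivalent connections. If the Levi-Civita connections of `B` and `B'` satisfy
`Γ' = Γ + ψ ⊗ id + id ⊗ ψ` and `dD = 2 D ψ`, then the endomorphism `L` with `B'(L x, y) = D B(x, y)`
satisfies the equation of a `BMGeometry` for `B`. -/
lemma MetricGeometry.bmGeometry {B' : E → E →L[ℝ] E →L[ℝ] ℝ} {Γ' : E → E →L[ℝ] E →L[ℝ] E}
    {ρ' : E → ℝ} (hG : MetricGeometry U B Γ ρ) (hG' : MetricGeometry U B' Γ' ρ')
    {ψ : E → E →L[ℝ] ℝ} {D : E → ℝ}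
    (hΓ : ∀ z ∈ U, ∀ x y, Γ' z x y = Γ z x y + ψ z x • y + ψ z y • x)
    (hD : ∀ z ∈ U, DifferentiableAt ℝ D z) (hD0 : ∀ z ∈ U, D z ≠ 0)
    (hD' : ∀ z ∈ U, ∀ x, fderiv ℝ D z x = 2 * D z * ψ z x)
    (hL : ∀ z ∈ U, ContDiffAt ℝ 2 L z) (hl : ∀ z ∈ U, ContDiffAt ℝ 1 l z)
    (hL' : ∀ z ∈ U, ∀ x y, B' z (L z x) y = D z * B z x y)
    (hl' : ∀ z ∈ U, ∀ y, B' z (l z) y = -(D z * ψ z y)) : BMGeometry U B Γ ρ L l where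
  toMetricGeometry := hG
  contDiffAt_L := hL
  contDiffAt_l := hl
  symm_L z hz x y := by
    refine mul_left_cancel₀ (hD0 z hz) ?_
    rw [hG.symm z hz, ← hL' z hz, ← hL' z hz, hG'.symm z hz]
  fderiv_L z hz x y := by
    rw [← sub_eq_zero]
    refine hG'.nondeg hz _ fun w => ?_
    have hB := ((hG.contDiffAt_B z hz).differentiableAt (by norm_num)).hasFDerivAt
    have hB' := ((hG'.contDiffAt_B z hz).differentiableAt (by norm_num)).hasFDerivAt
    have hLd := ((hL z hz).differentiableAt (by norm_num)).hasFDerivAt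
    have h1 := (hB'.clm_apply (hLd.clm_apply (hasFDerivAt_const y z))).clm_apply
      (hasFDerivAt_const w z)
    have h2 := (hD z hz).hasFDerivAt.mul
      ((hB.clm_apply (hasFDerivAt_const y z)).clm_apply (hasFDerivAt_const w z))
    have h3 : (fun v => B' v (L v y) w) =ᶠ[𝓝 z] fun v => D v * B v y w := by
      filter_upwards [hG.isOpen.mem_nhds hz] with v hv using hL' v hv y w
    have h4 := DFunLike.congr_fun (h1.unique (h2.congr_of_eventuallyEq h3)) x
    simp only [add_apply, ContinuousLinearMap.comp_apply, zero_apply, map_zero, zero_add,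
      ContinuousLinearMap.flip_apply, smul_apply, smul_eq_mul, hG.compat z hz, hG'.compat z hz,
      hΓ z hz, hD' z hz, map_add, map_smul, hL' z hz] at h4
    have h5 : B z (l z) y = -ψ z (L z y) := by
      refine mul_left_cancel₀ (hD0 z hz) ?_
      rw [hG.symm z hz, ← hL' z hz, hG'.symm z hz, hl' z hz]
      ring
    simp only [map_add, map_sub, map_smul, add_apply, sub_apply, smul_apply, smul_eq_mul, h5,
      hl' z hz, hL' z hz, hG.symm z hz x y]
    linarith

end ResolventFields

/-! ### Symmetries of the curvature -/

section Curvature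

variable {E : Type*} [NormedAddCommGroup E] [NormedSpace ℝ E]

/-- Symmetry of second derivatives, for a function whose first derivative is given by a formula
near the point. -/
lemma fderiv_fderiv_symm {V : Type*} [NormedAddCommGroup V] [NormedSpace ℝ V] {F : E → V} {z : E}
    (hF : ContDiffAt ℝ 2 F z) {G : E → E → V} (h : ∀ᶠ w in 𝓝 z, ∀ y, fderiv ℝ F w y = G y w)
    {D : E → E →L[ℝ] V} (hD : ∀ y, HasFDerivAt (G y) (D y) z) (x y : E) : D y x = D x y := by
  have h1 : HasFDerivAt (fderiv ℝ F) (fderiv ℝ (fderiv ℝ F) z) z :=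
    ((hF.fderiv_right (m := 1) (by norm_num)).differentiableAt (by norm_num)).hasFDerivAt
  have h2 : ∀ y x, D y x = fderiv ℝ (fderiv ℝ F) z x y := by
    intro y x
    have h3 := h1.clm_apply (hasFDerivAt_const y z)
    have h4 := (hD y).congr_of_eventuallyEq (h.mono fun w hw => hw y)
    simpa using DFunLike.congr_fun (h4.unique h3) x
  rw [h2, h2]
  exact (hF.isSymmSndFDerivAt (by simp)).eq x y

/-- The pair symmetry of a curvature-like form, from its skew-symmetries and the Bianchi
identity. -/
lemma pair_symm_of_bianchi {V : Type*} (Q : V → V → V → V → ℝ)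
    (h1 : ∀ a b c d, Q a b c d = -Q b a c d) (h2 : ∀ a b c d, Q a b c d = -Q a b d c)
    (h3 : ∀ a b c d, Q a b c d + Q b c a d + Q c a b d = 0) (a b c d : V) :
    Q a b c d = Q c d a b := by
  have e1 := h3 a b c d
  have e2 := h3 b c d a
  have e3 := h3 c d a b
  have e4 := h3 d a b c
  have f1 := h2 b c a d
  have f2 := h1 c a b d
  have f3 := h2 c d b a
  have f4 := h1 d b c a
  have f5 := h2 d a c b
  have f6 := h1 a c d b
  have f7 := h2 a b d c
  have f8 := h1 b d a c
  have g1 := h2 a c b d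
  have g2 := h2 b d c a
  have g3 := h2 d a b c
  have g4 := h1 d a b c
  have g5 := h1 a d b c
  have g6 := h2 b c d a
  linarith

variable [FiniteDimensional ℝ E]
variable {U : Set E} {B : E → E →L[ℝ] E →L[ℝ] ℝ} {Γ : E → E →L[ℝ] E →L[ℝ] E}
  {ρ : E → ℝ} {L : E → E →L[ℝ] E} {l : E → E}

namespace BMGeometry

/-- The covariant derivative of `l` is self-adjoint, since `2 l♭ = d tr L`. -/
lemma symm_cov_l (hG : BMGeometry U B Γ ρ L l) {z : E} (hz : z ∈ U) (x y : E) :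
    B z (cov Γ l z x) y = B z x (cov Γ l z y) := by
  have hU := hG.isOpen.mem_nhds hz
  have hF : ContDiffAt ℝ 2 (fun w => trL (L w)) z :=
    (trL (E := E)).contDiff.contDiffAt.comp z (hG.contDiffAt_L z hz)
  have hF1 : ∀ᶠ w in 𝓝 z, ∀ y, fderiv ℝ (fun w => trL (L w)) w y = 2 * B w (l w) y := by
    filter_upwards [hU] with w hw y
    have h1 := ((hG.contDiffAt_L w hw).differentiableAt (by norm_num)).hasFDerivAt
    have h2 : HasFDerivAt (fun w => trL (L w)) _ w := (trL (E := E)).hasFDerivAt.comp w h1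
    have e : fderiv ℝ L w y = ContinuousLinearMap.id ℝ E ∘L rk (B w) y (l w)
        + ContinuousLinearMap.id ℝ E ∘L rk (B w) (l w) y - Γ w y ∘L L w + L w ∘L Γ w y := by
      ext v
      simp [hG.fderiv_L w hw]
    rw [h2.fderiv, ContinuousLinearMap.comp_apply, e, map_add, map_sub, map_add, trL_comp_rk,
      trL_comp_rk, trL_comm, ContinuousLinearMap.id_apply, ContinuousLinearMap.id_apply,
      hG.symm w hw y]
    ring
  have hD : ∀ y, HasFDerivAt (fun w => 2 * B w (l w) y) _ z := fun y =>
    ((((hG.contDiffAt_B z hz).differentiableAt (by norm_num)).hasFDerivAt.clm_apply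
      ((hG.contDiffAt_l z hz).differentiableAt (by norm_num)).hasFDerivAt).clm_apply
        (hasFDerivAt_const y z)).const_mul 2
  have h := fderiv_fderiv_symm hF hF1 hD x y
  simp only [smul_apply, add_apply, ContinuousLinearMap.comp_apply, zero_apply, map_zero, zero_add,
    ContinuousLinearMap.flip_apply, hG.compat z hz, smul_eq_mul] at h
  rw [hG.symm z hz x]
  simp only [cov, add_apply, ContinuousLinearMap.flip_apply, map_add]
  rw [hG.torsion_free z hz y x] at h
  linarith

/-- The curvature is skew-adjoint, since the second derivatives of `B` commute. -/
lemma curv_skew (hG : BMGeometry U B Γ ρ L l) {z : E} (hz : z ∈ U) (j k y w : E) :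
    B z (curv Γ z j k y) w = -B z y (curv Γ z j k w) := by
  have hU := hG.isOpen.mem_nhds hz
  have hF : ContDiffAt ℝ 2 (fun v => B v y w) z :=
    ((hG.contDiffAt_B z hz).clm_apply contDiffAt_const).clm_apply contDiffAt_const
  have hB := fun v hv => ((hG.contDiffAt_B v hv).differentiableAt (by norm_num)).hasFDerivAt
  have hΓ := ((hG.contDiffAt_Γ z hz).differentiableAt (by norm_num)).hasFDerivAt
  have hF1 : ∀ᶠ v in 𝓝 z, ∀ k, fderiv ℝ (fun v => B v y w) v k
      = B v (Γ v k y) w + B v y (Γ v k w) := by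
    filter_upwards [hU] with v hv k
    rw [(((hB v hv).clm_apply (hasFDerivAt_const y v)).clm_apply (hasFDerivAt_const w v)).fderiv]
    simp [hG.compat v hv]
  have hc : ∀ k y, HasFDerivAt (fun v => Γ v k y) _ z := fun k y =>
    (hΓ.clm_apply (hasFDerivAt_const k z)).clm_apply (hasFDerivAt_const y z)
  have hD : ∀ k, HasFDerivAt (fun v => B v (Γ v k y) w + B v y (Γ v k w)) _ z := fun k =>
    (((hB z hz).clm_apply (hc k y)).clm_apply (hasFDerivAt_const w z)).add
    (((hB z hz).clm_apply (hasFDerivAt_const y z)).clm_apply (hc k w))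
  have h := fderiv_fderiv_symm hF hF1 hD j k
  simp only [add_apply, ContinuousLinearMap.comp_apply, zero_apply, map_zero, zero_add,
    ContinuousLinearMap.flip_apply, hG.compat z hz] at h
  simp only [curv, add_apply, sub_apply, ContinuousLinearMap.comp_apply, map_add, map_sub]
  linarith

omit [FiniteDimensional ℝ E] in
lemma curv_antisymm (Γ : E → E →L[ℝ] E →L[ℝ] E) (z j k y : E) :
    curv Γ z j k y = -curv Γ z k j y := by
  simp only [curv, add_apply, sub_apply, ContinuousLinearMap.comp_apply]
  abel

lemma eventually_torsion_free (hG : BMGeometry U B Γ ρ L l) {z : E} (hz : z ∈ U) :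
    ∀ᶠ w in 𝓝 z, ∀ x y, Γ w x y = Γ w y x := by
  filter_upwards [hG.isOpen.mem_nhds hz] with w hw using hG.torsion_free w hw

lemma fderiv_Γ_symm (hG : BMGeometry U B Γ ρ L l) {z : E} (hz : z ∈ U) (j x y : E) :
    fderiv ℝ Γ z j x y = fderiv ℝ Γ z j y x :=
  fderiv_symm_of_eventually (hG.eventually_torsion_free hz)
    ((hG.contDiffAt_Γ z hz).differentiableAt (by norm_num)) j x y

/-- The first Bianchi identity. -/
lemma curv_bianchi (hG : BMGeometry U B Γ ρ L l) {z : E} (hz : z ∈ U) (j k y : E) :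
    curv Γ z j k y + curv Γ z k y j + curv Γ z y j k = 0 := by
  simp only [curv, add_apply, sub_apply, ContinuousLinearMap.comp_apply]
  rw [hG.fderiv_Γ_symm hz j k y, hG.fderiv_Γ_symm hz k y j, hG.fderiv_Γ_symm hz y j k,
    hG.torsion_free z hz k y, hG.torsion_free z hz j y, hG.torsion_free z hz k j]
  abel

/-- The pair symmetry of the curvature. -/
lemma curv_pair_symm (hG : BMGeometry U B Γ ρ L l) {z : E} (hz : z ∈ U) (j k a m : E) :
    B z (curv Γ z j k a) m = B z (curv Γ z a m j) k := by
  refine pair_symm_of_bianchi (fun j k a m => B z (curv Γ z j k a) m) ?_ ?_ ?_ j k a m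
  · intro a b c d
    simp [curv_antisymm Γ z a b c]
  · intro a b c d
    rw [hG.curv_skew hz, hG.symm z hz]
  · intro a b c d
    have := congrArg (fun v => B z v d) (hG.curv_bianchi hz a b c)
    simpa using this

/-- The Ricci identity for `L`. -/
lemma curv_comm_L (hG : BMGeometry U B Γ ρ L l) {z : E} (hz : z ∈ U) (j k y : E) :
    curv Γ z j k (L z y) = L z (curv Γ z j k y)
      + (B z (cov Γ l z j) y • k + B z k y • cov Γ l z j)
      - (B z (cov Γ l z k) y • j + B z j y • cov Γ l z k) := by
  have hU := hG.isOpen.mem_nhds hz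
  have hL := fun v hv => ((hG.contDiffAt_L v hv).differentiableAt (by norm_num)).hasFDerivAt
  have hF : ContDiffAt ℝ 2 (fun v => L v y) z :=
    (hG.contDiffAt_L z hz).clm_apply contDiffAt_const
  have hB := ((hG.contDiffAt_B z hz).differentiableAt (by norm_num)).hasFDerivAt
  have hl := ((hG.contDiffAt_l z hz).differentiableAt (by norm_num)).hasFDerivAt
  have hΓ := ((hG.contDiffAt_Γ z hz).differentiableAt (by norm_num)).hasFDerivAt
  have hF1 : ∀ᶠ v in 𝓝 z, ∀ k, fderiv ℝ (fun v => L v y) v k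
      = B v (l v) y • k + B v k y • l v - Γ v k (L v y) + L v (Γ v k y) := by
    filter_upwards [hU] with v hv k
    rw [((hL v hv).clm_apply (hasFDerivAt_const y v)).fderiv]
    simp [hG.fderiv_L v hv]
  have hy : HasFDerivAt (fun _ : E => y) (0 : E →L[ℝ] E) z := hasFDerivAt_const y z
  have hc := fun k : E => hΓ.clm_apply (hasFDerivAt_const k z)
  have hD : ∀ k, HasFDerivAt (fun v => B v (l v) y • k + B v k y • l v - Γ v k (L v y)
      + L v (Γ v k y)) _ z := fun k =>
    (((((hB.clm_apply hl).clm_apply hy).smul_const k).add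
      (((hB.clm_apply (hasFDerivAt_const k z)).clm_apply hy).fun_smul hl)).sub
      ((hc k).clm_apply ((hL z hz).clm_apply hy))).add
      ((hL z hz).clm_apply ((hc k).clm_apply hy))
  have h := fderiv_fderiv_symm hF hF1 hD j k
  simp only [add_apply, sub_apply, smul_apply, ContinuousLinearMap.comp_apply, zero_apply, map_zero,
    zero_add, ContinuousLinearMap.flip_apply, ContinuousLinearMap.smulRight_apply,
    hG.compat z hz, map_add, map_sub, hG.fderiv_L z hz, map_smul] at h
  rw [hG.torsion_free z hz k j] at h
  simp only [curv, cov, add_apply, sub_apply, ContinuousLinearMap.comp_apply, map_add, map_sub,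
    ContinuousLinearMap.flip_apply]
  linear_combination (norm := module) (-1 : ℝ) • h

/-- The Ricci form is symmetric, since the trace of `Γ` is the closed form `d log ρ`. -/
lemma ricci_symm (hG : BMGeometry U B Γ ρ L l) {z : E} (hz : z ∈ U) (x y : E) :
    ricci Γ z x y = ricci Γ z y x := by
  have hU := hG.isOpen.mem_nhds hz
  have hΓ := ((hG.contDiffAt_Γ z hz).differentiableAt (by norm_num)).hasFDerivAt
  have h1 : trL (fderiv ℝ Γ z x y) = trL (fderiv ℝ Γ z y x) := by
    have hF : ContDiffAt ℝ 2 (fun w => Real.log (ρ w)) z :=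
      (hG.contDiffAt_ρ z hz).log (hG.pos_ρ z hz).ne'
    have hF1 : ∀ᶠ w in 𝓝 z, ∀ y, fderiv ℝ (fun w => Real.log (ρ w)) w y = trL (Γ w y) := by
      filter_upwards [hU] with w hw y
      have := ((hG.contDiffAt_ρ w hw).differentiableAt (by norm_num)).hasFDerivAt.log
        (hG.pos_ρ w hw).ne'
      rw [this.fderiv, smul_apply, hG.fderiv_ρ w hw, smul_eq_mul, ← mul_assoc,
        inv_mul_cancel₀ (hG.pos_ρ w hw).ne', one_mul]
    have hD : ∀ y, HasFDerivAt (fun w => trL (Γ w y)) _ z := fun y =>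
      (trL (E := E)).hasFDerivAt.comp z (hΓ.clm_apply (hasFDerivAt_const y z))
    have h := fderiv_fderiv_symm hF hF1 hD x y
    simpa only [ContinuousLinearMap.comp_apply, add_apply, ContinuousLinearMap.flip_apply,
      zero_apply, map_zero, zero_add] using h
  have h2 : ∀ x y, ricci Γ z x y = trL (((fderiv ℝ Γ z).flip x).flip y) - trL (fderiv ℝ Γ z x y)
      + trL ((Γ z).flip (Γ z x y)) - trL (Γ z x ∘L Γ z y) := by
    intro x y
    rw [ricci, ← map_sub, ← map_add, ← map_sub]
    congr 1
    ext v
    simp only [curvFlip, add_apply, sub_apply, ContinuousLinearMap.comp_apply,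
      ContinuousLinearMap.flip_apply, hG.fderiv_Γ_symm hz x v y, hG.torsion_free z hz v y]
    abel
  have h3 : ((fderiv ℝ Γ z).flip x).flip y = ((fderiv ℝ Γ z).flip y).flip x := by
    ext v; simp [hG.fderiv_Γ_symm hz v x y]
  rw [h2, h2, h1, h3, hG.torsion_free z hz x y, trL_comm]

/-- The endomorphism `L` is self-adjoint for the Ricci form: this is the contraction of the Ricci
identity `curv_comm_L`, whose other terms are symmetric in `x` and `y`. -/
lemma ricci_L (hG : BMGeometry U B Γ ρ L l) {z : E} (hz : z ∈ U) (x y : E) :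
    ricci Γ z x (L z y) = ricci Γ z (L z x) y := by
  have h1 : ∀ x y, ricci Γ z x (L z y) = trL (L z ∘L curvFlip Γ z x y)
      + (B z (cov Γ l z x) y + B z x y * trL (cov Γ l z)
        - B z (cov Γ l z x) y * trL (ContinuousLinearMap.id ℝ E) - B z (cov Γ l z x) y) := by
    intro x y
    have e : curvFlip Γ z x (L z y) = L z ∘L curvFlip Γ z x y
        + ContinuousLinearMap.smulRight (B z y ∘L cov Γ l z) x + B z x y • cov Γ l z
        - B z (cov Γ l z x) y • ContinuousLinearMap.id ℝ E
        - ContinuousLinearMap.smulRight (B z y) (cov Γ l z x) := by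
      ext j
      simp only [curvFlip_apply, hG.curv_comm_L hz, ContinuousLinearMap.comp_apply, add_apply,
        sub_apply, smul_apply, ContinuousLinearMap.smulRight_apply, ContinuousLinearMap.id_apply,
        hG.symm z hz y]
      abel
    rw [ricci, e]
    simp only [map_add, map_sub, map_smul, trL_smulRight, ContinuousLinearMap.comp_apply,
      smul_eq_mul, hG.symm z hz y]
    ring
  have h2 : trL (L z ∘L curvFlip Γ z x y) = trL (L z ∘L curvFlip Γ z y x) := by
    rw [trL_comm (L z) (curvFlip Γ z y x)]
    refine trL_eq_of_adjoint (B z) (hG.nondeg hz) _ _ fun a b => ?_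
    rw [ContinuousLinearMap.comp_apply, ContinuousLinearMap.comp_apply, hG.symm_L z hz,
      curvFlip_apply, curvFlip_apply, hG.curv_pair_symm hz, hG.curv_skew hz,
      curv_antisymm Γ z y, map_neg, neg_neg]
  have h3 : B z (cov Γ l z x) y = B z (cov Γ l z y) x := by
    rw [hG.symm_cov_l hz, hG.symm z hz]
  rw [h1, hG.ricci_symm hz, h1, h2, h3, hG.symm z hz x y]

end BMGeometry
end Curvature

/-! ### The commutator as a divergence -/

section DivergenceIdentity

variable {E : Type*} [NormedAddCommGroup E] [NormedSpace ℝ E] [FiniteDimensional ℝ E]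
variable {U : Set E} {B : E → E →L[ℝ] E →L[ℝ] ℝ} {Γ : E → E →L[ℝ] E →L[ℝ] E}
  {ρ : E → ℝ} {L : E → E →L[ℝ] E} {l : E → E}

lemma ricci_smul_sub_left (Γ : E → E →L[ℝ] E →L[ℝ] E) (z : E) (s : ℝ) (x x' y : E) :
    ricci Γ z (s • x - x') y = s * ricci Γ z x y - ricci Γ z x' y := by
  rw [ricci, ricci, ricci, ← smul_eq_mul, ← map_smul, ← map_sub]
  congr 1
  ext j
  have h : fderiv ℝ Γ z (s • x - x') j y
      = s • fderiv ℝ Γ z x j y - fderiv ℝ Γ z x' j y := by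
    rw [ContinuousLinearMap.map_sub, ContinuousLinearMap.map_smul]; rfl
  have h' : fderiv ℝ Γ z j (s • x - x') y
      = s • fderiv ℝ Γ z j x y - fderiv ℝ Γ z j x' y := by
    rw [ContinuousLinearMap.map_sub, ContinuousLinearMap.map_smul]; rfl
  have h'' : ∀ v, Γ z (s • x - x') v = s • Γ z x v - Γ z x' v := by
    intro v
    rw [ContinuousLinearMap.map_sub, ContinuousLinearMap.map_smul]; rfl
  have hc : ∀ x, curvFlip Γ z x y j = fderiv ℝ Γ z j x y - fderiv ℝ Γ z x j y
      + (Γ z j (Γ z x y) - Γ z x (Γ z j y)) := fun x => rfl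
  rw [sub_apply, smul_apply, hc, hc, hc, h, h', h'', h'', (Γ z j).map_sub, (Γ z j).map_smul]
  module

lemma ricci_smul_sub_right (Γ : E → E →L[ℝ] E →L[ℝ] E) (z : E) (s : ℝ) (x y y' : E) :
    ricci Γ z x (s • y - y') = s * ricci Γ z x y - ricci Γ z x y' := by
  rw [ricci, ricci, ricci, ← smul_eq_mul, ← map_smul, ← map_sub]
  congr 1
  ext j
  simp only [curvFlip_apply, sub_apply, smul_apply, curv, add_apply,
    ContinuousLinearMap.comp_apply, map_sub, map_smul]

/-- The vector field `det (s - L) (s - L)⁻¹ a`. -/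
def resFlow (L : E → E →L[ℝ] E) (s : ℝ) (a : E → E) (y : E) : E :=
  resDet L s y • resolv L s y (a y)

/-- The vector field `(B(b, P l) P a - B(a, P l) P b) δₛ δₜ / (t - s)`, where `P` is the difference
of the resolvents of `L` at `s` and `t`. -/
def crossField (B : E → E →L[ℝ] E →L[ℝ] ℝ) (L : E → E →L[ℝ] E) (l : E → E) (s t : ℝ)
    (a b : E → E) (y : E) : E :=
  ((t - s)⁻¹ * (resDet L s y * resDet L t y)) •
    ((B y (b y) (resolv L s y (l y)) - B y (b y) (resolv L t y (l y))) •
        (resolv L s y (a y) - resolv L t y (a y))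
      - (B y (a y) (resolv L s y (l y)) - B y (a y) (resolv L t y (l y))) •
        (resolv L s y (b y) - resolv L t y (b y)))

/-- The vector field whose divergence is `div (A a) div (A' b) - div (A' a) div (A b)`, where
`A`, `A'` are `det (s - L) (s - L)⁻¹` and `det (t - L) (t - L)⁻¹`. -/
def commField (B : E → E →L[ℝ] E →L[ℝ] ℝ) (Γ : E → E →L[ℝ] E →L[ℝ] E) (L : E → E →L[ℝ] E)
    (l : E → E) (s t : ℝ) (a b : E → E) (y : E) : E :=
  (divC Γ (resFlow L t b) y • resFlow L s a y - cov Γ (resFlow L t b) y (resFlow L s a y))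
    - (divC Γ (resFlow L s b) y • resFlow L t a y - cov Γ (resFlow L s b) y (resFlow L t a y))
    - crossField B L l s t a b y

/-- The Hessian `∇a` of a function `f` with gradient `a` is self-adjoint. -/
lemma MetricGeometry.symm_cov_grad (hG : MetricGeometry U B Γ ρ) {z : E} (hz : z ∈ U)
    {f : E → ℝ} {a : E → E}
    (hf : ContDiffAt ℝ 2 f z) (ha : DifferentiableAt ℝ a z)
    (hfa : ∀ᶠ w in 𝓝 z, ∀ y, fderiv ℝ f w y = B w (a w) y) (x y : E) :
    B z (cov Γ a z x) y = B z x (cov Γ a z y) := by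
  have hD : ∀ y, HasFDerivAt (fun w => B w (a w) y) _ z := fun y =>
    (((hG.contDiffAt_B z hz).differentiableAt (by norm_num)).hasFDerivAt.clm_apply
      ha.hasFDerivAt).clm_apply (hasFDerivAt_const y z)
  have h := fderiv_fderiv_symm hf hfa hD x y
  simp only [add_apply, ContinuousLinearMap.comp_apply, zero_apply, map_zero, zero_add,
    ContinuousLinearMap.flip_apply, hG.compat z hz] at h
  rw [hG.symm z hz x]
  simp only [cov, add_apply, ContinuousLinearMap.flip_apply, map_add]
  rw [hG.torsion_free z hz y x] at h
  linarith

namespace BMGeometry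

/-- Along with `L`, its resolvents are self-adjoint for the Ricci form. -/
lemma ricci_resolv (hG : BMGeometry U B Γ ρ L l) {z : E} (hz : z ∈ U) {s : ℝ}
    (hs : IsUnit (s • (1 : E →L[ℝ] E) - L z)) (x y : E) :
    ricci Γ z (resolv L s z x) y = ricci Γ z x (resolv L s z y) := by
  have hy : s • resolv L s z y - L z (resolv L s z y) = y := by rw [L_resolv_apply hs]; abel
  have hx : s • resolv L s z x - L z (resolv L s z x) = x := by rw [L_resolv_apply hs]; abel
  conv_lhs => rw [← hy, ricci_smul_sub_right]
  conv_rhs => rw [← hx, ricci_smul_sub_left]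
  rw [hG.ricci_L hz]

variable {s t : ℝ} {a b : E → E} {z : E}

lemma contDiffAt_resFlow (hG : BMGeometry U B Γ ρ L l) (hz : z ∈ U)
    (hs : IsUnit (s • (1 : E →L[ℝ] E) - L z)) {m : WithTop ℕ∞} (hm : m ≤ 2)
    (ha : ContDiffAt ℝ m a z) : ContDiffAt ℝ m (resFlow L s a) z :=
  ((hG.contDiffAt_resDet hz s).of_le hm).smul
    (((hG.contDiffAt_resolv hz hs).of_le hm).clm_apply ha)

lemma contDiffAt_pairing (hG : BMGeometry U B Γ ρ L l) (hz : z ∈ U)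
    (hs : IsUnit (s • (1 : E →L[ℝ] E) - L z)) (hb : ContDiffAt ℝ 1 b z) :
    ContDiffAt ℝ 1 (fun y => B y (b y) (resolv L s y (l y))) z :=
  (((hG.contDiffAt_B z hz).of_le (by norm_num)).clm_apply hb).clm_apply
    (((hG.contDiffAt_resolv hz hs).of_le (by norm_num)).clm_apply (hG.contDiffAt_l z hz))

/-- The divergence of the correcting field, in terms of `∇a`, `∇b` and `∇l`. The derivatives of the
resolvents enter through `resDiv` and `resPair`, those of the determinants through the
factors `-2`. -/
lemma divC_crossField (hG : BMGeometry U B Γ ρ L l) (hz : z ∈ U)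
    (hs : IsUnit (s • (1 : E →L[ℝ] E) - L z)) (ht : IsUnit (t • (1 : E →L[ℝ] E) - L z))
    (ha : ContDiffAt ℝ 1 a z) (hb : ContDiffAt ℝ 1 b z) :
    DifferentiableAt ℝ (crossField B L l s t a b) z ∧
    divC Γ (crossField B L l s t a b) z = resDet L s z * resDet L t z * ((t - s)⁻¹ * (
        (-2 * (B z (resolv L s z (l z)) (resolv L s z (a z) - resolv L t z (a z))
              + B z (resolv L t z (l z)) (resolv L s z (a z) - resolv L t z (a z)))
            * (B z (b z) (resolv L s z (l z)) - B z (b z) (resolv L t z (l z)))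
          + (resPair (B z) (resolv L s z) (cov Γ b z) (cov Γ l z) (l z) (b z)
                (resolv L s z (a z) - resolv L t z (a z))
              - resPair (B z) (resolv L t z) (cov Γ b z) (cov Γ l z) (l z) (b z)
                (resolv L s z (a z) - resolv L t z (a z)))
          + (B z (b z) (resolv L s z (l z)) - B z (b z) (resolv L t z (l z)))
            * (resDiv (B z) (resolv L s z) (cov Γ a z) (l z) (a z)
              - resDiv (B z) (resolv L t z) (cov Γ a z) (l z) (a z)))
        - (-2 * (B z (resolv L s z (l z)) (resolv L s z (b z) - resolv L t z (b z))
              + B z (resolv L t z (l z)) (resolv L s z (b z) - resolv L t z (b z)))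
            * (B z (a z) (resolv L s z (l z)) - B z (a z) (resolv L t z (l z)))
          + (resPair (B z) (resolv L s z) (cov Γ a z) (cov Γ l z) (l z) (a z)
                (resolv L s z (b z) - resolv L t z (b z))
              - resPair (B z) (resolv L t z) (cov Γ a z) (cov Γ l z) (l z) (a z)
                (resolv L s z (b z) - resolv L t z (b z)))
          + (B z (a z) (resolv L s z (l z)) - B z (a z) (resolv L t z (l z)))
            * (resDiv (B z) (resolv L s z) (cov Γ b z) (l z) (b z)
              - resDiv (B z) (resolv L t z) (cov Γ b z) (l z) (b z))))) := by
  have hds := (hG.contDiffAt_resDet hz s).differentiableAt (by norm_num)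
  have hdt := (hG.contDiffAt_resDet hz t).differentiableAt (by norm_num)
  have hda := ha.differentiableAt (by norm_num)
  have hdb := hb.differentiableAt (by norm_num)
  have hR := fun (r : ℝ) (hr : IsUnit (r • (1 : E →L[ℝ] E) - L z)) (v : E → E)
    (hv : DifferentiableAt ℝ v z) =>
    ((hG.contDiffAt_resolv hz hr).differentiableAt (by norm_num)).clm_apply hv
  have hP := fun (r : ℝ) (hr : IsUnit (r • (1 : E →L[ℝ] E) - L z)) (v : E → E)
    (hv : ContDiffAt ℝ 1 v z) => (hG.contDiffAt_pairing hz hr hv).differentiableAt (by norm_num)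
  have hc : HasFDerivAt (fun y => (t - s)⁻¹ * (resDet L s y * resDet L t y)) _ z :=
    (hds.hasFDerivAt.mul hdt.hasFDerivAt).const_mul (t - s)⁻¹
  have hqb := (hP s hs b hb).fun_sub (hP t ht b hb)
  have hqa := (hP s hs a ha).fun_sub (hP t ht a ha)
  have hva := (hR s hs a hda).fun_sub (hR t ht a hda)
  have hvb := (hR s hs b hdb).fun_sub (hR t ht b hdb)
  have hin := (hqb.fun_smul hva).fun_sub (hqa.fun_smul hvb)
  refine ⟨hc.differentiableAt.fun_smul hin, ?_⟩
  have e := divC_smul (Γ := Γ) hc.differentiableAt hin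
  rw [divC_sub (hqb.fun_smul hva) (hqa.fun_smul hvb), divC_smul hqb hva, divC_smul hqa hvb,
    divC_sub (hR s hs a hda) (hR t ht a hda), divC_sub (hR s hs b hdb) (hR t ht b hdb),
    hG.divC_resolv hz hs hda, hG.divC_resolv hz ht hda, hG.divC_resolv hz hs hdb,
    hG.divC_resolv hz ht hdb, fderiv_fun_sub (hP s hs b hb) (hP t ht b hb),
    fderiv_fun_sub (hP s hs a ha) (hP t ht a ha), sub_apply, sub_apply,
    hG.fderiv_pairing hz hs hdb, hG.fderiv_pairing hz ht hdb, hG.fderiv_pairing hz hs hda,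
    hG.fderiv_pairing hz ht hda, hc.fderiv] at e
  refine Eq.trans e ?_
  simp only [smul_apply, add_apply, hG.fderiv_resDet hz hs, hG.fderiv_resDet hz ht, smul_eq_mul,
    map_sub, map_smul]
  ring

/-- The key identity: the antisymmetrized product of divergences is itself a divergence. Only one
of the two fields, `b`, has to be twice differentiable. -/
lemma divC_commField (hG : BMGeometry U B Γ ρ L l) (hz : z ∈ U) (hst : s ≠ t)
    (hs : IsUnit (s • (1 : E →L[ℝ] E) - L z)) (ht : IsUnit (t • (1 : E →L[ℝ] E) - L z))
    (ha : ContDiffAt ℝ 1 a z) (hb : ContDiffAt ℝ 2 b z)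
    (hU : ∀ x y, B z (cov Γ a z x) y = B z x (cov Γ a z y))
    (hW : ∀ x y, B z (cov Γ b z x) y = B z x (cov Γ b z y)) :
    divC Γ (commField B Γ L l s t a b) z
      = divC Γ (resFlow L s a) z * divC Γ (resFlow L t b) z
        - divC Γ (resFlow L t a) z * divC Γ (resFlow L s b) z := by
  have hΓ := (hG.contDiffAt_Γ z hz).differentiableAt (by norm_num)
  have hsa := (hG.contDiffAt_resFlow hz hs (by norm_num) ha).differentiableAt (by norm_num)
  have hta := (hG.contDiffAt_resFlow hz ht (by norm_num) ha).differentiableAt (by norm_num)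
  have hsb := hG.contDiffAt_resFlow hz hs le_rfl hb
  have htb := hG.contDiffAt_resFlow hz ht le_rfl hb
  obtain ⟨hZ, hZd⟩ := hG.divC_crossField hz hs ht ha (hb.of_le (by norm_num))
  have h1 := ((differentiableAt_divC htb hΓ).fun_smul hsa).fun_sub
    (differentiableAt_cov_apply hsa htb hΓ)
  have h2 := ((differentiableAt_divC hsb hΓ).fun_smul hta).fun_sub
    (differentiableAt_cov_apply hta hsb hΓ)
  have htf := hG.eventually_torsion_free hz
  have e := divC_sub (Γ := Γ) (h1.fun_sub h2) hZ
  rw [divC_sub h1 h2, divC_bochner htf hsa htb hΓ, divC_bochner htf hta hsb hΓ, hZd] at e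
  have hMN := resolv_comp_resolv hst hs ht
  have hNM : resolv L t z ∘L resolv L s z = (t - s)⁻¹ • (resolv L s z - resolv L t z) := by
    rw [resolv_comp_resolv hst.symm ht hs, ← neg_sub t s, inv_neg, neg_smul, ← smul_neg, neg_sub]
  -- The Ricci terms cancel, since the resolvents of `L` are self-adjoint for the Ricci form.
  have hric : ricci Γ z (resFlow L s a z) (resFlow L t b z)
      = ricci Γ z (resFlow L t a z) (resFlow L s b z) := by
    have hl := fun r x y => ricci_smul_sub_left Γ z r x 0 y
    have hr := fun r x y => ricci_smul_sub_right Γ z r x y 0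
    have hl0 := fun y => ricci_smul_sub_left Γ z 0 0 0 y
    have hr0 := fun x => ricci_smul_sub_right Γ z 0 x 0 0
    simp only [smul_zero, sub_zero, zero_mul, zero_sub] at hl hr hl0 hr0
    have hl1 : ∀ y, ricci Γ z 0 y = 0 := fun y => by linarith [hl0 y]
    have hr1 : ∀ x, ricci Γ z x 0 = 0 := fun x => by linarith [hr0 x]
    simp only [hl1, hr1, sub_zero] at hl hr
    have hcomm : resolv L s z (resolv L t z (b z)) = resolv L t z (resolv L s z (b z)) := by
      have := hMN.trans hNM.symm
      exact DFunLike.congr_fun this (b z)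
    simp only [resFlow, hl, hr]
    rw [hG.ricci_resolv hz hs, hG.ricci_resolv hz ht, hcomm]
    ring
  have key := trL_resGrad_comp_sub (B z) (hG.symm z hz) (resolv L s z) (resolv L t z)
    (cov Γ a z) (cov Γ b z) (cov Γ l z) (l z) (a z) (b z) (t - s)⁻¹
    (hG.symm_resolv hz hs) (hG.symm_resolv hz ht) hU hW (hG.symm_cov_l hz) (hG.nondeg hz) hMN hNM
  have hca : ∀ {r : ℝ} (hr : IsUnit (r • (1 : E →L[ℝ] E) - L z)), cov Γ (resFlow L r a) z = _ :=
    fun hr => hG.cov_resDet_smul hz hr (ha.differentiableAt (by norm_num))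
  have hcb : ∀ {r : ℝ} (hr : IsUnit (r • (1 : E →L[ℝ] E) - L z)), cov Γ (resFlow L r b) z = _ :=
    fun hr => hG.cov_resDet_smul hz hr (hb.differentiableAt (by norm_num))
  refine Eq.trans e ?_
  rw [hric, hca hs, hca ht, hcb hs, hcb ht]
  simp only [ContinuousLinearMap.smul_comp, ContinuousLinearMap.comp_smul, map_smul, smul_eq_mul]
  linear_combination (-(resDet L s z * resDet L t z)) * key

end BMGeometry
end DivergenceIdentity

/-! ### Divergence theorem and Green's formula -/

section LocalIntegration

variable {E : Type*} [NormedAddCommGroup E] [NormedSpace ℝ E]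

lemma contDiff_of_compact_subset {F : Type*} [NormedAddCommGroup F] [NormedSpace ℝ F]
    {U K : Set E} (hK : IsCompact K) (hKU : K ⊆ U)
    {Y : E → F} {m : WithTop ℕ∞} (hY : ∀ z ∈ U, ContDiffAt ℝ m Y z) (h0 : ∀ z ∉ K, Y z = 0) :
    ContDiff ℝ m Y := by
  rw [contDiff_iff_contDiffAt]
  intro z
  by_cases hz : z ∈ K
  · exact hY z (hKU hz)
  · have : Y =ᶠ[𝓝 z] fun _ => 0 := by
      filter_upwards [hK.isClosed.isOpen_compl.mem_nhds hz] with w hw using h0 w hw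
    exact contDiffAt_const.congr_of_eventuallyEq this

lemma continuous_of_compact_subset {F : Type*} [NormedAddCommGroup F]
    {U K : Set E} (hK : IsCompact K) (hKU : K ⊆ U)
    {Y : E → F} (hY : ∀ z ∈ U, ContinuousAt Y z) (h0 : ∀ z ∉ K, Y z = 0) :
    Continuous Y := by
  rw [continuous_iff_continuousAt]
  intro z
  by_cases hz : z ∈ K
  · exact hY z (hKU hz)
  · have : Y =ᶠ[𝓝 z] fun _ => 0 := by
      filter_upwards [hK.isClosed.isOpen_compl.mem_nhds hz] with w hw using h0 w hw
    exact continuousAt_const.congr this.symm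

lemma integrable_of_compact_subset [MeasurableSpace E] [BorelSpace E] {μ : Measure E}
    [IsFiniteMeasureOnCompacts μ] {U K : Set E} (hK : IsCompact K) (hKU : K ⊆ U)
    {Y : E → ℝ} (hY : ∀ z ∈ U, ContinuousAt Y z) (h0 : ∀ z ∉ K, Y z = 0) : Integrable Y μ :=
  (continuous_of_compact_subset hK hKU hY h0).integrable_of_hasCompactSupport
    (HasCompactSupport.intro hK h0)

variable [FiniteDimensional ℝ E]

/-- The divergence theorem in a vector space, for the constant density. -/
lemma integral_trL_fderiv_eq_zero [MeasurableSpace E] [BorelSpace E] (μ : Measure E)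
    [μ.IsAddHaarMeasure] {Y : E → E} (hY : ContDiff ℝ 1 Y) (hc : HasCompactSupport Y) :
    ∫ z, trL (fderiv ℝ Y z) ∂μ = 0 := by
  let b := Module.finBasis ℝ E
  let c : Fin (Module.finrank ℝ E) → E →L[ℝ] ℝ := fun i => (b.coord i).toContinuousLinearMap
  have hcd : ∀ i, ContDiff ℝ 1 (fun z => c i (Y z)) := fun i => (c i).contDiff.comp hY
  have hcc : ∀ i, HasCompactSupport (fun z => c i (Y z)) := fun i =>
    hc.comp_left (g := c i) (map_zero _)
  have htr : ∀ z, trL (fderiv ℝ Y z) = ∑ i, fderiv ℝ (fun z => c i (Y z)) z (b i) := by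
    intro z
    rw [trL_eq_trace, LinearMap.trace_eq_matrix_trace ℝ b, Matrix.trace]
    refine Finset.sum_congr rfl fun i _ => ?_
    have h1 : HasFDerivAt (fun z => c i (Y z)) (c i ∘L fderiv ℝ Y z) z :=
      (c i).hasFDerivAt.comp z (hY.differentiable (by norm_num) z).hasFDerivAt
    rw [h1.fderiv, Matrix.diag_apply, LinearMap.toMatrix_apply]
    rfl
  have hint : ∀ i, Integrable (fun z => fderiv ℝ (fun z => c i (Y z)) z (b i)) μ := fun i =>
    (((hcd i).continuous_fderiv (by norm_num)).clm_apply
      continuous_const).integrable_of_hasCompactSupport ((hcc i).fderiv_apply (𝕜 := ℝ) (b i))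
  simp_rw [htr]
  rw [integral_finsetSum _ fun i _ => hint i]
  refine Finset.sum_eq_zero fun i _ => ?_
  have := integral_mul_fderiv_eq_neg_fderiv_mul_of_integrable (μ := μ) (𝕜 := ℝ)
    (f := fun _ => (1 : ℝ)) (g := fun z => c i (Y z)) (v := b i) (by simp)
    (by simpa using hint i)
    (by simpa using (hcd i).continuous.integrable_of_hasCompactSupport (hcc i))
    (fun x _ => differentiableAt_const _)
    (fun x _ => (hcd i).differentiable (by norm_num) x)
  simpa using this

variable {U : Set E} {B : E → E →L[ℝ] E →L[ℝ] ℝ} {Γ : E → E →L[ℝ] E →L[ℝ] E}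
  {ρ : E → ℝ} {L : E → E →L[ℝ] E} {l : E → E}

lemma contDiffAt_divC {X : E → E} {z : E} {m : WithTop ℕ∞} {k : WithTop ℕ∞} (hmk : m + 1 ≤ k)
    (hX : ContDiffAt ℝ k X z) (hΓ : ContDiffAt ℝ m Γ z) : ContDiffAt ℝ m (divC Γ X) z :=
  ((trL (E := E)).contDiff.contDiffAt.comp z (hX.fderiv_right hmk)).add
    ((trL (E := E)).contDiff.contDiffAt.comp z
      (hΓ.clm_apply (hX.of_le (le_self_add.trans hmk))))

omit [FiniteDimensional ℝ E] in
lemma contDiffAt_cov_apply {X Y : E → E} {z : E}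
    (hX : ContDiffAt ℝ 1 X z) (hY : ContDiffAt ℝ 2 Y z) (hΓ : ContDiffAt ℝ 1 Γ z) :
    ContDiffAt ℝ 1 (fun y => cov Γ Y y (X y)) z :=
  ((hY.fderiv_right (m := 1) (by norm_num)).clm_apply hX).add
    ((hΓ.clm_apply hX).clm_apply (hY.of_le (by norm_num)))

/-- The gradient of a function with respect to the metric `B`. -/
def grad (B : E → E →L[ℝ] E →L[ℝ] ℝ) (f : E → ℝ) (z : E) : E :=
  (B z).inverse (fderiv ℝ f z)

/-- The second-order operator `div (A ∇f)`. -/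
def divOp (B : E → E →L[ℝ] E →L[ℝ] ℝ) (Γ : E → E →L[ℝ] E →L[ℝ] E) (A : E → E →L[ℝ] E)
    (f : E → ℝ) : E → ℝ :=
  divC Γ (fun y => A y (grad B f y))

namespace MetricGeometry

lemma isInvertible (hG : MetricGeometry U B Γ ρ) {z : E} (hz : z ∈ U) : (B z).IsInvertible := by
  have hinj : Function.Injective (B z : E →ₗ[ℝ] E →L[ℝ] ℝ) := by
    rw [← LinearMap.ker_eq_bot, LinearMap.ker_eq_bot']
    intro x hx
    refine hG.nondeg hz x fun y => ?_
    simpa using DFunLike.congr_fun hx y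
  have hfr : Module.finrank ℝ E = Module.finrank ℝ (E →L[ℝ] ℝ) := by
    rw [← (LinearMap.toContinuousLinearMap : (E →ₗ[ℝ] ℝ) ≃ₗ[ℝ] _).finrank_eq]
    exact Subspace.dual_finrank_eq.symm
  let e : E ≃L[ℝ] (E →L[ℝ] ℝ) :=
    (LinearEquiv.ofInjectiveOfFinrankEq _ hinj hfr).toContinuousLinearEquiv
  exact ⟨e, by ext x y; rfl⟩

lemma B_grad (hG : MetricGeometry U B Γ ρ) {z : E} (hz : z ∈ U) (f : E → ℝ) (y : E) :
    B z (grad B f z) y = fderiv ℝ f z y := by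
  obtain ⟨e, he⟩ := hG.isInvertible hz
  rw [grad, ← he, ContinuousLinearMap.inverse_equiv]
  simp

lemma contDiffAt_grad (hG : MetricGeometry U B Γ ρ) {z : E} (hz : z ∈ U) {f : E → ℝ}
    {m k : WithTop ℕ∞} (hm : m ≤ 2) (hmk : m + 1 ≤ k) (hf : ContDiffAt ℝ k f z) :
    ContDiffAt ℝ m (grad B f) z := by
  obtain ⟨e, he⟩ := hG.isInvertible hz
  have h1 : ContDiffAt ℝ m ContinuousLinearMap.inverse (B z) := by
    rw [← he]; exact contDiffAt_map_inverse e
  exact (h1.comp z ((hG.contDiffAt_B z hz).of_le hm)).clm_apply (hf.fderiv_right hmk)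

lemma symm_cov_grad' (hG : MetricGeometry U B Γ ρ) {z : E} (hz : z ∈ U) {f : E → ℝ}
    (hf : ContDiffAt ℝ 2 f z) (x y : E) :
    B z (cov Γ (grad B f) z x) y = B z x (cov Γ (grad B f) z y) := by
  refine hG.symm_cov_grad hz hf ((hG.contDiffAt_grad hz (m := 1) (by norm_num) (by norm_num)
    hf).differentiableAt (by norm_num)) ?_ x y
  filter_upwards [hG.isOpen.mem_nhds hz] with w hw y using (hG.B_grad hw f y).symm

/-- The divergence theorem for compactly supported vector fields. -/
lemma integral_divC_eq_zero [MeasurableSpace E] [BorelSpace E] (μ : Measure E)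
    [μ.IsAddHaarMeasure] (hG : MetricGeometry U B Γ ρ) {K : Set E} (hK : IsCompact K) (hKU : K ⊆ U)
    {X : E → E} (hX : ∀ z ∈ U, ContDiffAt ℝ 1 X z) (h0 : ∀ z ∉ K, X z = 0) :
    ∫ z, ρ z * divC Γ X z ∂μ = 0 := by
  have hρ := fun z hz => (hG.contDiffAt_ρ z hz).of_le (m := 1) (by norm_num)
  have hY0 : ∀ z ∉ K, ρ z • X z = 0 := fun z hz => by rw [h0 z hz, smul_zero]
  have hY : ContDiff ℝ 1 (fun z => ρ z • X z) := contDiff_of_compact_subset hK hKU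
    (fun z hz => (hρ z hz).smul (hX z hz)) hY0
  have h := integral_trL_fderiv_eq_zero μ hY (HasCompactSupport.intro hK hY0)
  rw [← h]
  refine integral_congr_ae (Eventually.of_forall fun z => ?_)
  by_cases hz : z ∈ U
  · have h1 := ((hρ z hz).differentiableAt (by norm_num)).hasFDerivAt.fun_smul
      ((hX z hz).differentiableAt (by norm_num)).hasFDerivAt
    have e : fderiv ℝ (fun z => ρ z • X z) z = _ := h1.fderiv
    simp only [e, map_add, map_smul, trL_smulRight, hG.fderiv_ρ z hz, divC, smul_eq_mul]
    ring
  · have hzK : z ∉ K := fun h => hz (hKU h)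
    have hX0 : X =ᶠ[𝓝 z] fun _ => 0 := by
      filter_upwards [hK.isClosed.isOpen_compl.mem_nhds hzK] with w hw using h0 w hw
    have hY0' : (fun z => ρ z • X z) =ᶠ[𝓝 z] fun _ => 0 := by
      filter_upwards [hX0] with w hw
      rw [hw, smul_zero]
    simp only [divC, hX0.fderiv_eq, hY0'.fderiv_eq, h0 z hzK]
    simp

end MetricGeometry

lemma grad_eq_zero (B : E → E →L[ℝ] E →L[ℝ] ℝ) {f : E → ℝ} {z : E} (hz : z ∉ tsupport f) :
    grad B f z = 0 := by
  have : fderiv ℝ f z = 0 := by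
    have := image_eq_zero_of_notMem_tsupport (f := fderiv ℝ f)
      (fun h => hz (tsupport_fderiv_subset ℝ h))
    exact this
  rw [grad, this, map_zero]

lemma eventually_grad_eq_zero (B : E → E →L[ℝ] E →L[ℝ] ℝ) {f : E → ℝ} {z : E}
    (hz : z ∉ tsupport f) : ∀ᶠ w in 𝓝 z, grad B f w = 0 := by
  filter_upwards [(isClosed_tsupport f).isOpen_compl.mem_nhds hz] with w hw
  exact grad_eq_zero B hw

lemma divC_eq_zero (Γ : E → E →L[ℝ] E →L[ℝ] E) {X : E → E} {z : E} (h : X =ᶠ[𝓝 z] fun _ => 0) :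
    divC Γ X z = 0 := by
  simp [divC, h.fderiv_eq, h.self_of_nhds]

lemma cov_eq_zero (Γ : E → E →L[ℝ] E →L[ℝ] E) {X : E → E} {z : E} (h : X =ᶠ[𝓝 z] fun _ => 0) :
    cov Γ X z = 0 := by
  simp [cov, h.fderiv_eq, h.self_of_nhds]

lemma divOp_eq_zero (B : E → E →L[ℝ] E →L[ℝ] ℝ) (Γ : E → E →L[ℝ] E →L[ℝ] E)
    (A : E → E →L[ℝ] E) {f : E → ℝ} {z : E} (hz : z ∉ tsupport f) : divOp B Γ A f z = 0 := by
  refine divC_eq_zero Γ ?_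
  filter_upwards [eventually_grad_eq_zero B hz] with w hw
  rw [hw, map_zero]

namespace MetricGeometry

lemma contDiffAt_divOp_field (hG : MetricGeometry U B Γ ρ) {A : E → E →L[ℝ] E} {f : E → ℝ} {z : E}
    (hz : z ∈ U) (hA : ContDiffAt ℝ 1 A z) (hf : ContDiffAt ℝ 2 f z) :
    ContDiffAt ℝ 1 (fun y => A y (grad B f y)) z :=
  hA.clm_apply (hG.contDiffAt_grad hz (by norm_num) (by norm_num) hf)

lemma continuousAt_divOp (hG : MetricGeometry U B Γ ρ) {A : E → E →L[ℝ] E} {f : E → ℝ} {z : E}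
    (hz : z ∈ U) (hA : ContDiffAt ℝ 1 A z) (hf : ContDiffAt ℝ 2 f z) :
    ContinuousAt (divOp B Γ A f) z :=
  (contDiffAt_divC (m := 0) (k := 1) (by norm_num) (hG.contDiffAt_divOp_field hz hA hf)
    ((hG.contDiffAt_Γ z hz).of_le (by norm_num))).continuousAt

/-- Green's formula for the operator `div (A ∇f)` with `A` self-adjoint. -/
lemma green [MeasurableSpace E] [BorelSpace E] (μ : Measure E)
    [μ.IsAddHaarMeasure] (hG : MetricGeometry U B Γ ρ) {A : E → E →L[ℝ] E}
    (hA : ∀ z ∈ U, ContDiffAt ℝ 1 A z) (hAs : ∀ z ∈ U, ∀ x y, B z (A z x) y = B z x (A z y))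
    {f h : E → ℝ} (hf : ∀ z ∈ U, ContDiffAt ℝ 2 f z) (hh : ∀ z ∈ U, ContDiffAt ℝ 2 h z)
    (hc : HasCompactSupport h) (hhU : tsupport h ⊆ U) :
    ∫ z, ρ z * (divOp B Γ A f z * h z) ∂μ = ∫ z, ρ z * (f z * divOp B Γ A h z) ∂μ := by
  have hXf := fun z hz => hG.contDiffAt_divOp_field hz (hA z hz) (hf z hz)
  have hXh := fun z hz => hG.contDiffAt_divOp_field hz (hA z hz) (hh z hz)
  have hf1 := fun z hz => (hf z hz).of_le (m := 1) (by norm_num)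
  have hh1 := fun z hz => (hh z hz).of_le (m := 1) (by norm_num)
  have hh0 : ∀ z ∉ tsupport h, h z = 0 := fun z hz => image_eq_zero_of_notMem_tsupport hz
  have h1 := hG.integral_divC_eq_zero μ hc hhU
    (X := fun y => h y • A y (grad B f y) - f y • A y (grad B h y))
    (fun z hz => ((hh1 z hz).smul (hXf z hz)).sub ((hf1 z hz).smul (hXh z hz)))
    (fun z hz => by rw [hh0 z hz, grad_eq_zero B hz]; simp)
  rw [← sub_eq_zero, ← integral_sub, ← h1]
  · refine integral_congr_ae (Eventually.of_forall fun z => ?_)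
    by_cases hz : z ∈ U
    · have hd1 := (hh1 z hz).differentiableAt (by norm_num)
      have hd2 := (hf1 z hz).differentiableAt (by norm_num)
      have hd3 := (hXf z hz).differentiableAt (by norm_num)
      have hd4 := (hXh z hz).differentiableAt (by norm_num)
      simp only
      rw [divC_sub (hd1.fun_smul hd3) (hd2.fun_smul hd4), divC_smul hd1 hd3, divC_smul hd2 hd4,
        ← hG.B_grad hz, ← hG.B_grad hz, ← hAs z hz, hG.symm z hz (A z (grad B h z)), divOp, divOp]
      ring
    · have hzK : z ∉ tsupport h := fun h => hz (hhU h)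
      have : (fun y => h y • A y (grad B f y) - f y • A y (grad B h y)) =ᶠ[𝓝 z] fun _ => 0 := by
        filter_upwards [(isClosed_tsupport h).isOpen_compl.mem_nhds hzK] with w hw
        rw [hh0 w hw, grad_eq_zero B hw]; simp
      simp only [divC_eq_zero Γ this, divOp_eq_zero B Γ A hzK, hh0 z hzK]
      simp
  · refine integrable_of_compact_subset hc hhU (fun z hz => ?_) fun z hz => by simp [hh0 z hz]
    exact (hG.contDiffAt_ρ z hz).continuousAt.mul
      ((hG.continuousAt_divOp hz (hA z hz) (hf z hz)).mul (hh z hz).continuousAt)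
  · refine integrable_of_compact_subset hc hhU (fun z hz => ?_)
      fun z hz => by simp [divOp_eq_zero B Γ A hz]
    exact (hG.contDiffAt_ρ z hz).continuousAt.mul
      ((hf z hz).continuousAt.mul (hG.continuousAt_divOp hz (hA z hz) (hh z hz)))

end MetricGeometry
end LocalIntegration

/-! ### Commutation in a coordinate domain -/

section WeakCommutation

variable {E : Type*} [NormedAddCommGroup E] [NormedSpace ℝ E] [FiniteDimensional ℝ E]
variable {U : Set E} {B : E → E →L[ℝ] E →L[ℝ] ℝ} {Γ : E → E →L[ℝ] E →L[ℝ] E}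
  {ρ : E → ℝ} {L : E → E →L[ℝ] E} {l : E → E}

/-- A polynomial in two variables that vanishes for all distinct negative values of the variables
has zero coefficients. -/
lemma coeff_eq_zero_of_eval_neg {n : ℕ} (w : Fin n → Fin n → ℝ)
    (h : ∀ s t : ℝ, s < 0 → t < 0 → s ≠ t →
      ∑ i : Fin n, ∑ j : Fin n, s ^ (i : ℕ) * t ^ (j : ℕ) * w i j = 0)
    (i j : Fin n) : w i j = 0 := by
  have key : ∀ (c : Fin n → ℝ) (S : Set ℝ), S.Infinite →
      (∀ s ∈ S, ∑ i : Fin n, s ^ (i : ℕ) * c i = 0) → ∀ i, c i = 0 := by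
    intro c S hS hc i
    let p : ℝ[X] := ∑ i : Fin n, Polynomial.monomial (i : ℕ) (c i)
    have hp : p = 0 := by
      refine Polynomial.eq_zero_of_infinite_isRoot p (hS.mono fun s hs => ?_)
      have := hc s hs
      simp only [Set.mem_ofPred_eq, Polynomial.IsRoot, p, Polynomial.eval_finsetSum,
        Polynomial.eval_monomial]
      rw [← this]
      exact Finset.sum_congr rfl fun i _ => mul_comm _ _
    have hcoeff : p.coeff (i : ℕ) = c i := by
      simp only [p, Polynomial.finsetSum_coeff, Polynomial.coeff_monomial]
      rw [Finset.sum_eq_single i]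
      · simp
      · intro b _ hb
        rw [if_neg (fun h => hb (Fin.ext h))]
      · simp
    rw [← hcoeff, hp, Polynomial.coeff_zero]
  have h1 : ∀ s : ℝ, s < 0 → ∀ j, ∑ i : Fin n, s ^ (i : ℕ) * w i j = 0 := by
    intro s hs
    refine key (fun j => ∑ i : Fin n, s ^ (i : ℕ) * w i j) (Set.Iio 0 \ {s})
      ((Set.Iio_infinite 0).sdiff (Set.finite_singleton s)) fun t ht => ?_
    rw [← h s t hs ht.1 (fun e => ht.2 e.symm), Finset.sum_comm]
    refine Finset.sum_congr rfl fun j _ => ?_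
    rw [Finset.mul_sum]
    exact Finset.sum_congr rfl fun i _ => by ring
  exact key (fun i => w i j) (Set.Iio 0) (Set.Iio_infinite 0) (fun s hs => h1 s hs j) i

namespace BMGeometry

variable {s t : ℝ}

lemma contDiffAt_commField (hG : BMGeometry U B Γ ρ L l) {z : E} (hz : z ∈ U)
    (hs : IsUnit (s • (1 : E →L[ℝ] E) - L z)) (ht : IsUnit (t • (1 : E →L[ℝ] E) - L z))
    {a b : E → E} (ha : ContDiffAt ℝ 1 a z) (hb : ContDiffAt ℝ 2 b z) :
    ContDiffAt ℝ 1 (commField B Γ L l s t a b) z := by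
  have hΓ := hG.contDiffAt_Γ z hz
  have hb1 : ContDiffAt ℝ 1 b z := hb.of_le (by norm_num)
  have hsa := hG.contDiffAt_resFlow hz hs (by norm_num) ha
  have hta := hG.contDiffAt_resFlow hz ht (by norm_num) ha
  have hsb := hG.contDiffAt_resFlow hz hs le_rfl hb
  have htb := hG.contDiffAt_resFlow hz ht le_rfl hb
  have h12 : (1 : WithTop ℕ∞) + 1 ≤ 2 := by norm_num
  have hR := fun (r : ℝ) (hr : IsUnit (r • (1 : E →L[ℝ] E) - L z)) (v : E → E)
    (hv : ContDiffAt ℝ 1 v z) =>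
    ((hG.contDiffAt_resolv hz hr).of_le (m := 1) (by norm_num)).clm_apply hv
  have hd := fun r => (hG.contDiffAt_resDet hz r).of_le (m := 1) (by norm_num)
  have hP := fun (r : ℝ) (hr : IsUnit (r • (1 : E →L[ℝ] E) - L z)) (v : E → E)
    (hv : ContDiffAt ℝ 1 v z) => hG.contDiffAt_pairing hz hr hv
  refine ((((contDiffAt_divC h12 htb hΓ).smul hsa).sub (contDiffAt_cov_apply hsa htb hΓ)).sub
    (((contDiffAt_divC h12 hsb hΓ).smul hta).sub (contDiffAt_cov_apply hta hsb hΓ))).sub ?_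
  exact (contDiffAt_const.mul ((hd s).mul (hd t))).smul
    ((((hP s hs b hb1).sub (hP t ht b hb1)).smul ((hR s hs a ha).sub (hR t ht a ha))).sub
      (((hP s hs a ha).sub (hP t ht a ha)).smul ((hR s hs b hb1).sub (hR t ht b hb1))))

lemma commField_eq_zero (B : E → E →L[ℝ] E →L[ℝ] ℝ) (Γ : E → E →L[ℝ] E →L[ℝ] E)
    (L : E → E →L[ℝ] E) (l : E → E) (s t : ℝ) (a : E → E) {b : E → E} {z : E}
    (hb : b =ᶠ[𝓝 z] fun _ => 0) : commField B Γ L l s t a b z = 0 := by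
  have h : ∀ r, resFlow L r b =ᶠ[𝓝 z] fun _ => 0 := fun r => by
    filter_upwards [hb] with w hw
    rw [resFlow, hw, map_zero, smul_zero]
  rw [commField, crossField, divC_eq_zero Γ (h t), divC_eq_zero Γ (h s), cov_eq_zero Γ (h t),
    cov_eq_zero Γ (h s), hb.self_of_nhds]
  simp

/-- Weak form of the commutation of the operators `div (A ∇f)` for `A = det (s - L) (s - L)⁻¹`. -/
lemma integral_divOp_resolv [MeasurableSpace E] [BorelSpace E] (μ : Measure E)
    [μ.IsAddHaarMeasure] (hG : BMGeometry U B Γ ρ L l) (hst : s ≠ t)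
    (hs : ∀ z ∈ U, IsUnit (s • (1 : E →L[ℝ] E) - L z))
    (ht : ∀ z ∈ U, IsUnit (t • (1 : E →L[ℝ] E) - L z))
    {f φ : E → ℝ} (hf : ∀ z ∈ U, ContDiffAt ℝ 2 f z) (hφ : ContDiff ℝ ∞ φ)
    (hc : HasCompactSupport φ) (hφU : tsupport φ ⊆ U) :
    ∫ z, ρ z * (divC Γ (resFlow L s (grad B f)) z * divC Γ (resFlow L t (grad B φ)) z
        - divC Γ (resFlow L t (grad B f)) z * divC Γ (resFlow L s (grad B φ)) z) ∂μ = 0 := by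
  have ha := fun z hz => hG.contDiffAt_grad hz (m := 1) (by norm_num) (by norm_num) (hf z hz)
  have hb := fun (z : E) (hz : z ∈ U) => hG.contDiffAt_grad hz (m := 2) (k := 3)
    le_rfl (by norm_num)
    (by exact_mod_cast (contDiff_infty.1 hφ 3).contDiffAt)
  have hφ2 : ∀ z, ContDiffAt ℝ 2 φ z := fun z => by
    exact_mod_cast (contDiff_infty.1 hφ 2).contDiffAt
  have h := hG.integral_divC_eq_zero μ hc hφU
    (X := commField B Γ L l s t (grad B f) (grad B φ))
    (fun z hz => hG.contDiffAt_commField hz (hs z hz) (ht z hz) (ha z hz) (hb z hz))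
    (fun z hz => commField_eq_zero B Γ L l s t _ (eventually_grad_eq_zero B hz))
  rw [← h]
  refine integral_congr_ae (Eventually.of_forall fun z => ?_)
  by_cases hz : z ∈ U
  · simp only
    rw [hG.divC_commField hz hst (hs z hz) (ht z hz) (ha z hz) (hb z hz)
      (hG.symm_cov_grad' hz (hf z hz)) (hG.symm_cov_grad' hz (hφ2 z))]
  · have hzK : z ∉ tsupport φ := fun h => hz (hφU h)
    have hev : ∀ᶠ w in 𝓝 z, w ∉ tsupport φ :=
      (isClosed_tsupport φ).isOpen_compl.mem_nhds hzK
    have h0 : ∀ r, resFlow L r (grad B φ) =ᶠ[𝓝 z] fun _ => 0 := fun r => by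
      filter_upwards [hev] with w hw
      rw [resFlow, grad_eq_zero B hw, map_zero, smul_zero]
    have h1 : commField B Γ L l s t (grad B f) (grad B φ) =ᶠ[𝓝 z] fun _ => 0 := by
      filter_upwards [hev] with w hw
      exact commField_eq_zero B Γ L l s t _ (eventually_grad_eq_zero B hw)
    simp only [divC_eq_zero Γ (h0 s), divC_eq_zero Γ (h0 t), divC_eq_zero Γ h1]
    simp

/-- If `∑ tᵏ Sₖ = -det (t - L) (t - L)⁻¹`, then the operators `div (Sₖ ∇f)` commute in the weak
sense. -/
lemma integral_divOp_coeff [MeasurableSpace E] [BorelSpace E] (μ : Measure E)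
    [μ.IsAddHaarMeasure] (hG : BMGeometry U B Γ ρ L l)
    (hunit : ∀ t : ℝ, t < 0 → ∀ z ∈ U, IsUnit (t • (1 : E →L[ℝ] E) - L z))
    {n : ℕ} {S : Fin n → E → E →L[ℝ] E} (hS : ∀ k, ∀ z ∈ U, ContDiffAt ℝ 1 (S k) z)
    (hgen : ∀ t : ℝ, t < 0 → ∀ z ∈ U,
      ∑ k : Fin n, t ^ (k : ℕ) • S k z = -(resDet L t z • resolv L t z))
    {f φ : E → ℝ} (hf : ∀ z ∈ U, ContDiffAt ℝ 2 f z) (hφ : ContDiff ℝ ∞ φ)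
    (hc : HasCompactSupport φ) (hφU : tsupport φ ⊆ U) (k m : Fin n) :
    ∫ z, ρ z * (divOp B Γ (S k) f z * divOp B Γ (S m) φ z
        - divOp B Γ (S m) f z * divOp B Γ (S k) φ z) ∂μ = 0 := by
  have hφ2 : ∀ z, ContDiffAt ℝ 2 φ z := fun z => by
    exact_mod_cast (contDiff_infty.1 hφ 2).contDiffAt
  have hint : ∀ k m, Integrable (fun z => ρ z * (divOp B Γ (S k) f z * divOp B Γ (S m) φ z
      - divOp B Γ (S m) f z * divOp B Γ (S k) φ z)) μ := by
    intro k m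
    refine integrable_of_compact_subset hc hφU (fun z hz => ?_)
      fun z hz => by simp [divOp_eq_zero B Γ _ hz]
    have h1 := fun k => hG.continuousAt_divOp hz (hS k z hz) (hf z hz)
    have h2 := fun k => hG.continuousAt_divOp hz (hS k z hz) (hφ2 z)
    exact (hG.contDiffAt_ρ z hz).continuousAt.mul (((h1 k).mul (h2 m)).sub ((h1 m).mul (h2 k)))
  -- the operators of the generating function
  have hflow : ∀ t : ℝ, t < 0 → ∀ z ∈ U, ∀ h : E → ℝ, ContDiffAt ℝ 2 h z →
      divC Γ (resFlow L t (grad B h)) z = -∑ k : Fin n, t ^ (k : ℕ) * divOp B Γ (S k) h z := by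
    intro t ht z hz h hh
    have hd := fun k => (hG.contDiffAt_divOp_field hz (hS k z hz) hh).differentiableAt
      (by norm_num)
    have e : resFlow L t (grad B h)
        =ᶠ[𝓝 z] fun y => -∑ k : Fin n, t ^ (k : ℕ) • S k y (grad B h y) := by
      filter_upwards [hG.isOpen.mem_nhds hz] with w hw
      have h1 : resFlow L t (grad B h) w = -((∑ k : Fin n, t ^ (k : ℕ) • S k w) (grad B h w)) := by
        rw [hgen t ht w hw]
        simp [resFlow]
      rw [h1, sum_apply]
      rfl
    have hs : HasFDerivAt (fun y => -∑ k : Fin n, t ^ (k : ℕ) • S k y (grad B h y))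
        (-∑ k : Fin n, t ^ (k : ℕ) • fderiv ℝ (fun y => S k y (grad B h y)) z) z :=
      (HasFDerivAt.fun_sum fun k _ => ((hd k).hasFDerivAt.const_smul (t ^ (k : ℕ)))).neg
    rw [divC, e.fderiv_eq, e.self_of_nhds, hs.fderiv]
    simp only [map_neg, map_sum, map_smul, smul_eq_mul, divOp, divC, mul_add,
      Finset.sum_add_distrib]
    ring
  refine coeff_eq_zero_of_eval_neg (fun k m => ∫ z, ρ z * (divOp B Γ (S k) f z *
    divOp B Γ (S m) φ z - divOp B Γ (S m) f z * divOp B Γ (S k) φ z) ∂μ) ?_ k m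
  intro s t hs ht hst
  rw [← hG.integral_divOp_resolv μ hst (hunit s hs) (hunit t ht) hf hφ hc hφU]
  simp_rw [← integral_const_mul]
  have hi := fun k m => (hint k m).const_mul (s ^ (k : ℕ) * t ^ (m : ℕ))
  have e1 : ∀ k : Fin n, ∑ m : Fin n, ∫ z, s ^ (k : ℕ) * t ^ (m : ℕ) * (ρ z * (divOp B Γ (S k) f z *
      divOp B Γ (S m) φ z - divOp B Γ (S m) f z * divOp B Γ (S k) φ z)) ∂μ
      = ∫ z, ∑ m : Fin n, s ^ (k : ℕ) * t ^ (m : ℕ) * (ρ z * (divOp B Γ (S k) f z *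
      divOp B Γ (S m) φ z - divOp B Γ (S m) f z * divOp B Γ (S k) φ z)) ∂μ := fun k =>
    (integral_finsetSum _ fun m _ => hi k m).symm
  simp_rw [e1]
  rw [← integral_finsetSum _ fun k _ => integrable_finsetSum _ fun m _ => hi k m]
  refine integral_congr_ae (Eventually.of_forall fun z => ?_)
  simp only
  by_cases hz : z ∈ U
  · rw [hflow s hs z hz f (hf z hz), hflow t ht z hz f (hf z hz), hflow s hs z hz φ (hφ2 z),
      hflow t ht z hz φ (hφ2 z), neg_mul_neg, neg_mul_neg,
      Finset.sum_mul_sum, mul_comm (∑ k : Fin n, t ^ (k : ℕ) * divOp B Γ (S k) f z),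
      Finset.sum_mul_sum, ← Finset.sum_sub_distrib, Finset.mul_sum]
    refine Finset.sum_congr rfl fun k _ => ?_
    rw [← Finset.sum_sub_distrib, Finset.mul_sum]
    exact Finset.sum_congr rfl fun m _ => by ring
  · have hzK : z ∉ tsupport φ := fun h => hz (hφU h)
    have h0 : ∀ r, resFlow L r (grad B φ) =ᶠ[𝓝 z] fun _ => 0 := fun r => by
      filter_upwards [(isClosed_tsupport φ).isOpen_compl.mem_nhds hzK] with w hw
      rw [resFlow, grad_eq_zero B hw, map_zero, smul_zero]
    simp [divC_eq_zero Γ (h0 s), divC_eq_zero Γ (h0 t), divOp_eq_zero B Γ _ hzK]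

/-- The operators `div (Sₖ ∇f)` commute on every `C²` function for which both compositions are
defined. -/
theorem divOp_comm [MeasurableSpace E] [BorelSpace E] (μ : Measure E)
    [μ.IsAddHaarMeasure] (hG : BMGeometry U B Γ ρ L l)
    (hunit : ∀ t : ℝ, t < 0 → ∀ z ∈ U, IsUnit (t • (1 : E →L[ℝ] E) - L z))
    {n : ℕ} {S : Fin n → E → E →L[ℝ] E} (hS : ∀ k, ∀ z ∈ U, ContDiffAt ℝ 1 (S k) z)
    (hSs : ∀ k, ∀ z ∈ U, ∀ x y, B z (S k z x) y = B z x (S k z y))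
    (hgen : ∀ t : ℝ, t < 0 → ∀ z ∈ U,
      ∑ k : Fin n, t ^ (k : ℕ) • S k z = -(resDet L t z • resolv L t z))
    {f : E → ℝ} (hf : ∀ z ∈ U, ContDiffAt ℝ 2 f z) (k m : Fin n)
    (hk : ∀ z ∈ U, ContDiffAt ℝ 2 (divOp B Γ (S k) f) z)
    (hm : ∀ z ∈ U, ContDiffAt ℝ 2 (divOp B Γ (S m) f) z) {z : E} (hz : z ∈ U) :
    divOp B Γ (S k) (divOp B Γ (S m) f) z = divOp B Γ (S m) (divOp B Γ (S k) f) z := by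
  let H : E → ℝ := fun z => ρ z * (divOp B Γ (S k) (divOp B Γ (S m) f) z
    - divOp B Γ (S m) (divOp B Γ (S k) f) z)
  have hHc : ContinuousOn H U := fun z hz =>
    ((hG.contDiffAt_ρ z hz).continuousAt.mul
      ((hG.continuousAt_divOp hz (hS k z hz) (hm z hz)).sub
        (hG.continuousAt_divOp hz (hS m z hz) (hk z hz)))).continuousWithinAt
  have hH0 : ∀ᵐ x ∂μ, x ∈ U → H x = 0 := by
    refine hG.isOpen.ae_eq_zero_of_integral_contDiff_smul_eq_zero
      (hHc.locallyIntegrableOn hG.isOpen.measurableSet) fun φ hφ hc hφU => ?_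
    have hφ2 : ∀ z ∈ U, ContDiffAt ℝ 2 φ z := fun z _ => by
      exact_mod_cast (contDiff_infty.1 hφ 2).contDiffAt
    have hφ0 : ∀ z ∉ tsupport φ, φ z = 0 := fun z hz => image_eq_zero_of_notMem_tsupport hz
    have h1 := hG.green μ (hS k) (hSs k) hm hφ2 hc hφU
    have h2 := hG.green μ (hS m) (hSs m) hk hφ2 hc hφU
    have h3 := hG.integral_divOp_coeff μ hunit hS hgen hf hφ hc hφU m k
    have i1 : ∀ (a b : Fin n), (∀ z ∈ U, ContDiffAt ℝ 2 (divOp B Γ (S b) f) z) →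
        Integrable (fun z => ρ z * (divOp B Γ (S a) (divOp B Γ (S b) f) z * φ z)) μ := by
      intro a b hb
      refine integrable_of_compact_subset hc hφU (fun z hz => ?_) fun z hz => by simp [hφ0 z hz]
      exact (hG.contDiffAt_ρ z hz).continuousAt.mul
        ((hG.continuousAt_divOp hz (hS a z hz) (hb z hz)).mul (hφ2 z hz).continuousAt)
    have i2 : ∀ (a b : Fin n), (∀ z ∈ U, ContDiffAt ℝ 2 (divOp B Γ (S b) f) z) →
        Integrable (fun z => ρ z * (divOp B Γ (S b) f z * divOp B Γ (S a) φ z)) μ := by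
      intro a b hb
      refine integrable_of_compact_subset hc hφU (fun z hz => ?_)
        fun z hz => by simp [divOp_eq_zero B Γ _ hz]
      exact (hG.contDiffAt_ρ z hz).continuousAt.mul
        ((hb z hz).continuousAt.mul (hG.continuousAt_divOp hz (hS a z hz) (hφ2 z hz)))
    calc ∫ x, φ x • H x ∂μ
        = ∫ x, (ρ x * (divOp B Γ (S k) (divOp B Γ (S m) f) x * φ x)
            - ρ x * (divOp B Γ (S m) (divOp B Γ (S k) f) x * φ x)) ∂μ := by
          refine integral_congr_ae (Eventually.of_forall fun x => ?_)
          simp only [H, smul_eq_mul]; ring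
      _ = ∫ x, (ρ x * (divOp B Γ (S m) f x * divOp B Γ (S k) φ x)
            - ρ x * (divOp B Γ (S k) f x * divOp B Γ (S m) φ x)) ∂μ := by
          rw [integral_sub (i1 k m hm) (i1 m k hk), h1, h2, ← integral_sub (i2 k m hm) (i2 m k hk)]
      _ = 0 := by
          rw [← h3]
          refine integral_congr_ae (Eventually.of_forall fun x => ?_)
          simp only; ring
  have hEq : Set.EqOn H (fun _ => 0) U := by
    refine Measure.eqOn_open_of_ae_eq (μ := μ) ?_ hG.isOpen hHc continuousOn_const
    exact (ae_restrict_iff' hG.isOpen.measurableSet).2 hH0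
  have := hEq hz
  exact sub_eq_zero.1 ((mul_eq_zero.1 this).resolve_left (hG.pos_ρ z hz).ne')

end BMGeometry
end WeakCommutation

/-! ### Metrics given by matrix fields -/

section MatrixFields

variable {n : ℕ}

local notation "𝔼" => EuclideanSpace ℝ (Fin n)

/-- The `i`-th coordinate as a continuous linear functional. -/
def crd (i : Fin n) : 𝔼 →L[ℝ] ℝ := EuclideanSpace.proj i

@[simp] lemma crd_apply (i : Fin n) (x : 𝔼) : crd i x = x i := rfl

lemma stdVec_apply (i j : Fin n) : (stdVec i : 𝔼) j = if j = i then 1 else 0 := by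
  simp [stdVec]

lemma eq_sum_stdVec (x : 𝔼) : x = ∑ i, x i • stdVec i := by
  ext j
  simp [stdVec_apply]

lemma clm_ext_stdVec {F : Type*} [NormedAddCommGroup F] [NormedSpace ℝ F] {S T : 𝔼 →L[ℝ] F}
    (h : ∀ i, S (stdVec i) = T (stdVec i)) : S = T := by
  ext x
  rw [eq_sum_stdVec x]
  simp [h]

lemma clm_apply_eq_sum {F : Type*} [NormedAddCommGroup F] [NormedSpace ℝ F] (S : 𝔼 →L[ℝ] F)
    (x : 𝔼) : S x = ∑ i, x i • S (stdVec i) := by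
  conv_lhs => rw [eq_sum_stdVec x]
  simp

lemma trL_eq_sum (T : 𝔼 →L[ℝ] 𝔼) : trL T = ∑ i, T (stdVec i) i := by
  rw [trL_eq_trace,
    LinearMap.trace_eq_matrix_trace ℝ (EuclideanSpace.basisFun (Fin n) ℝ).toBasis, Matrix.trace]
  refine Finset.sum_congr rfl fun i _ => ?_
  simp [LinearMap.toMatrix_apply, stdVec]

/-- The bilinear form with matrix `A`. -/
def bil (A : Matrix (Fin n) (Fin n) ℝ) : 𝔼 →L[ℝ] 𝔼 →L[ℝ] ℝ :=
  ∑ i, ∑ j, A i j • (crd i).smulRight (crd j)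

lemma bil_apply (A : Matrix (Fin n) (Fin n) ℝ) (x y : 𝔼) :
    bil A x y = x ⬝ᵥ A.mulVec y := by
  simp only [bil, sum_apply, smul_apply, ContinuousLinearMap.smulRight_apply, crd_apply,
    smul_eq_mul, dotProduct, Matrix.mulVec, Finset.mul_sum]
  exact Finset.sum_congr rfl fun i _ => Finset.sum_congr rfl fun j _ => by ring

lemma bil_stdVec (A : Matrix (Fin n) (Fin n) ℝ) (i j : Fin n) :
    bil A (stdVec i) (stdVec j) = A i j := by
  rw [bil_apply]
  simp [stdVec]

/-- The endomorphism with matrix `A`. -/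
def endo (A : Matrix (Fin n) (Fin n) ℝ) : 𝔼 →L[ℝ] 𝔼 := Matrix.toEuclideanCLM (𝕜 := ℝ) A

lemma endo_apply (A : Matrix (Fin n) (Fin n) ℝ) (x : 𝔼) (i : Fin n) :
    endo A x i = A.mulVec x i := rfl

lemma endo_mul (A A' : Matrix (Fin n) (Fin n) ℝ) : endo (A * A') = endo A ∘L endo A' :=
  map_mul (Matrix.toEuclideanCLM (𝕜 := ℝ)) A A'

lemma endo_one : endo (1 : Matrix (Fin n) (Fin n) ℝ) = 1 :=
  map_one (Matrix.toEuclideanCLM (𝕜 := ℝ))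

lemma endo_smul (c : ℝ) (A : Matrix (Fin n) (Fin n) ℝ) : endo (c • A) = c • endo A :=
  map_smul (Matrix.toEuclideanCLM (𝕜 := ℝ)) c A

lemma endo_sub (A A' : Matrix (Fin n) (Fin n) ℝ) : endo (A - A') = endo A - endo A' :=
  map_sub (Matrix.toEuclideanCLM (𝕜 := ℝ)) A A'

lemma endo_sum {ι : Type*} (s : Finset ι) (A : ι → Matrix (Fin n) (Fin n) ℝ) :
    endo (∑ i ∈ s, A i) = ∑ i ∈ s, endo (A i) :=
  map_sum (Matrix.toEuclideanCLM (𝕜 := ℝ)) A s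

lemma bil_endo (A S : Matrix (Fin n) (Fin n) ℝ) (x y : 𝔼) :
    bil A x (endo S y) = bil (A * S) x y := by
  rw [bil_apply, bil_apply, ← Matrix.mulVec_mulVec]
  rfl

lemma bil_symm {A : Matrix (Fin n) (Fin n) ℝ} (hA : A.IsHermitian) (x y : 𝔼) :
    bil A x y = bil A y x := by
  have hT : A.transpose = A := by simpa [Matrix.IsHermitian] using hA
  rw [bil_apply, bil_apply, Matrix.dotProduct_mulVec, ← Matrix.mulVec_transpose, hT,
    dotProduct_comm]

lemma det_endo (A : Matrix (Fin n) (Fin n) ℝ) : (endo A).det = A.det := by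
  rw [ContinuousLinearMap.det, ← LinearMap.det_toMatrix (EuclideanSpace.basisFun (Fin n) ℝ).toBasis]
  congr 1
  ext i j
  rw [LinearMap.toMatrix_apply]
  have : (endo A (stdVec j)) i = A i j := by
    rw [endo_apply]
    simp [stdVec]
  simpa [stdVec] using this

lemma endo_stdVec (A : Matrix (Fin n) (Fin n) ℝ) (i j : Fin n) : endo A (stdVec j) i = A i j := by
  rw [endo_apply]
  simp [stdVec]

lemma endo_eq_sum (A : Matrix (Fin n) (Fin n) ℝ) :
    endo A = ∑ i, ∑ j, A i j • (crd j).smulRight (stdVec i) := by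
  refine clm_ext_stdVec fun j => ?_
  ext i
  rw [endo_stdVec]
  simp [stdVec_apply]

/-- The bilinear map with components `c k i j`. -/
def mkConn (c : Fin n → Fin n → Fin n → ℝ) : 𝔼 →L[ℝ] 𝔼 →L[ℝ] 𝔼 :=
  ∑ k, ∑ i, ∑ j, c k i j • (crd i).smulRight ((crd j).smulRight (stdVec k))

lemma mkConn_apply (c : Fin n → Fin n → Fin n → ℝ) (x y : 𝔼) (k : Fin n) :
    mkConn c x y k = ∑ i, ∑ j, c k i j * x i * y j := by
  simp [mkConn, stdVec_apply, mul_assoc]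

lemma mkConn_stdVec (c : Fin n → Fin n → Fin n → ℝ) (i j : Fin n) :
    mkConn c (stdVec i) (stdVec j) = ∑ k, c k i j • stdVec k := by
  ext k
  rw [mkConn_apply]
  simp [stdVec_apply]

variable {z : EuclideanSpace ℝ (Fin n)} {m : WithTop ℕ∞}

lemma contDiffAt_smul_vec {F : Type*} [NormedAddCommGroup F] [NormedSpace ℝ F] {f : 𝔼 → ℝ}
    (hf : ContDiffAt ℝ m f z) (v : F) : ContDiffAt ℝ m (fun y => f y • v) z :=
  hf.smul contDiffAt_const

/-- A matrix-valued function with `C^m` entries. -/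
def SmoothEntries (m : WithTop ℕ∞) (A : 𝔼 → Matrix (Fin n) (Fin n) ℝ) (z : 𝔼) : Prop :=
  ∀ i j, ContDiffAt ℝ m (fun y => A y i j) z

lemma SmoothEntries.det {A : 𝔼 → Matrix (Fin n) (Fin n) ℝ} (hA : SmoothEntries m A z) :
    ContDiffAt ℝ m (fun y => (A y).det) z := by
  simp only [Matrix.det_apply']
  exact ContDiffAt.sum fun σ _ => contDiffAt_const.mul (contDiffAt_prod fun i _ => hA _ _)

lemma SmoothEntries.inv {A : 𝔼 → Matrix (Fin n) (Fin n) ℝ} (hA : SmoothEntries m A z)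
    (h0 : (A z).det ≠ 0) : SmoothEntries m (fun y => (A y)⁻¹) z := by
  intro i j
  have h : (fun y => (A y)⁻¹ i j) = fun y => ((A y).det)⁻¹ * (A y).adjugate i j := by
    funext y
    simp [Matrix.inv_def, Ring.inverse_eq_inv']
  rw [h]
  refine (hA.det.inv h0).mul ?_
  simp only [Matrix.adjugate_apply]
  refine SmoothEntries.det (A := fun y => (A y).updateRow j (Pi.single i 1)) fun a b => ?_
  by_cases ha : a = j
  · subst ha
    simp only [Matrix.updateRow_self]
    exact contDiffAt_const
  · simp only [Matrix.updateRow_ne ha]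
    exact hA a b

lemma SmoothEntries.mul {A A' : 𝔼 → Matrix (Fin n) (Fin n) ℝ} (hA : SmoothEntries m A z)
    (hA' : SmoothEntries m A' z) : SmoothEntries m (fun y => A y * A' y) z := by
  intro i j
  simp only [Matrix.mul_apply]
  exact ContDiffAt.sum fun k _ => (hA i k).mul (hA' k j)

lemma SmoothEntries.smul {f : 𝔼 → ℝ} {A : 𝔼 → Matrix (Fin n) (Fin n) ℝ} (hf : ContDiffAt ℝ m f z)
    (hA : SmoothEntries m A z) : SmoothEntries m (fun y => f y • A y) z := by
  intro i j
  exact hf.mul (hA i j)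

lemma SmoothEntries.pow {A : 𝔼 → Matrix (Fin n) (Fin n) ℝ} (hA : SmoothEntries m A z) (k : ℕ) :
    SmoothEntries m (fun y => A y ^ k) z := by
  induction k with
  | zero => intro i j; simp only [pow_zero]; exact contDiffAt_const
  | succ k ih => simp only [pow_succ]; exact ih.mul hA

lemma SmoothEntries.contDiffAt_endo {A : 𝔼 → Matrix (Fin n) (Fin n) ℝ}
    (hA : SmoothEntries m A z) : ContDiffAt ℝ m (fun y => endo (A y)) z := by
  simp only [endo_eq_sum]
  exact ContDiffAt.sum fun i _ => ContDiffAt.sum fun j _ => contDiffAt_smul_vec (hA i j) _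

lemma SmoothEntries.contDiffAt_bil {A : 𝔼 → Matrix (Fin n) (Fin n) ℝ}
    (hA : SmoothEntries m A z) : ContDiffAt ℝ m (fun y => bil (A y)) z := by
  simp only [bil]
  exact ContDiffAt.sum fun i _ => ContDiffAt.sum fun j _ => contDiffAt_smul_vec (hA i j) _

lemma contDiffAt_pd {f : 𝔼 → ℝ} {k : WithTop ℕ∞} (hmk : m + 1 ≤ k) (hf : ContDiffAt ℝ k f z)
    (i : Fin n) : ContDiffAt ℝ m (pd i f) z :=
  (hf.fderiv_right hmk).clm_apply contDiffAt_const

/-- The Christoffel symbols of the metric with matrix field `γ`. -/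
def chr (γ : 𝔼 → Matrix (Fin n) (Fin n) ℝ) (k i j : Fin n) (z : 𝔼) : ℝ :=
  (1 / 2) * ∑ m : Fin n, (γ z)⁻¹ k m *
    (pd i (fun y => γ y m j) z + pd j (fun y => γ y m i) z - pd m (fun y => γ y i j) z)

/-- The Levi-Civita connection of the metric with matrix field `γ`. -/
def conn (γ : 𝔼 → Matrix (Fin n) (Fin n) ℝ) (z : 𝔼) : 𝔼 →L[ℝ] 𝔼 →L[ℝ] 𝔼 :=
  mkConn fun k i j => chr γ k i j z

/-- The Christoffel symbols of the first kind. -/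
lemma sum_mul_chr {γ : 𝔼 → Matrix (Fin n) (Fin n) ℝ} (h0 : (γ z).det ≠ 0) (a i j : Fin n) :
    ∑ k, γ z a k * chr γ k i j z
      = (1 / 2) * (pd i (fun y => γ y a j) z + pd j (fun y => γ y a i) z
        - pd a (fun y => γ y i j) z) := by
  have h : ∀ v : Fin n → ℝ, ∑ k, γ z a k * ∑ m, (γ z)⁻¹ k m * v m = v a := by
    intro v
    have := congrFun (congrArg (fun A => A.mulVec v) (Matrix.mul_nonsing_inv (γ z)
      (isUnit_iff_ne_zero.2 h0))) a
    simp only [← Matrix.mulVec_mulVec, Matrix.one_mulVec] at this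
    exact this
  simp only [chr]
  rw [← h fun m => pd i (fun y => γ y m j) z + pd j (fun y => γ y m i) z
        - pd m (fun y => γ y i j) z, Finset.mul_sum]
  exact Finset.sum_congr rfl fun k _ => by ring

lemma contDiffAt_chr {γ : 𝔼 → Matrix (Fin n) (Fin n) ℝ} (hγ : SmoothEntries 2 γ z)
    (h0 : (γ z).det ≠ 0) (k i j : Fin n) : ContDiffAt ℝ 1 (chr γ k i j) z := by
  have h12 : (1 : WithTop ℕ∞) + 1 ≤ 2 := by norm_num
  have hinv := hγ.inv h0
  refine contDiffAt_const.mul (ContDiffAt.sum fun m _ => ((hinv k m).of_le (by norm_num)).mul ?_)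
  exact ((contDiffAt_pd h12 (hγ m j) i).add (contDiffAt_pd h12 (hγ m i) j)).sub
    (contDiffAt_pd h12 (hγ i j) m)

lemma contDiffAt_conn {γ : 𝔼 → Matrix (Fin n) (Fin n) ℝ} (hγ : SmoothEntries 2 γ z)
    (h0 : (γ z).det ≠ 0) : ContDiffAt ℝ 1 (conn γ) z := by
  unfold conn mkConn
  exact ContDiffAt.sum fun k _ => ContDiffAt.sum fun i _ => ContDiffAt.sum fun j _ =>
    contDiffAt_smul_vec (contDiffAt_chr hγ h0 k i j) _

lemma fderiv_bil_apply {γ : 𝔼 → Matrix (Fin n) (Fin n) ℝ} (hγ : SmoothEntries 1 γ z)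
    (x : 𝔼) (i j : Fin n) :
    fderiv ℝ (fun y => bil (γ y)) z x (stdVec i) (stdVec j) = fderiv ℝ (fun y => γ y i j) z x := by
  have h1 := (hγ.contDiffAt_bil.differentiableAt (by norm_num)).hasFDerivAt
  have h2 := (h1.clm_apply (hasFDerivAt_const (stdVec i) z)).clm_apply
    (hasFDerivAt_const (stdVec j) z)
  have h3 : (fun y => γ y i j) = fun y => bil (γ y) (stdVec i) (stdVec j) := by
    funext y; rw [bil_stdVec]
  rw [h3, h2.fderiv]
  simp

/-- The metric geometry of a `C²` field of positive definite matrices. -/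
lemma metricGeometry_of_matrix {U : Set 𝔼} (hU : IsOpen U) {γ : 𝔼 → Matrix (Fin n) (Fin n) ℝ}
    (hγ : ∀ z ∈ U, SmoothEntries 2 γ z) (hpos : ∀ z ∈ U, (γ z).PosDef) :
    MetricGeometry U (fun z => bil (γ z)) (conn γ) (fun z => √(γ z).det) := by
  have h0 : ∀ z ∈ U, (γ z).det ≠ 0 := fun z hz => (hpos z hz).det_pos.ne'
  have hγ1 : ∀ z ∈ U, SmoothEntries 1 γ z := fun z hz i j => (hγ z hz i j).of_le (by norm_num)
  have hsym : ∀ z ∈ U, ∀ i j, γ z i j = γ z j i := fun z hz i j => by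
    have := (hpos z hz).isHermitian.apply i j
    simpa using this.symm
  have hpdsym : ∀ z ∈ U, ∀ k i j, pd k (fun y => γ y i j) z = pd k (fun y => γ y j i) z := by
    intro z hz k i j
    have : (fun y => γ y i j) =ᶠ[𝓝 z] fun y => γ y j i := by
      filter_upwards [hU.mem_nhds hz] with y hy using hsym y hy i j
    rw [pd, pd, this.fderiv_eq]
  have hchr : ∀ z ∈ U, ∀ k i j, chr γ k i j z = chr γ k j i z := by
    intro z hz k i j
    simp only [chr]
    congr 1
    refine Finset.sum_congr rfl fun m _ => ?_
    rw [hpdsym z hz m i j]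
    ring
  have hcompat : ∀ z ∈ U, ∀ x y w, fderiv ℝ (fun z => bil (γ z)) z x y w
      = bil (γ z) (conn γ z x y) w + bil (γ z) y (conn γ z x w) := by
    intro z hz x y w
    have e3 : ∀ i j k, fderiv ℝ (fun z => bil (γ z)) z (stdVec i) (stdVec j) (stdVec k)
        = bil (γ z) (conn γ z (stdVec i) (stdVec j)) (stdVec k)
          + bil (γ z) (stdVec j) (conn γ z (stdVec i) (stdVec k)) := by
      intro i j k
      rw [fderiv_bil_apply (hγ1 z hz), bil_symm (hpos z hz).isHermitian _ (stdVec k), conn,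
        mkConn_stdVec, mkConn_stdVec]
      simp only [map_sum, map_smul, bil_stdVec, smul_eq_mul]
      have e1 := sum_mul_chr (h0 z hz) k i j
      have e2 := sum_mul_chr (h0 z hz) j i k
      simp only [mul_comm (γ z _ _)] at e1 e2
      rw [e1, e2, hpdsym z hz i k j, hpdsym z hz j k i, hpdsym z hz k i j]
      change pd i (fun y => γ y j k) z = _
      ring
    have e2 : ∀ i j, fderiv ℝ (fun z => bil (γ z)) z (stdVec i) (stdVec j)
        = bil (γ z) (conn γ z (stdVec i) (stdVec j))
          + bil (γ z) (stdVec j) ∘L conn γ z (stdVec i) :=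
      fun i j => clm_ext_stdVec fun k => e3 i j k
    have e1 : ∀ i, (fderiv ℝ (fun z => bil (γ z)) z (stdVec i)).flip w
        = (bil (γ z)).flip w ∘L conn γ z (stdVec i) + (bil (γ z)).flip (conn γ z (stdVec i) w) :=
      fun i => clm_ext_stdVec fun j => by simp [e2]
    have e0 : ((fderiv ℝ (fun z => bil (γ z)) z).flip y).flip w
        = (bil (γ z)).flip w ∘L (conn γ z).flip y + bil (γ z) y ∘L (conn γ z).flip w :=
      clm_ext_stdVec fun i => by
        have := DFunLike.congr_fun (e1 i) y
        simpa using this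
    have := DFunLike.congr_fun e0 x
    simpa using this
  have hposB : ∀ z ∈ U, ∀ x, x ≠ 0 → 0 < bil (γ z) x x := by
    intro z hz x hx
    rw [bil_apply]
    have hx' : (x : Fin n → ℝ) ≠ 0 := fun h => hx (by ext i; exact congrFun h i)
    simpa using (hpos z hz).dotProduct_mulVec_pos hx'
  refine ⟨hU, fun z hz => (hγ z hz).contDiffAt_bil, fun z hz => bil_symm (hpos z hz).isHermitian,
    hposB, fun z hz => contDiffAt_conn (hγ z hz) (h0 z hz), ?_, hcompat,
    fun z hz => (hγ z hz).det.sqrt (h0 z hz), fun z hz => Real.sqrt_pos.2 (hpos z hz).det_pos, ?_⟩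
  · intro z hz x y
    ext k
    rw [conn, mkConn_apply, mkConn_apply, Finset.sum_comm]
    refine Finset.sum_congr rfl fun i _ => Finset.sum_congr rfl fun j _ => ?_
    rw [hchr z hz k j i]
    ring
  · intro z hz x
    set g := γ z with hg
    have hdet := h0 z hz
    have hinv : endo g ∘L endo g⁻¹ = ContinuousLinearMap.id ℝ 𝔼 := by
      rw [← endo_mul, Matrix.mul_nonsing_inv _ (isUnit_iff_ne_zero.2 hdet), endo_one]; rfl
    obtain ⟨D, hD, hD'⟩ := hasFDerivAt_det hinv
    have hE := ((hγ1 z hz).contDiffAt_endo.differentiableAt (by norm_num)).hasFDerivAt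
    have hcomp := (hD.comp z hE).sqrt (by rw [Function.comp, det_endo]; exact hdet)
    have hfun : (fun y => √(γ y).det) = fun y => √(((fun A : 𝔼 →L[ℝ] 𝔼 => A.det) ∘
        fun y => endo (γ y)) y) := by
      funext y; simp [det_endo]
    have hbe : ∀ x y w, bil g y (endo g⁻¹ (fderiv ℝ (fun y => endo (γ y)) z x w))
        = fderiv ℝ (fun z => bil (γ z)) z x y w := by
      intro x y w
      have hB := ((hγ1 z hz).contDiffAt_bil.differentiableAt (by norm_num)).hasFDerivAt
      have h1 := (hB.clm_apply (hasFDerivAt_const y z)).clm_apply (hasFDerivAt_const w z)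
      have h2 := (bil 1 y).hasFDerivAt.comp z (hE.clm_apply (hasFDerivAt_const w z))
      have h3 : (fun y' => bil (γ y') y w) = (bil 1 y) ∘ fun y' => endo (γ y') w := by
        funext y'
        rw [Function.comp, bil_endo, Matrix.one_mul]
      rw [h3] at h1
      have h4 := DFunLike.congr_fun (h1.unique h2) x
      rw [bil_endo, Matrix.mul_nonsing_inv _ (isUnit_iff_ne_zero.2 hdet)]
      simpa using h4.symm
    have htr : trL (endo g⁻¹ ∘L fderiv ℝ (fun y => endo (γ y)) z x) = 2 * trL (conn γ z x) := by
      have := trL_eq_of_adjoint (bil g) (fun a ha => by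
          by_contra hne
          exact (hposB z hz a hne).ne' (ha a))
        (endo g⁻¹ ∘L fderiv ℝ (fun y => endo (γ y)) z x - conn γ z x) (conn γ z x) (by
          intro a b
          rw [bil_symm (hpos z hz).isHermitian, sub_apply, ContinuousLinearMap.map_sub,
            ContinuousLinearMap.comp_apply, hbe, hcompat z hz, add_sub_cancel_right,
            bil_symm (hpos z hz).isHermitian])
      rw [map_sub] at this
      linarith
    rw [hfun, hcomp.fderiv]
    simp only [smul_apply, ContinuousLinearMap.comp_apply, hD', htr, smul_eq_mul,
      Function.comp, det_endo]
    have hs : √g.det * √g.det = g.det := Real.mul_self_sqrt (hpos z hz).det_pos.le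
    have hs0 : √g.det ≠ 0 := (Real.sqrt_pos.2 (hpos z hz).det_pos).ne'
    rw [← hg]
    field_simp
    rw [sq, hs]

end MatrixFields

/-! ### The generating function of the endomorphisms `S_k` -/

section MatrixGenerating

variable {n : ℕ}

/-- The coefficients `c_i` are those of the characteristic polynomial in descending order, up to
sign. -/
lemma charCoeff_eq (G : Matrix (Fin n) (Fin n) ℝ) (i : ℕ) :
    charCoeff G i = (-1) ^ n * G.charpoly.coeff (n - i) := by
  have h : G.map (C : ℝ →+* ℝ[X]) - (X : ℝ[X]) • (1 : Matrix (Fin n) (Fin n) ℝ[X])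
      = -G.charmatrix := by
    ext a b : 2
    simp [Matrix.charmatrix, Matrix.one_apply, Matrix.diagonal_apply]
  rw [charCoeff, h, Matrix.det_neg, ← Matrix.charpoly, Fintype.card_fin, ← C_1, ← C_neg, ← C_pow,
    coeff_C_mul]

/-- Horner's evaluation of the Cayley–Hamilton identity. -/
lemma sum_charCoeff_pow (G : Matrix (Fin n) (Fin n) ℝ) :
    ∑ i ∈ Finset.range (n + 1), charCoeff G i • G ^ (n - i) = 0 := by
  have h := G.aeval_self_charpoly
  rw [aeval_eq_sum_range' (n := n + 1)
    (by rw [G.charpoly_natDegree_eq_dim, Fintype.card_fin]; omega),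
    ← Finset.sum_range_reflect] at h
  simp only [charCoeff_eq, mul_smul, ← Finset.smul_sum]
  rw [show ∑ i ∈ Finset.range (n + 1), G.charpoly.coeff (n - i) • G ^ (n - i) = 0 from ?_,
    smul_zero]
  rw [← h]
  exact Finset.sum_congr rfl fun i _ => by simp

lemma charCoeff_self (G : Matrix (Fin n) (Fin n) ℝ) : charCoeff G n = G.det := by
  rw [charCoeff_eq, Nat.sub_self, Matrix.det_eq_sign_charpoly_coeff, Fintype.card_fin]

lemma det_sub_smul_one (G : Matrix (Fin n) (Fin n) ℝ) (μ : ℝ) :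
    (G - μ • (1 : Matrix (Fin n) (Fin n) ℝ)).det
      = ∑ i ∈ Finset.range (n + 1), charCoeff G i * μ ^ (n - i) := by
  have h1 : (G - μ • (1 : Matrix (Fin n) (Fin n) ℝ)).det = (-1) ^ n * G.charpoly.eval μ := by
    rw [Matrix.eval_charpoly, show G - μ • (1 : Matrix (Fin n) (Fin n) ℝ)
      = -(Matrix.scalar (Fin n) μ - G) by
        rw [Matrix.scalar_apply, neg_sub, Matrix.smul_one_eq_diagonal],
      Matrix.det_neg, Fintype.card_fin]
  rw [h1, eval_eq_sum_range' (n := n + 1)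
    (by rw [G.charpoly_natDegree_eq_dim, Fintype.card_fin]; omega),
    ← Finset.sum_range_reflect, Finset.mul_sum]
  exact Finset.sum_congr rfl fun i _ => by rw [charCoeff_eq]; simp [mul_assoc]

/-- The matrix of `S_k` for metrics with matrices `A` and `A'`. -/
def sMat (A A' : Matrix (Fin n) (Fin n) ℝ) (k : ℕ) : Matrix (Fin n) (Fin n) ℝ :=
  ((A.det / A'.det) ^ (((k : ℝ) + 2) / ((n : ℝ) + 1))) •
    ∑ i ∈ Finset.range (k + 1), charCoeff (A⁻¹ * A') i • (A⁻¹ * A') ^ (k - i + 1)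

/-- The conformal factor `D = (det A' / det A) ^ (1 / (n + 1))`. -/
def dMat (A A' : Matrix (Fin n) (Fin n) ℝ) : ℝ := (A'.det / A.det) ^ (1 / ((n : ℝ) + 1))

/-- The Benenti tensor `L = D G⁻¹`, where `G = A⁻¹ A'`. -/
def lMat (A A' : Matrix (Fin n) (Fin n) ℝ) : Matrix (Fin n) (Fin n) ℝ :=
  dMat A A' • (A'⁻¹ * A)

section
variable {A A' : Matrix (Fin n) (Fin n) ℝ} (hA : A.PosDef) (hA' : A'.PosDef)
include hA hA'

lemma dMat_pos : 0 < dMat A A' := Real.rpow_pos_of_pos (div_pos hA'.det_pos hA.det_pos) _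

lemma dMat_pow : dMat A A' ^ (n + 1) = (A⁻¹ * A').det := by
  rw [dMat, ← Real.rpow_natCast, ← Real.rpow_mul (div_pos hA'.det_pos hA.det_pos).le,
    Matrix.det_mul, Matrix.det_nonsing_inv, Ring.inverse_eq_inv']
  push_cast
  rw [one_div_mul_cancel (by positivity), Real.rpow_one]
  ring

/-- The factor `(det A / det A') ^ ((k + 2) / (n + 1))` of `S_k` in terms of `D`. -/
lemma det_div_rpow (k : ℕ) :
    (A.det / A'.det) ^ (((k : ℝ) + 2) / ((n : ℝ) + 1)) = (dMat A A')⁻¹ ^ (k + 2) := by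
  rw [dMat, ← Real.rpow_natCast, ← Real.inv_rpow (div_pos hA'.det_pos hA.det_pos).le, inv_div,
    ← Real.rpow_mul (div_pos hA.det_pos hA'.det_pos).le]
  congr 1
  push_cast
  ring

/-- The factorization behind the generating function: `(∑ t ^ k S_k) (t - L) = - det (t - L)`. -/
lemma sum_sMat_mul {t : ℝ} (ht : t ≠ 0) :
    (∑ k ∈ Finset.range n, t ^ k • sMat A A' k) * (t • 1 - lMat A A')
      = -((t • 1 - lMat A A').det • (1 : Matrix (Fin n) (Fin n) ℝ)) := by
  set G := A⁻¹ * A' with hGdef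
  set d := dMat A A' with hd
  have hd0 : d ≠ 0 := (dMat_pos hA hA').ne'
  have uA : IsUnit A.det := isUnit_iff_ne_zero.2 hA.det_pos.ne'
  have uA' : IsUnit A'.det := isUnit_iff_ne_zero.2 hA'.det_pos.ne'
  have hGL : G * lMat A A' = d • (1 : Matrix (Fin n) (Fin n) ℝ) := by
    rw [lMat, Matrix.mul_smul, hGdef, Matrix.mul_assoc, ← Matrix.mul_assoc A',
      Matrix.mul_nonsing_inv _ uA', Matrix.one_mul, Matrix.nonsing_inv_mul _ uA]
  -- `T N` is `S_{N - 1}`, with `T 0 = 0`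
  let T : ℕ → Matrix (Fin n) (Fin n) ℝ := fun N =>
    d⁻¹ ^ (N + 1) • ∑ i ∈ Finset.range N, charCoeff G i • G ^ (N - i)
  have hS : ∀ k, sMat A A' k = T (k + 1) := fun k => by
    rw [sMat, det_div_rpow hA hA']
    change _ = d⁻¹ ^ (k + 1 + 1) • _
    congr 1
    refine Finset.sum_congr rfl fun i hi => ?_
    rw [Nat.sub_add_comm (by simpa [Nat.lt_succ_iff] using hi)]
  have hTL : ∀ N, T (N + 1) * lMat A A'
      = T N + (d⁻¹ ^ (N + 1) * charCoeff G N) • (1 : Matrix (Fin n) (Fin n) ℝ) := by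
    intro N
    have h : (∑ i ∈ Finset.range (N + 1), charCoeff G i • G ^ (N + 1 - i)) * lMat A A'
        = d • ∑ i ∈ Finset.range (N + 1), charCoeff G i • G ^ (N - i) := by
      rw [Finset.sum_mul, Finset.smul_sum]
      refine Finset.sum_congr rfl fun i hi => ?_
      rw [Nat.sub_add_comm (by simpa [Nat.lt_succ_iff] using hi), pow_succ, Matrix.smul_mul,
        Matrix.mul_assoc, hGL, Matrix.mul_smul, Matrix.mul_one, smul_comm]
    change (d⁻¹ ^ (N + 1 + 1) • _) * _ = _
    rw [Matrix.smul_mul, h, smul_smul, pow_succ d⁻¹ (N + 1), mul_assoc, inv_mul_cancel₀ hd0,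
      mul_one, Finset.sum_range_succ, smul_add, Nat.sub_self, pow_zero, smul_smul]
  have hsum : ∀ N, (∑ k ∈ Finset.range N, t ^ k • sMat A A' k) * (t • 1 - lMat A A')
      = t ^ N • T N - (∑ k ∈ Finset.range N, t ^ k * (d⁻¹ ^ (k + 1) * charCoeff G k)) •
        (1 : Matrix (Fin n) (Fin n) ℝ) := by
    intro N
    induction N with
    | zero => simp [T]
    | succ N ih =>
      rw [Finset.sum_range_succ, add_mul, ih, Finset.sum_range_succ, hS, Matrix.smul_mul,
        Matrix.mul_sub, hTL, Matrix.mul_smul, Matrix.mul_one]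
      module
  have hTn : T n = -((d⁻¹ ^ (n + 1) * charCoeff G n) • (1 : Matrix (Fin n) (Fin n) ℝ)) := by
    have h := sum_charCoeff_pow G
    rw [Finset.sum_range_succ, Nat.sub_self, pow_zero] at h
    change d⁻¹ ^ (n + 1) • _ = _
    rw [eq_neg_of_add_eq_zero_left h, smul_neg, smul_smul]
  have hdet : (t • 1 - lMat A A').det
      = ∑ k ∈ Finset.range (n + 1), t ^ k * (d⁻¹ ^ (k + 1) * charCoeff G k) := by
    have h1 : t • 1 - lMat A A' = (t • (A'⁻¹ * A)) * (G - (d / t) • 1) := by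
      rw [Matrix.mul_sub, Matrix.smul_mul, Matrix.smul_mul, Matrix.mul_smul, Matrix.mul_one,
        smul_smul, mul_div_cancel₀ _ ht, hGdef, Matrix.mul_assoc, ← Matrix.mul_assoc A,
        Matrix.mul_nonsing_inv _ uA, Matrix.one_mul, Matrix.nonsing_inv_mul _ uA', lMat]
    have h2 : (A'⁻¹ * A).det = d⁻¹ ^ (n + 1) := by
      rw [inv_pow, dMat_pow hA hA', Matrix.det_mul, Matrix.det_mul, Matrix.det_nonsing_inv,
        Matrix.det_nonsing_inv, Ring.inverse_eq_inv', mul_inv, inv_inv, mul_comm]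
    rw [h1, Matrix.det_mul, Matrix.det_smul, h2, det_sub_smul_one, Fintype.card_fin,
      Finset.mul_sum]
    refine Finset.sum_congr rfl fun i hi => ?_
    obtain ⟨j, rfl⟩ := Nat.exists_eq_add_of_le (Nat.lt_succ_iff.1 (Finset.mem_range.1 hi))
    rw [Nat.add_sub_cancel_left, div_pow, inv_pow, inv_pow, pow_add t,
      show d ^ (i + j + 1) = d ^ (i + 1) * d ^ j by ring]
    have hdj : d ^ j ≠ 0 := pow_ne_zero _ hd0
    have hdi : d ^ (i + 1) ≠ 0 := pow_ne_zero _ hd0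
    have htj : t ^ j ≠ 0 := pow_ne_zero _ ht
    field_simp
  rw [hsum, hTn, hdet, Finset.sum_range_succ]
  module

/-- For `k = n - 1` the Cayley–Hamilton identity gives `S_k = -1`. -/
lemma sMat_last {k : ℕ} (hk : k + 1 = n) : sMat A A' k = -1 := by
  subst hk
  have h := sum_charCoeff_pow (A⁻¹ * A')
  rw [Finset.sum_range_succ, Nat.sub_self, pow_zero, charCoeff_self, ← dMat_pow hA hA'] at h
  have hs : ∑ i ∈ Finset.range (k + 1), charCoeff (A⁻¹ * A') i • (A⁻¹ * A') ^ (k - i + 1)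
      = ∑ i ∈ Finset.range (k + 1), charCoeff (A⁻¹ * A') i • (A⁻¹ * A') ^ (k + 1 - i) :=
    Finset.sum_congr rfl fun i hi => by
      rw [Nat.sub_add_comm (by simpa [Nat.lt_succ_iff] using hi)]
  rw [sMat, det_div_rpow hA hA', hs, eq_neg_of_add_eq_zero_left h, smul_neg, smul_smul, ← mul_pow,
    inv_mul_cancel₀ (dMat_pos hA hA').ne', one_pow, one_smul]

lemma det_lMat_ne_zero {t : ℝ} (ht : t < 0) : (t • 1 - lMat A A').det ≠ 0 := by
  have uA' : IsUnit A'.det := isUnit_iff_ne_zero.2 hA'.det_pos.ne'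
  have h : -(A' * (t • 1 - lMat A A')) = (-t) • A' + dMat A A' • A := by
    rw [lMat, Matrix.mul_sub, Matrix.mul_smul, Matrix.mul_smul, ← Matrix.mul_assoc,
      Matrix.mul_nonsing_inv _ uA', Matrix.one_mul, Matrix.mul_one]
    module
  have hp : ((-t) • A' + dMat A A' • A).PosDef :=
    (hA'.smul (by linarith : 0 < -t)).add (hA.smul (dMat_pos hA hA'))
  intro h0
  have := hp.det_pos.ne'
  rw [← h, Matrix.det_neg, Matrix.det_mul, h0] at this
  simp at this

omit hA' in
/-- `S_k` is self-adjoint for the form `A`. -/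
lemma transpose_sMat_mul (hA's : A'.IsHermitian) (k : ℕ) :
    (sMat A A' k).transpose * A = A * sMat A A' k := by
  have uA : IsUnit A.det := isUnit_iff_ne_zero.2 hA.det_pos.ne'
  have hT : A.transpose = A := by simpa [Matrix.IsHermitian] using hA.isHermitian
  have hT' : A'.transpose = A' := by simpa [Matrix.IsHermitian] using hA's
  have hG : (A⁻¹ * A').transpose * A = A * (A⁻¹ * A') := by
    rw [Matrix.transpose_mul, Matrix.transpose_nonsing_inv, hT, hT', Matrix.mul_assoc,
      Matrix.nonsing_inv_mul _ uA, ← Matrix.mul_assoc, Matrix.mul_nonsing_inv _ uA,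
      Matrix.one_mul, Matrix.mul_one]
  have hp : ∀ m, ((A⁻¹ * A') ^ m).transpose * A = A * (A⁻¹ * A') ^ m := by
    intro m
    induction m with
    | zero => simp
    | succ m ih =>
      rw [pow_succ, Matrix.transpose_mul, Matrix.mul_assoc, ih, ← Matrix.mul_assoc, hG,
        Matrix.mul_assoc, ← pow_succ', pow_succ]
  rw [sMat, Matrix.transpose_smul, Matrix.transpose_sum, Matrix.smul_mul, Matrix.mul_smul,
    Finset.sum_mul, Finset.mul_sum]
  congr 1
  refine Finset.sum_congr rfl fun i _ => ?_
  rw [Matrix.transpose_smul, Matrix.smul_mul, Matrix.mul_smul, hp]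

end

/-- `S_k` transforms as an endomorphism under a change of coordinates. -/
lemma sMat_conj {J : Matrix (Fin n) (Fin n) ℝ} (hJ : IsUnit J.det)
    (A A' : Matrix (Fin n) (Fin n) ℝ) (k : ℕ) :
    J * sMat (J.transpose * A * J) (J.transpose * A' * J) k = sMat A A' k * J := by
  set G := A⁻¹ * A' with hG
  set G' := (J.transpose * A * J)⁻¹ * (J.transpose * A' * J) with hG'
  have hJT : IsUnit J.transpose.det := by rwa [Matrix.det_transpose]
  have hJG : J * G' = G * J := by
    rw [hG', hG, Matrix.mul_inv_rev, Matrix.mul_inv_rev]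
    simp only [Matrix.mul_assoc]
    rw [Matrix.mul_nonsing_inv_cancel_left _ _ hJ, Matrix.nonsing_inv_mul_cancel_left _ _ hJT]
  have hconj : G' = J⁻¹ * G * J := by
    rw [Matrix.mul_assoc, ← hJG, Matrix.nonsing_inv_mul_cancel_left _ _ hJ]
  have hpow : ∀ m, J * G' ^ m = G ^ m * J := by
    intro m
    induction m with
    | zero => simp
    | succ m ih => rw [pow_succ, ← Matrix.mul_assoc, ih, Matrix.mul_assoc, hJG, pow_succ,
        Matrix.mul_assoc _ G]
  have hcoeff : ∀ i, charCoeff G' i = charCoeff G i := by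
    intro i
    have := Matrix.charpoly_units_conj' (Matrix.nonsingInvUnit J hJ) G
    rw [charCoeff_eq, charCoeff_eq, hconj, ← this]
    rfl
  have hdet : (J.transpose * A * J).det / (J.transpose * A' * J).det = A.det / A'.det := by
    simp only [Matrix.det_mul, Matrix.det_transpose]
    rw [mul_right_comm, mul_right_comm _ A'.det,
      mul_div_mul_left _ _ (mul_ne_zero hJ.ne_zero hJ.ne_zero)]
  rw [sMat, sMat, hdet, Matrix.smul_mul, Matrix.mul_smul, Finset.mul_sum, Finset.sum_mul]
  congr 1
  refine Finset.sum_congr rfl fun i _ => ?_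
  rw [← hG', hcoeff, Matrix.mul_smul, hpow, Matrix.smul_mul]

end MatrixGenerating

/-! ### Isometries between coordinate domains -/

section ChangeOfCoordinates

variable {E : Type*} [NormedAddCommGroup E] [NormedSpace ℝ E] [FiniteDimensional ℝ E]
  {U V : Set E} {B B' : E → E →L[ℝ] E →L[ℝ] ℝ} {Γ Γ' : E → E →L[ℝ] E →L[ℝ] E} {ρ ρ' : E → ℝ}
  {φ : E → E}

set_option synthInstance.maxHeartbeats 200000 in
/-- The transformation rule of the Levi-Civita connection under an isometry `φ`. -/
lemma MetricGeometry.map_connection (hG : MetricGeometry U B Γ ρ) (hG' : MetricGeometry V B' Γ' ρ')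
    (hφ : ∀ z ∈ U, ContDiffAt ℝ 2 φ z) (hφV : Set.MapsTo φ U V)
    (hsurj : ∀ z ∈ U, Function.Surjective (fderiv ℝ φ z))
    (hB : ∀ z ∈ U, ∀ x y, B z x y = B' (φ z) (fderiv ℝ φ z x) (fderiv ℝ φ z y))
    {z : E} (hz : z ∈ U) (x y : E) :
    fderiv ℝ φ z (Γ z x y) = fderiv ℝ (fderiv ℝ φ) z x y
      + Γ' (φ z) (fderiv ℝ φ z x) (fderiv ℝ φ z y) := by
  set J := fderiv ℝ φ z with hJ
  set H := fderiv ℝ (fderiv ℝ φ) z with hH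
  have hsymH : ∀ x y, H x y = H y x := fun x y =>
    ((hφ z hz).isSymmSndFDerivAt (by simp)) x y
  have hz' := hφV hz
  have hd : ∀ x y w, B z (Γ z x y) w + B z y (Γ z x w)
      = B' (φ z) (Γ' (φ z) (J x) (J y)) (J w) + B' (φ z) (J y) (Γ' (φ z) (J x) (J w))
        + B' (φ z) (H x y) (J w) + B' (φ z) (J y) (H x w) := by
    intro x y w
    have hB1 := ((hG.contDiffAt_B z hz).differentiableAt (by norm_num)).hasFDerivAt
    have hB2 := ((hG'.contDiffAt_B _ hz').differentiableAt (by norm_num)).hasFDerivAt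
    have hφ1 := ((hφ z hz).differentiableAt (by norm_num)).hasFDerivAt
    have hJ1 := (((hφ z hz).fderiv_right (m := 1) (by norm_num)).differentiableAt
      (by norm_num)).hasFDerivAt
    have h1 := (hB1.clm_apply (hasFDerivAt_const y z)).clm_apply (hasFDerivAt_const w z)
    have hB3 : HasFDerivAt (fun v => B' (φ v)) _ z := hB2.comp z hφ1
    have h2 := (hB3.clm_apply (hJ1.clm_apply (hasFDerivAt_const y z))).clm_apply
      (hJ1.clm_apply (hasFDerivAt_const w z))
    have h3 : (fun v => B v y w) =ᶠ[𝓝 z] fun v =>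
        B' (φ v) (fderiv ℝ φ v y) (fderiv ℝ φ v w) := by
      filter_upwards [hG.isOpen.mem_nhds hz] with v hv using hB v hv y w
    have h4 := DFunLike.congr_fun (h1.unique (h2.congr_of_eventuallyEq h3)) x
    simp only [add_apply, ContinuousLinearMap.comp_apply, zero_apply, map_zero, zero_add,
      ContinuousLinearMap.flip_apply, hG.compat z hz, hG'.compat _ hz'] at h4
    rw [h4]
    ring
  -- The difference of both sides is symmetric in `x` and `y`, skew in `y` and `w`.
  let T : E → E → E → ℝ := fun x y w =>
    B' (φ z) (J (Γ z x y) - H x y - Γ' (φ z) (J x) (J y)) (J w)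
  have hT1 : ∀ x y w, T x y w = T y x w := fun x y w => by
    simp only [T]
    rw [hG.torsion_free z hz x y, hsymH x y, hG'.torsion_free _ hz' (J x)]
  have hT2 : ∀ x y w, T x y w = -T x w y := fun x y w => by
    have h := hd x y w
    rw [hB z hz, hB z hz, ← hJ] at h
    simp only [T, map_sub, sub_apply]
    rw [hG'.symm _ hz' (J (Γ z x w)), hG'.symm _ hz' (H x w), hG'.symm _ hz' (Γ' (φ z) (J x) (J w))]
    linarith
  have hT : ∀ w, T x y w = 0 := fun w => by
    have h1 := hT2 x y w
    have h2 := hT1 x w y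
    have h3 := hT2 w x y
    have h4 := hT1 w y x
    have h5 := hT2 y w x
    have h6 := hT1 y x w
    linarith
  have : J (Γ z x y) - H x y - Γ' (φ z) (J x) (J y) = 0 := by
    refine hG'.nondeg hz' _ fun w => ?_
    obtain ⟨w, rfl⟩ := hsurj z hz w
    exact hT w
  rw [sub_sub, sub_eq_zero] at this
  exact this

lemma MetricGeometry.map_grad (hG : MetricGeometry U B Γ ρ) (hG' : MetricGeometry V B' Γ' ρ')
    (hφ : ∀ z ∈ U, ContDiffAt ℝ 2 φ z) (hφV : Set.MapsTo φ U V)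
    (hsurj : ∀ z ∈ U, Function.Surjective (fderiv ℝ φ z))
    (hB : ∀ z ∈ U, ∀ x y, B z x y = B' (φ z) (fderiv ℝ φ z x) (fderiv ℝ φ z y))
    {f : E → ℝ} {z : E} (hz : z ∈ U) (hf : DifferentiableAt ℝ f (φ z)) :
    fderiv ℝ φ z (grad B (f ∘ φ) z) = grad B' f (φ z) := by
  rw [← sub_eq_zero]
  refine hG'.nondeg (hφV hz) _ fun w => ?_
  obtain ⟨w, rfl⟩ := hsurj z hz w
  rw [map_sub, sub_apply, ← hB z hz, hG.B_grad hz, hG'.B_grad (hφV hz),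
    fderiv_comp z hf ((hφ z hz).differentiableAt (by norm_num))]
  simp

/-- The operator `div (A ∇f)` is invariant under isometries. -/
lemma MetricGeometry.divOp_comp (hG : MetricGeometry U B Γ ρ) (hG' : MetricGeometry V B' Γ' ρ')
    (hφ : ∀ z ∈ U, ContDiffAt ℝ 2 φ z) (hφV : Set.MapsTo φ U V)
    (hbij : ∀ z ∈ U, (fderiv ℝ φ z).IsInvertible)
    (hB : ∀ z ∈ U, ∀ x y, B z x y = B' (φ z) (fderiv ℝ φ z x) (fderiv ℝ φ z y))
    {A A' : E → E →L[ℝ] E} (hA : ∀ z ∈ U, ∀ x, fderiv ℝ φ z (A z x) = A' (φ z) (fderiv ℝ φ z x))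
    {f : E → ℝ} (hf : ∀ z ∈ V, DifferentiableAt ℝ f z) {z : E} (hz : z ∈ U)
    (hX : DifferentiableAt ℝ (fun y => A y (grad B (f ∘ φ) y)) z)
    (hX' : DifferentiableAt ℝ (fun y => A' y (grad B' f y)) (φ z)) :
    divOp B Γ A (f ∘ φ) z = divOp B' Γ' A' f (φ z) := by
  have hsurj : ∀ z ∈ U, Function.Surjective (fderiv ℝ φ z) := fun z hz => by
    obtain ⟨e, he⟩ := hbij z hz
    rw [← he]; exact e.surjective
  have hcon := hG.map_connection hG' hφ hφV hsurj hB hz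
  set X := fun y => A y (grad B (f ∘ φ) y) with hXdef
  set X' := fun y => A' y (grad B' f y) with hXdef'
  have hXX : (fun y => X' (φ y)) =ᶠ[𝓝 z] fun y => fderiv ℝ φ y (X y) := by
    filter_upwards [hG.isOpen.mem_nhds hz] with y hy
    rw [hXdef, hXdef']
    simp only
    rw [hA y hy, hG.map_grad hG' hφ hφV hsurj hB hy (hf _ (hφV hy))]
  have hφ1 := ((hφ z hz).differentiableAt (by norm_num)).hasFDerivAt
  have hJ1 := (((hφ z hz).fderiv_right (m := 1) (by norm_num)).differentiableAt
    (by norm_num)).hasFDerivAt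
  have h1 := hX'.hasFDerivAt.comp z hφ1
  have h2 := hJ1.clm_apply hX.hasFDerivAt
  have h3 := h1.unique (h2.congr_of_eventuallyEq hXX)
  obtain ⟨e, he⟩ := hbij z hz
  have hconj : ∀ S : E →L[ℝ] E, trL S = trL ((e.symm : E →L[ℝ] E) ∘L (S ∘L (e : E →L[ℝ] E))) := by
    intro S
    rw [trL_comm, ContinuousLinearMap.comp_assoc]
    congr 1
    ext x
    simp
  change trL _ + trL _ = trL _ + trL _
  rw [hconj (fderiv ℝ X' (φ z)), hconj (Γ' (φ z) (X' (φ z))), ← map_add, ← map_add]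
  congr 1
  ext x
  have h4 := DFunLike.congr_fun h3 x
  have h5 := hcon (X z) x
  have h6 := hXX.self_of_nhds
  simp only at h6
  have hsym : fderiv ℝ (fderiv ℝ φ) z x (X z) = fderiv ℝ (fderiv ℝ φ) z (X z) x :=
    ((hφ z hz).isSymmSndFDerivAt (by simp)) x (X z)
  simp only [add_apply, ContinuousLinearMap.comp_apply, ContinuousLinearMap.flip_apply, ← he,
    ContinuousLinearEquiv.coe_coe] at h4 h5 h6 ⊢
  change fderiv ℝ X z x + Γ z (X z) x = _
  rw [← map_add, ContinuousLinearEquiv.eq_symm_apply, map_add, h4, h6, h5, hsym]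
  abel

end ChangeOfCoordinates

/-! ### Metrics in charts -/

section Charts

variable {n : ℕ} {M : Type*} [TopologicalSpace M] [ChartedSpace (EuclideanSpace ℝ (Fin n)) M]
  [IsManifold (𝓡 n) ∞ M]

local notation "𝔼" => EuclideanSpace ℝ (Fin n)

/-- The derivative of `e⁻¹`, with the tangent space of `M` read as the model space. -/
def symmDeriv (e : OpenPartialHomeomorph M (EuclideanSpace ℝ (Fin n)))
    (z : EuclideanSpace ℝ (Fin n)) : EuclideanSpace ℝ (Fin n) →L[ℝ] EuclideanSpace ℝ (Fin n) :=
  mfderiv (𝓡 n) (𝓡 n) e.symm z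

/-- The metric at a point, with the tangent space of `M` read as the model space. -/
def innerForm (g : Metric n M) (x : M) :
    EuclideanSpace ℝ (Fin n) →L[ℝ] EuclideanSpace ℝ (Fin n) →L[ℝ] ℝ := g.inner x

lemma bil_gram (g : Metric n M) (e : OpenPartialHomeomorph M (EuclideanSpace ℝ (Fin n)))
    (z x y : EuclideanSpace ℝ (Fin n)) :
    bil (gram g e z) x y = innerForm g (e.symm z) (symmDeriv e z x) (symmDeriv e z y) := by
  have : bil (gram g e z) = (innerForm g (e.symm z)).bilinearComp (symmDeriv e z)
      (symmDeriv e z) := by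
    refine clm_ext_stdVec fun i => clm_ext_stdVec fun j => ?_
    rw [bil_stdVec]
    rfl
  rw [this]
  rfl

lemma contMDiffAt_symm {e : OpenPartialHomeomorph M (EuclideanSpace ℝ (Fin n))}
    (he : e ∈ atlas (EuclideanSpace ℝ (Fin n)) M) {z : EuclideanSpace ℝ (Fin n)}
    (hz : z ∈ e.target) : ContMDiffAt (𝓡 n) (𝓡 n) ∞ e.symm z :=
  (contMDiffOn_symm_of_mem_maximalAtlas (IsManifold.subset_maximalAtlas he)).contMDiffAt
    (e.open_target.mem_nhds hz)

lemma contMDiffAt_chart {e : OpenPartialHomeomorph M (EuclideanSpace ℝ (Fin n))}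
    (he : e ∈ atlas (EuclideanSpace ℝ (Fin n)) M) {x : M}
    (hx : x ∈ e.source) : ContMDiffAt (𝓡 n) (𝓡 n) ∞ e x :=
  (contMDiffOn_of_mem_maximalAtlas (IsManifold.subset_maximalAtlas he)).contMDiffAt
    (e.open_source.mem_nhds hx)

lemma two_le_infty : (2 : WithTop ℕ∞) ≤ ∞ := ENat.LEInfty.out

lemma injective_symmDeriv {e : OpenPartialHomeomorph M (EuclideanSpace ℝ (Fin n))}
    (he : e ∈ atlas (EuclideanSpace ℝ (Fin n)) M) {z : EuclideanSpace ℝ (Fin n)}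
    (hz : z ∈ e.target) : Function.Injective (symmDeriv e z) := by
  have h := (mdifferentiable_of_mem_atlas (I := 𝓡 n) he).symm
  exact h.mfderiv_injective (by simpa using hz)

lemma smoothEntries_gram (g : Metric n M) {e : OpenPartialHomeomorph M (EuclideanSpace ℝ (Fin n))}
    (he : e ∈ atlas (EuclideanSpace ℝ (Fin n)) M) {z : EuclideanSpace ℝ (Fin n)}
    (hz : z ∈ e.target) : SmoothEntries 2 (gram g e) z := by
  have htan : ∀ v : 𝔼, ContMDiffAt (𝓡 n) ((𝓡 n).prod 𝓘(ℝ, 𝔼)) 2 (fun y =>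
      (TotalSpace.mk' 𝔼 (e.symm y) (mfderiv (𝓡 n) (𝓡 n) e.symm y v) :
        TotalSpace 𝔼 (TangentSpace (𝓡 n) : M → Type _))) z := by
    intro v
    have h1 := (contMDiffOn_symm_of_mem_maximalAtlas (I := 𝓡 n) (n := ∞)
      (IsManifold.subset_maximalAtlas he)).contMDiffOn_tangentMapWithin (m := 2)
      (by norm_num; exact ENat.LEInfty.out) e.open_target.uniqueMDiffOn
    have h2 : ContMDiffAt (𝓡 n) ((𝓡 n).prod 𝓘(ℝ, 𝔼)) 2
        (fun y : 𝔼 => (TotalSpace.mk' 𝔼 y v : TangentBundle (𝓡 n) 𝔼)) z :=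
      contMDiffAt_vectorSpace_iff_contDiffAt (V := fun _ => v) |>.2 contDiffAt_const
    have h3 : ContMDiffAt ((𝓡 n).prod 𝓘(ℝ, 𝔼)) ((𝓡 n).prod 𝓘(ℝ, 𝔼)) 2
        (tangentMapWithin (𝓡 n) (𝓡 n) e.symm e.target)
        (TotalSpace.mk' 𝔼 z v : TangentBundle (𝓡 n) 𝔼) :=
      (h1 _ hz).contMDiffAt ((e.open_target.preimage
        (FiberBundle.continuous_proj 𝔼 (TangentSpace (𝓡 n)))).mem_nhds hz)
    have h4 := h3.comp z h2
    refine h4.congr_of_eventuallyEq ?_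
    filter_upwards [e.open_target.mem_nhds hz] with y hy
    simp only [Function.comp, tangentMapWithin]
    rw [mfderivWithin_of_isOpen e.open_target hy]
  intro i j
  have h := ContMDiffAt.clm_bundle_apply₂ (F₁ := 𝔼) (F₂ := 𝔼) (F₃ := ℝ)
    (E₃ := Bundle.Trivial M ℝ) (b := e.symm)
    ((g.contMDiff (e.symm z)).comp z ((contMDiffAt_symm he hz).of_le two_le_infty))
    (htan (stdVec i)) (htan (stdVec j))
  rw [contMDiffAt_totalSpace] at h
  exact h.2.contDiffAt

lemma posDef_gram (g : Metric n M) {e : OpenPartialHomeomorph M (EuclideanSpace ℝ (Fin n))}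
    (he : e ∈ atlas (EuclideanSpace ℝ (Fin n)) M) {z : EuclideanSpace ℝ (Fin n)}
    (hz : z ∈ e.target) : (gram g e z).PosDef := by
  rw [Matrix.posDef_iff_dotProduct_mulVec]
  refine ⟨?_, fun x hx => ?_⟩
  · ext i j
    exact g.symm _ _ _
  · have h := bil_gram g e z (WithLp.toLp 2 x) (WithLp.toLp 2 x)
    rw [bil_apply] at h
    simp only [star_trivial]
    refine lt_of_lt_of_eq ?_ h.symm
    refine g.pos _ _ fun h0 => hx ?_
    have := injective_symmDeriv he hz (a₁ := WithLp.toLp 2 x) (a₂ := 0) (by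
      rw [map_zero]; exact h0)
    simpa using this

/-- The Levi-Civita geometry of `g` in the chart `e`. -/
lemma metricGeometry_gram (g : Metric n M)
    {e : OpenPartialHomeomorph M (EuclideanSpace ℝ (Fin n))}
    (he : e ∈ atlas (EuclideanSpace ℝ (Fin n)) M) :
    MetricGeometry e.target (fun z => bil (gram g e z)) (conn (gram g e))
      (fun z => √(gram g e z).det) :=
  metricGeometry_of_matrix e.open_target (fun _ hz => smoothEntries_gram g he hz)
    fun _ hz => posDef_gram g he hz

section Transition

variable {e e' : OpenPartialHomeomorph M (EuclideanSpace ℝ (Fin n))}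
  (he : e ∈ atlas (EuclideanSpace ℝ (Fin n)) M) (he' : e' ∈ atlas (EuclideanSpace ℝ (Fin n)) M)

/-- The coordinates of the points that belong to both charts. -/
def overlap (e e' : OpenPartialHomeomorph M (EuclideanSpace ℝ (Fin n))) :
    Set (EuclideanSpace ℝ (Fin n)) := e.target ∩ e.symm ⁻¹' e'.source

lemma isOpen_overlap : IsOpen (overlap e e') := e.isOpen_inter_preimage_symm e'.open_source

lemma mapsTo_overlap : Set.MapsTo (e' ∘ e.symm) (overlap e e') e'.target :=
  fun _ hz => e'.map_source hz.2

lemma symm_transition {z : EuclideanSpace ℝ (Fin n)} (hz : z ∈ overlap e e') :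
    e'.symm ((e' ∘ e.symm) z) = e.symm z := e'.left_inv hz.2

include he he' in
lemma contDiffAt_transition {z : EuclideanSpace ℝ (Fin n)} (hz : z ∈ overlap e e') :
    ContDiffAt ℝ ∞ (e' ∘ e.symm) z :=
  ((contMDiffAt_chart he' hz.2).comp z (contMDiffAt_symm he hz.1)).contDiffAt

include he he' in
lemma symmDeriv_eq {z : EuclideanSpace ℝ (Fin n)} (hz : z ∈ overlap e e') :
    symmDeriv e z = symmDeriv e' ((e' ∘ e.symm) z) ∘L fderiv ℝ (e' ∘ e.symm) z := by
  have h1 : e.symm =ᶠ[𝓝 z] e'.symm ∘ (e' ∘ e.symm) := by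
    filter_upwards [isOpen_overlap.mem_nhds hz] with y hy using (symm_transition hy).symm
  have h2 : MDifferentiableAt (𝓡 n) (𝓡 n) (e' ∘ e.symm) z :=
    ((contDiffAt_transition he he' hz).differentiableAt (by simp)).mdifferentiableAt
  have h3 : MDifferentiableAt (𝓡 n) (𝓡 n) e'.symm ((e' ∘ e.symm) z) :=
    (contMDiffAt_symm he' (mapsTo_overlap hz)).mdifferentiableAt (by simp)
  have h4 := (mfderiv_comp z h3 h2)
  have h5 := h1.mfderiv_eq (I := 𝓡 n) (I' := 𝓡 n)
  rw [symmDeriv, h5, h4, mfderiv_eq_fderiv]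
  rfl

include he he' in
lemma isInvertible_transition {z : EuclideanSpace ℝ (Fin n)} (hz : z ∈ overlap e e') :
    (fderiv ℝ (e' ∘ e.symm) z).IsInvertible := by
  have h1 := injective_symmDeriv he hz.1
  rw [symmDeriv_eq he he' hz] at h1
  have h2 : Function.Injective (fderiv ℝ (e' ∘ e.symm) z : 𝔼 →ₗ[ℝ] 𝔼) := fun x y hxy => h1 (by
    simp only [ContinuousLinearMap.comp_apply]
    exact congrArg _ hxy)
  exact ⟨(LinearEquiv.ofInjectiveEndo _ h2).toContinuousLinearEquiv, by ext x; rfl⟩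

include he he' in
lemma bil_gram_transition (g : Metric n M) {z : EuclideanSpace ℝ (Fin n)} (hz : z ∈ overlap e e')
    (x y : EuclideanSpace ℝ (Fin n)) :
    bil (gram g e z) x y = bil (gram g e' ((e' ∘ e.symm) z)) (fderiv ℝ (e' ∘ e.symm) z x)
      (fderiv ℝ (e' ∘ e.symm) z y) := by
  rw [bil_gram, bil_gram, symm_transition hz, symmDeriv_eq he he' hz]
  rfl

/-- The Jacobian matrix of the transition map. -/
def jac (e e' : OpenPartialHomeomorph M (EuclideanSpace ℝ (Fin n)))
    (z : EuclideanSpace ℝ (Fin n)) : Matrix (Fin n) (Fin n) ℝ :=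
  (Matrix.toEuclideanCLM (n := Fin n) (𝕜 := ℝ)).symm (fderiv ℝ (e' ∘ e.symm) z)

lemma endo_jac (z : EuclideanSpace ℝ (Fin n)) :
    endo (jac e e' z) = fderiv ℝ (e' ∘ e.symm) z :=
  StarAlgEquiv.apply_symm_apply _ _

include he he' in
lemma gram_transition (g : Metric n M) {z : EuclideanSpace ℝ (Fin n)} (hz : z ∈ overlap e e') :
    gram g e z = (jac e e' z).transpose * gram g e' ((e' ∘ e.symm) z) * jac e e' z := by
  ext i j
  have h := bil_gram_transition he he' g hz (stdVec i) (stdVec j)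
  rw [bil_stdVec, ← endo_jac, bil_endo, bil_apply] at h
  rw [h, Matrix.mul_assoc, Matrix.mul_apply, dotProduct]
  refine Finset.sum_congr rfl fun k _ => ?_
  rw [endo_stdVec, Matrix.transpose_apply]
  congr 1
  simp [stdVec]

include he he' in
lemma isUnit_det_jac {z : EuclideanSpace ℝ (Fin n)} (hz : z ∈ overlap e e') :
    IsUnit (jac e e' z).det := by
  obtain ⟨f, hf⟩ := isInvertible_transition he he' hz
  rw [← det_endo, endo_jac, ← hf]
  exact f.toLinearEquiv.isUnit_det'

end Transition

end Charts

/-! ### Coordinate expressions of the operators -/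

section LocalOperators

variable {n : ℕ} {U : Set (EuclideanSpace ℝ (Fin n))} {z : EuclideanSpace ℝ (Fin n)}
  {γ γ' σ : EuclideanSpace ℝ (Fin n) → Matrix (Fin n) (Fin n) ℝ}
  {u : EuclideanSpace ℝ (Fin n) → ℝ}

local notation "𝔼" => EuclideanSpace ℝ (Fin n)

lemma grad_bil_apply (hG : MetricGeometry U (fun z => bil (γ z)) (conn γ) (fun z => √(γ z).det))
    (hz : z ∈ U) (h0 : (γ z).det ≠ 0) (i : Fin n) :
    grad (fun z => bil (γ z)) u z i = ∑ j, (γ z)⁻¹ i j * pd j u z := by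
  set v : 𝔼 := grad (fun z => bil (γ z)) u z with hv
  have h1 : ∀ j, (γ z).mulVec v j = pd j u z := fun j => by
    have h := hG.B_grad hz u (stdVec j)
    rw [hG.symm z hz, bil_apply, ← hv] at h
    rw [pd, ← h]
    simp [stdVec]
  have h2 := congrFun (congrArg (fun A => A.mulVec v)
    (Matrix.nonsing_inv_mul (γ z) (isUnit_iff_ne_zero.2 h0))) i
  simp only [← Matrix.mulVec_mulVec, Matrix.one_mulVec] at h2
  rw [← h2]
  change ∑ j, (γ z)⁻¹ i j * (γ z).mulVec v j = _
  simp only [h1]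

/-- The coordinate expression `ρ⁻¹ ∂_i (σ^i_a ρ γ^{aj} ∂_j u)` is the divergence of `σ ∇u`. -/
lemma sum_pd_eq_divOp
    (hG : MetricGeometry U (fun z => bil (γ z)) (conn γ) (fun z => √(γ z).det))
    (h0 : ∀ z ∈ U, (γ z).det ≠ 0) (hz : z ∈ U) (hσ : SmoothEntries 1 σ z)
    (hu : ContDiffAt ℝ 2 u z) :
    (1 / √(γ z).det) * ∑ i : Fin n, pd i (fun y => ∑ a : Fin n, ∑ j : Fin n,
      σ y i a * √(γ y).det * (γ y)⁻¹ a j * pd j u y) z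
      = divOp (fun z => bil (γ z)) (conn γ) (fun z => endo (σ z)) u z := by
  set X : 𝔼 → 𝔼 := fun y => endo (σ y) (grad (fun z => bil (γ z)) u y) with hX
  have hXd : DifferentiableAt ℝ X z :=
    (hG.contDiffAt_divOp_field hz hσ.contDiffAt_endo hu).differentiableAt (by norm_num)
  have hρd := (hG.contDiffAt_ρ z hz).differentiableAt (by norm_num)
  have hXi : ∀ i, HasFDerivAt (fun y => X y i) (crd i ∘L fderiv ℝ X z) z := fun i =>
    (crd i).hasFDerivAt.comp z hXd.hasFDerivAt
  have h1 : ∀ i, pd i (fun y => ∑ a : Fin n, ∑ j : Fin n,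
      σ y i a * √(γ y).det * (γ y)⁻¹ a j * pd j u y) z
      = √(γ z).det * fderiv ℝ X z (stdVec i) i
        + X z i * fderiv ℝ (fun y => √(γ y).det) z (stdVec i) := by
    intro i
    have hev : (fun y => ∑ a : Fin n, ∑ j : Fin n,
        σ y i a * √(γ y).det * (γ y)⁻¹ a j * pd j u y) =ᶠ[𝓝 z] fun y => √(γ y).det * X y i := by
      filter_upwards [hG.isOpen.mem_nhds hz] with y hy
      change _ = √(γ y).det * (∑ a, σ y i a * grad (fun z => bil (γ z)) u y a)
      rw [Finset.mul_sum]
      refine Finset.sum_congr rfl fun a _ => ?_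
      rw [grad_bil_apply hG hy (h0 y hy), Finset.mul_sum, Finset.mul_sum]
      exact Finset.sum_congr rfl fun j _ => by ring
    have h2 := hρd.hasFDerivAt.fun_mul (hXi i)
    rw [pd, hev.fderiv_eq, h2.fderiv]
    simp
  have h2 : ∑ i, X z i * fderiv ℝ (fun y => √(γ y).det) z (stdVec i)
      = √(γ z).det * trL (conn γ z (X z)) := by
    rw [← hG.fderiv_ρ z hz, clm_apply_eq_sum _ (X z)]
    simp
  rw [Finset.sum_congr rfl fun i _ => h1 i, Finset.sum_add_distrib, h2, ← Finset.mul_sum,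
    ← trL_eq_sum, ← mul_add, ← mul_assoc, one_div_mul_cancel (hG.pos_ρ z hz).ne', one_mul]
  rfl

lemma contDiffAt_coeff_prod {m : WithTop ℕ∞} {ι : Type*} (s : Finset ι) {p : ι → 𝔼 → ℝ[X]}
    (hp : ∀ i ∈ s, ∀ k, ContDiffAt ℝ m (fun y => (p i y).coeff k) z) (k : ℕ) :
    ContDiffAt ℝ m (fun y => (∏ i ∈ s, p i y).coeff k) z := by
  classical
  induction s using Finset.induction_on generalizing k with
  | empty => simp only [Finset.prod_empty]; exact contDiffAt_const
  | insert a s ha ih =>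
    simp only [Finset.prod_insert ha, coeff_mul]
    exact ContDiffAt.sum fun q _ => (hp a (Finset.mem_insert_self a s) _).mul
      (ih (fun i hi => hp i (Finset.mem_insert_of_mem hi)) _)

lemma SmoothEntries.contDiffAt_charCoeff {m : WithTop ℕ∞} (hσ : SmoothEntries m σ z) (i : ℕ) :
    ContDiffAt ℝ m (fun y => charCoeff (σ y) i) z := by
  simp only [charCoeff, Matrix.det_apply, finsetSum_coeff, coeff_smul]
  refine ContDiffAt.sum fun τ _ => ContDiffAt.const_smul _ (contDiffAt_coeff_prod _ ?_ _)
  intro a _ k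
  simp only [Matrix.sub_apply, Matrix.map_apply, Matrix.smul_apply, coeff_sub, coeff_C]
  refine ContDiffAt.sub ?_ contDiffAt_const
  split_ifs
  · exact hσ _ _
  · exact contDiffAt_const

lemma SmoothEntries.sum {m : WithTop ℕ∞} {ι : Type*} {s : Finset ι}
    {A : ι → 𝔼 → Matrix (Fin n) (Fin n) ℝ} (hA : ∀ i ∈ s, SmoothEntries m (A i) z) :
    SmoothEntries m (fun y => ∑ i ∈ s, A i y) z := by
  intro a b
  simp only [Matrix.sum_apply]
  exact ContDiffAt.sum fun i hi => hA i hi a b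

section Pair

variable (hγ : SmoothEntries 2 γ z) (hγ' : SmoothEntries 2 γ' z) (hp : (γ z).PosDef)
  (hp' : (γ' z).PosDef)
include hγ hγ' hp hp'

lemma smoothEntries_sMat (k : ℕ) : SmoothEntries 2 (fun y => sMat (γ y) (γ' y) k) z := by
  have hG := (hγ.inv hp.det_pos.ne').mul hγ'
  refine SmoothEntries.smul ?_ (SmoothEntries.sum fun i _ =>
    SmoothEntries.smul (hG.contDiffAt_charCoeff i) (hG.pow _))
  exact (hγ.det.div hγ'.det hp'.det_pos.ne').rpow_const_of_ne
    (div_pos hp.det_pos hp'.det_pos).ne'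

lemma contDiffAt_dMat : ContDiffAt ℝ 2 (fun y => dMat (γ y) (γ' y)) z :=
  (hγ'.det.div hγ.det hp.det_pos.ne').rpow_const_of_ne
    (div_pos hp'.det_pos hp.det_pos).ne'

lemma smoothEntries_lMat : SmoothEntries 2 (fun y => lMat (γ y) (γ' y)) z :=
  SmoothEntries.smul (contDiffAt_dMat hγ hγ' hp hp') ((hγ'.inv hp'.det_pos.ne').mul hγ)

end Pair

/-- Two matrix fields of metrics whose connections differ by `ψ ⊗ id + id ⊗ ψ` make up a
geometry with a Benenti tensor. -/
lemma exists_bmGeometry (hU : IsOpen U)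
    (hγ : ∀ z ∈ U, SmoothEntries 2 γ z) (hγ' : ∀ z ∈ U, SmoothEntries 2 γ' z)
    (hp : ∀ z ∈ U, (γ z).PosDef) (hp' : ∀ z ∈ U, (γ' z).PosDef)
    {ψ : 𝔼 → 𝔼 →L[ℝ] ℝ}
    (hψ : ∀ z ∈ U, ∀ x y, conn γ' z x y = conn γ z x y + ψ z x • y + ψ z y • x) :
    ∃ l, BMGeometry U (fun z => bil (γ z)) (conn γ) (fun z => √(γ z).det)
      (fun z => endo (lMat (γ z) (γ' z))) l := by
  have hG := metricGeometry_of_matrix hU hγ hp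
  have hG' := metricGeometry_of_matrix hU hγ' hp'
  have hψtr : ∀ z ∈ U, ∀ x, ψ z x = (1 / ((n : ℝ) + 1)) *
      (trL (conn γ' z x) - trL (conn γ z x)) := by
    intro z hz x
    have h : conn γ' z x = conn γ z x + ψ z x • ContinuousLinearMap.id ℝ 𝔼
        + (ψ z).smulRight x := by
      ext1 y
      simp [hψ z hz]
    have hid : trL (ContinuousLinearMap.id ℝ 𝔼) = n := by
      rw [trL_eq_sum]
      simp [stdVec_apply]
    rw [h, map_add, map_add, map_smul, hid, trL_smulRight, smul_eq_mul]
    have : (n : ℝ) + 1 ≠ 0 := by positivity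
    field_simp
    ring
  have hψc : ∀ z ∈ U, ContDiffAt ℝ 1 ψ z := by
    intro z hz
    have h1 : ContDiffAt ℝ 1 (fun y => (1 / ((n : ℝ) + 1)) •
        ((trL (E := 𝔼)) ∘L (conn γ' y - conn γ y))) z :=
      ContDiffAt.const_smul _ (contDiffAt_const.clm_comp
        ((hG'.contDiffAt_Γ z hz).sub (hG.contDiffAt_Γ z hz)))
    refine h1.congr_of_eventuallyEq ?_
    filter_upwards [hU.mem_nhds hz] with y hy
    ext1 x
    rw [hψtr y hy]
    simp
  let D : 𝔼 → ℝ := fun z => dMat (γ z) (γ' z)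
  have hDc : ∀ z ∈ U, ContDiffAt ℝ 2 D z := fun z hz =>
    contDiffAt_dMat (hγ z hz) (hγ' z hz) (hp z hz) (hp' z hz)
  have hDpos : ∀ z ∈ U, 0 < D z := fun z hz => dMat_pos (hp z hz) (hp' z hz)
  have hD' : ∀ z ∈ U, ∀ x, fderiv ℝ D z x = 2 * D z * ψ z x := by
    intro z hz x
    -- Differentiate `D ^ (n + 1) ρ ^ 2 = ρ' ^ 2`.
    have hrel : ∀ y ∈ U, D y ^ (n + 1) * √(γ y).det ^ 2 = √(γ' y).det ^ 2 := by
      intro y hy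
      have h1 := (hp y hy).det_pos
      rw [Real.sq_sqrt h1.le, Real.sq_sqrt (hp' y hy).det_pos.le, dMat_pow (hp y hy) (hp' y hy),
        Matrix.det_mul, Matrix.det_nonsing_inv, Ring.inverse_eq_inv']
      field_simp
    have hDd := ((hDc z hz).differentiableAt (by norm_num)).hasFDerivAt
    have hρd := ((hG.contDiffAt_ρ z hz).differentiableAt (by norm_num)).hasFDerivAt
    have hρd' := ((hG'.contDiffAt_ρ z hz).differentiableAt (by norm_num)).hasFDerivAt
    have h1 := (hDd.pow (n + 1)).fun_mul (hρd.pow 2)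
    have h2 := hρd'.pow 2
    have hev : (fun y => D y ^ (n + 1) * √(γ y).det ^ 2) =ᶠ[𝓝 z] fun y => √(γ' y).det ^ 2 := by
      filter_upwards [hU.mem_nhds hz] with y hy using hrel y hy
    have h3 := DFunLike.congr_fun (h1.unique (h2.congr_of_eventuallyEq hev)) x
    simp only [add_apply, smul_apply, smul_eq_mul, hG.fderiv_ρ z hz, hG'.fderiv_ρ z hz,
      nsmul_eq_mul, Nat.add_sub_cancel] at h3
    have hr := hrel z hz
    have hDz := hDpos z hz
    have hρ0 := hG.pos_ρ z hz
    rw [hψtr z hz]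
    have hn : (n : ℝ) + 1 ≠ 0 := by positivity
    have hne : D z ^ n * √(γ z).det ^ 2 ≠ 0 := by positivity
    refine mul_left_cancel₀ (mul_ne_zero hn hne) ?_
    push_cast at h3
    linear_combination h3 - 2 * trL (conn γ' z x) * hr
      - 2 * (D z ^ n * √(γ z).det ^ 2) * D z * (trL (conn γ' z x) - trL (conn γ z x))
        * mul_one_div_cancel hn
  let l : 𝔼 → 𝔼 := fun z => ContinuousLinearMap.inverse (bil (γ' z)) (-(D z • ψ z))
  refine ⟨l, hG.bmGeometry hG' hψ (fun z hz => (hDc z hz).differentiableAt (by norm_num))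
    (fun z hz => (hDpos z hz).ne') hD' (fun z hz =>
      (smoothEntries_lMat (hγ z hz) (hγ' z hz) (hp z hz) (hp' z hz)).contDiffAt_endo) ?_ ?_ ?_⟩
  · intro z hz
    obtain ⟨e, he⟩ := hG'.isInvertible hz
    have h1 : ContDiffAt ℝ 1 ContinuousLinearMap.inverse (bil (γ' z)) := by
      rw [← he]; exact contDiffAt_map_inverse e
    exact (h1.comp z ((hG'.contDiffAt_B z hz).of_le (by norm_num))).clm_apply
      ((((hDc z hz).of_le (by norm_num)).smul (hψc z hz)).neg)
  · intro z hz x y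
    have uA' : IsUnit (γ' z).det := isUnit_iff_ne_zero.2 (hp' z hz).det_pos.ne'
    rw [hG'.symm z hz, bil_endo, lMat, Matrix.mul_smul, ← Matrix.mul_assoc,
      Matrix.mul_nonsing_inv _ uA', Matrix.one_mul, hG.symm z hz]
    simp [bil_apply, Matrix.smul_mulVec, D]
  · intro z hz y
    obtain ⟨e, he⟩ := hG'.isInvertible hz
    simp only [l]
    rw [← he, ContinuousLinearMap.inverse_equiv]
    simp

end LocalOperators

/-! ### Commutation on the manifold -/

section LocalOperators

variable {n : ℕ} {z : EuclideanSpace ℝ (Fin n)}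

local notation "𝔼" => EuclideanSpace ℝ (Fin n)

lemma bil_endo_symm {A S : Matrix (Fin n) (Fin n) ℝ}
    (hS : S.transpose * A = A * S) (x y : EuclideanSpace ℝ (Fin n)) :
    bil A (endo S x) y = bil A x (endo S y) := by
  rw [bil_endo, ← hS, bil_apply, bil_apply, ← Matrix.mulVec_mulVec,
    Matrix.dotProduct_mulVec _ S.transpose,
    Matrix.vecMul_transpose]
  rfl

lemma isUnit_sub_lMat {A A' : Matrix (Fin n) (Fin n) ℝ} (hA : A.PosDef) (hA' : A'.PosDef) {t : ℝ}
    (ht : t < 0) : IsUnit (t • (1 : 𝔼 →L[ℝ] 𝔼) - endo (lMat A A')) := by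
  have hu : IsUnit (t • 1 - lMat A A') :=
    (Matrix.isUnit_iff_isUnit_det _).2 (isUnit_iff_ne_zero.2 (det_lMat_ne_zero hA hA' ht))
  have h := hu.map (Matrix.toEuclideanCLM (n := Fin n) (𝕜 := ℝ))
  have e : Matrix.toEuclideanCLM (n := Fin n) (𝕜 := ℝ) (t • 1 - lMat A A')
      = t • (1 : 𝔼 →L[ℝ] 𝔼) - endo (lMat A A') := by
    change endo _ = _
    rw [endo_sub, endo_smul, endo_one]
  rwa [e] at h

/-- The generating function of the `S_k` is `-det (t - L) (t - L)⁻¹`. -/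
lemma sum_endo_sMat {γ γ' : EuclideanSpace ℝ (Fin n) → Matrix (Fin n) (Fin n) ℝ}
    (hp : (γ z).PosDef) (hp' : (γ' z).PosDef) {t : ℝ} (ht : t < 0) :
    ∑ k : Fin n, t ^ (k : ℕ) • endo (sMat (γ z) (γ' z) k)
      = -(resDet (fun z => endo (lMat (γ z) (γ' z))) t z •
        resolv (fun z => endo (lMat (γ z) (γ' z))) t z) := by
  have hu := isUnit_sub_lMat hp hp' ht
  have e : endo (t • 1 - lMat (γ z) (γ' z)) = t • (1 : 𝔼 →L[ℝ] 𝔼) - endo (lMat (γ z) (γ' z)) := by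
    rw [endo_sub, endo_smul, endo_one]
  have hsmul : ∀ (c : ℝ) (T : 𝔼 →L[ℝ] 𝔼), -c • (1 : 𝔼 →L[ℝ] 𝔼) * T = -(c • T) := fun c T => by
    ext1 x
    exact neg_smul c (T x)
  have h := congrArg endo (sum_sMat_mul hp hp' ht.ne)
  rw [endo_mul, endo_sum, e, ← neg_smul, endo_smul, endo_one, ← det_endo, e,
    ← Fin.sum_univ_eq_sum_range (fun k => endo (t ^ k • sMat (γ z) (γ' z) k))] at h
  simp only [endo_smul] at h
  have h2 := congrArg (fun T => T * Ring.inverse (t • (1 : 𝔼 →L[ℝ] 𝔼) - endo (lMat (γ z) (γ' z)))) h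
  change (_ : 𝔼 →L[ℝ] 𝔼) * (_ : 𝔼 →L[ℝ] 𝔼) * (_ : 𝔼 →L[ℝ] 𝔼) = _ at h2
  rw [mul_assoc, Ring.mul_inverse_cancel _ hu, mul_one] at h2
  rw [h2]
  exact hsmul _ _

lemma divOp_congr {E : Type*} [NormedAddCommGroup E] [NormedSpace ℝ E] [FiniteDimensional ℝ E]
    (B : E → E →L[ℝ] E →L[ℝ] ℝ) (Γ : E → E →L[ℝ] E →L[ℝ] E)
    (A : E → E →L[ℝ] E) {u v : E → ℝ} {z : E} (h : u =ᶠ[𝓝 z] v) :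
    divOp B Γ A u z = divOp B Γ A v z := by
  have h1 : (fun y => A y (grad B u y)) =ᶠ[𝓝 z] fun y => A y (grad B v y) := by
    filter_upwards [h.fderiv (𝕜 := ℝ)] with y hy
    rw [grad, grad, hy]
  have h2 : A z (grad B u z) = A z (grad B v z) := h1.self_of_nhds
  rw [divOp, divOp, divC, divC, h1.fderiv_eq, h2]

lemma MetricGeometry.mono {E : Type*} [NormedAddCommGroup E] [NormedSpace ℝ E]
    [FiniteDimensional ℝ E] {U V : Set E} {B : E → E →L[ℝ] E →L[ℝ] ℝ}
    {Γ : E → E →L[ℝ] E →L[ℝ] E} {ρ : E → ℝ} (hG : MetricGeometry V B Γ ρ) (hU : IsOpen U)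
    (hUV : U ⊆ V) : MetricGeometry U B Γ ρ :=
  ⟨hU, fun z hz => hG.contDiffAt_B z (hUV hz), fun z hz => hG.symm z (hUV hz),
    fun z hz => hG.pos z (hUV hz), fun z hz => hG.contDiffAt_Γ z (hUV hz),
    fun z hz => hG.torsion_free z (hUV hz), fun z hz => hG.compat z (hUV hz),
    fun z hz => hG.contDiffAt_ρ z (hUV hz), fun z hz => hG.pos_ρ z (hUV hz),
    fun z hz => hG.fderiv_ρ z (hUV hz)⟩

end LocalOperators

section Charts

variable {n : ℕ} {M : Type*} [TopologicalSpace M] [ChartedSpace (EuclideanSpace ℝ (Fin n)) M]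
  [IsManifold (𝓡 n) ∞ M] (g g' : Metric n M) (k : ℕ)
  {e e' : OpenPartialHomeomorph M (EuclideanSpace ℝ (Fin n))}
  (he : e ∈ atlas (EuclideanSpace ℝ (Fin n)) M) (he' : e' ∈ atlas (EuclideanSpace ℝ (Fin n)) M)
  {u : EuclideanSpace ℝ (Fin n) → ℝ} {z : EuclideanSpace ℝ (Fin n)} {f : M → ℝ}

local notation "𝔼" => EuclideanSpace ℝ (Fin n)

/-- The operator `u ↦ div (S_k ∇u)` in the chart `e`. -/
def chartOp (e : OpenPartialHomeomorph M (EuclideanSpace ℝ (Fin n)))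
    (u : EuclideanSpace ℝ (Fin n) → ℝ) : EuclideanSpace ℝ (Fin n) → ℝ :=
  divOp (fun z => bil (gram g e z)) (conn (gram g e)) (fun y => endo (matS g g' k e y)) u

include he in
lemma smoothEntries_matS (hz : z ∈ e.target) : SmoothEntries 2 (matS g g' k e) z :=
  smoothEntries_sMat (smoothEntries_gram g he hz) (smoothEntries_gram g' he hz)
    (posDef_gram g he hz) (posDef_gram g' he hz) k

include he in
lemma contDiffAt_endo_matS (hz : z ∈ e.target) :
    ContDiffAt ℝ 1 (fun y => endo (matS g g' k e y)) z :=
  (smoothEntries_matS g g' k he hz).contDiffAt_endo.of_le (by norm_num)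

include he in
lemma symm_endo_matS (hz : z ∈ e.target) (x y : EuclideanSpace ℝ (Fin n)) :
    bil (gram g e z) (endo (matS g g' k e z) x) y = bil (gram g e z) x (endo (matS g g' k e z) y) :=
  bil_endo_symm
    (transpose_sMat_mul (posDef_gram g he hz) (posDef_gram g' he hz).isHermitian k) x y

include he in
lemma localI_eq_chartOp (hz : z ∈ e.target) (hu : ContDiffAt ℝ 2 u z) :
    localI g g' k e u z = chartOp g g' k e u z :=
  sum_pd_eq_divOp (metricGeometry_gram g he) (fun _ hz => (posDef_gram g he hz).det_pos.ne') hz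
    (fun i j => (smoothEntries_matS g g' k he hz i j).of_le (by norm_num)) hu

include he in
lemma IsC2.contDiffAt (hf : IsC2 n f) (hz : z ∈ e.target) : ContDiffAt ℝ 2 (f ∘ e.symm) z :=
  ((hf _).comp z ((contMDiffAt_symm he hz).of_le two_le_infty)).contDiffAt

include he he' in
lemma chartOp_transition (hz : z ∈ overlap e e') (hu : ∀ z ∈ e'.target, ContDiffAt ℝ 2 u z) :
    chartOp g g' k e (u ∘ (e' ∘ e.symm)) z = chartOp g g' k e' u ((e' ∘ e.symm) z) := by
  have hG := (metricGeometry_gram g he).mono (isOpen_overlap (e := e) (e' := e'))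
    Set.inter_subset_left
  have hφ2 : ∀ z ∈ overlap e e', ContDiffAt ℝ 2 (e' ∘ e.symm) z := fun z hz =>
    (contDiffAt_transition he he' hz).of_le two_le_infty
  refine hG.divOp_comp (metricGeometry_gram g he') hφ2 mapsTo_overlap
    (fun z hz => isInvertible_transition he he' hz)
    (fun z hz => bil_gram_transition he he' g hz) ?_
    (fun z hz => (hu z hz).differentiableAt (by norm_num)) hz ?_ ?_
  · intro z hz x
    have h := sMat_conj (isUnit_det_jac he he' hz) (gram g e' ((e' ∘ e.symm) z))
      (gram g' e' ((e' ∘ e.symm) z)) k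
    rw [← gram_transition he he' g hz, ← gram_transition he he' g' hz] at h
    have h2 := DFunLike.congr_fun (congrArg endo h) x
    rw [endo_mul, endo_mul, endo_jac] at h2
    exact h2
  · exact (hG.contDiffAt_divOp_field hz (contDiffAt_endo_matS g g' k he hz.1)
      ((hu _ (mapsTo_overlap hz)).comp z (hφ2 z hz))).differentiableAt (by norm_num)
  · exact ((metricGeometry_gram g he').contDiffAt_divOp_field (mapsTo_overlap hz)
      (contDiffAt_endo_matS g g' k he' (mapsTo_overlap hz))
      (hu _ (mapsTo_overlap hz))).differentiableAt (by norm_num)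

include he in
/-- The operator `𝓘_k` is computed by its coordinate expression in every chart. -/
lemma opI_symm (hf : IsC2 n f) (hz : z ∈ e.target) :
    opI g g' k f (e.symm z) = chartOp g g' k e (f ∘ e.symm) z := by
  set e₀ := chartAt (EuclideanSpace ℝ (Fin n)) (e.symm z) with he₀
  have hat : e₀ ∈ atlas (EuclideanSpace ℝ (Fin n)) M := chart_mem_atlas _ _
  have hov : z ∈ overlap e e₀ := ⟨hz, mem_chart_source _ _⟩
  have h1 : opI g g' k f (e.symm z) = chartOp g g' k e₀ (f ∘ e₀.symm) ((e₀ ∘ e.symm) z) :=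
    localI_eq_chartOp g g' k hat (mapsTo_overlap hov) (IsC2.contDiffAt hat hf (mapsTo_overlap hov))
  rw [h1, ← chartOp_transition g g' k he hat hov fun z hz => IsC2.contDiffAt hat hf hz]
  refine divOp_congr _ _ _ ?_
  filter_upwards [isOpen_overlap.mem_nhds hov] with y hy
  exact congrArg f (symm_transition hy)

include he in
lemma opI_apply (hf : IsC2 n f) {x : M} (hx : x ∈ e.source) :
    opI g g' k f x = chartOp g g' k e (f ∘ e.symm) (e x) := by
  rw [← opI_symm g g' k he hf (e.map_source hx), e.left_inv hx]

/-- Commutation in a domain where the two metrics are projectively related. -/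
lemma operatorsCommute_opI (k m : Fin n)
    (hproj : ∀ e ∈ atlas (EuclideanSpace ℝ (Fin n)) M, ∃ ψ : 𝔼 → 𝔼 →L[ℝ] ℝ,
      ∀ z ∈ e.target, ∀ x y,
        conn (gram g' e) z x y = conn (gram g e) z x y + ψ z x • y + ψ z y • x) :
    OperatorsCommute n (opI g g' k) (opI g g' m) := by
  intro f hf hkf hmf
  funext x
  set e := chartAt (EuclideanSpace ℝ (Fin n)) x
  have he : e ∈ atlas (EuclideanSpace ℝ (Fin n)) M := chart_mem_atlas _ _
  have hx : x ∈ e.source := mem_chart_source _ _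
  obtain ⟨ψ, hψ⟩ := hproj e he
  obtain ⟨l, hBM⟩ := exists_bmGeometry e.open_target (fun _ hz => smoothEntries_gram g he hz)
    (fun _ hz => smoothEntries_gram g' he hz) (fun _ hz => posDef_gram g he hz)
    (fun _ hz => posDef_gram g' he hz) hψ
  have hop : ∀ j : ℕ, ∀ z ∈ e.target,
      (opI g g' j f ∘ e.symm) z = chartOp g g' j e (f ∘ e.symm) z := fun j z hz =>
    opI_symm g g' j he hf hz
  have hev : ∀ j : ℕ, ∀ z ∈ e.target,
      (opI g g' j f ∘ e.symm) =ᶠ[𝓝 z] chartOp g g' j e (f ∘ e.symm) := fun j z hz => by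
    filter_upwards [e.open_target.mem_nhds hz] with y hy using hop j y hy
  have hz := e.map_source hx
  rw [opI_apply g g' k he hmf hx, opI_apply g g' m he hkf hx]
  have h1 : chartOp g g' k e (opI g g' m f ∘ e.symm) (e x)
      = chartOp g g' k e (chartOp g g' m e (f ∘ e.symm)) (e x) := divOp_congr _ _ _ (hev m _ hz)
  have h2 : chartOp g g' m e (opI g g' k f ∘ e.symm) (e x)
      = chartOp g g' m e (chartOp g g' k e (f ∘ e.symm)) (e x) := divOp_congr _ _ _ (hev k _ hz)
  rw [h1, h2]
  exact hBM.divOp_comm (volume : Measure 𝔼)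
    (fun t ht z hz => isUnit_sub_lMat (posDef_gram g he hz) (posDef_gram g' he hz) ht)
    (S := fun j : Fin n => fun z => endo (matS g g' j e z))
    (fun j z hz => contDiffAt_endo_matS g g' j he hz)
    (fun j z hz => symm_endo_matS g g' j he hz)
    (fun t ht z hz => sum_endo_sMat (γ := gram g e) (γ' := gram g' e) (posDef_gram g he hz)
      (posDef_gram g' he hz) ht)
    (fun z hz => IsC2.contDiffAt he hf hz) k m
    (fun z hz => (IsC2.contDiffAt he hkf hz).congr_of_eventuallyEq (hev k z hz).symm)
    (fun z hz => (IsC2.contDiffAt he hmf hz).congr_of_eventuallyEq (hev m z hz).symm) hz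

/-- The last operator is the Beltrami–Laplace operator, since `S_(n-1) = -1`. -/
lemma opI_eq_laplaceBeltrami {k : ℕ} (hk : k + 1 = n) (f : M → ℝ) :
    opI g g' k f = laplaceBeltrami g f := by
  funext x
  set e := chartAt (EuclideanSpace ℝ (Fin n)) x with hedef
  have he : e ∈ atlas (EuclideanSpace ℝ (Fin n)) M := chart_mem_atlas _ _
  have hz : e x ∈ e.target := e.map_source (mem_chart_source _ _)
  rw [opI, laplaceBeltrami, localI, localLaplace, ← hedef, ← mul_neg, ← Finset.sum_neg_distrib]
  congr 1
  refine Finset.sum_congr rfl fun i _ => ?_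
  rw [pd, pd, ← neg_apply, ← fderiv_fun_neg]
  congr 1
  refine Filter.EventuallyEq.fderiv_eq ?_
  filter_upwards [e.open_target.mem_nhds hz] with y hy
  have hS : matS g g' k e y = -1 :=
    sMat_last (posDef_gram g he hy) (posDef_gram g' he hy) hk
  rw [hS, Finset.sum_comm]
  simp [Matrix.one_apply]

end Charts

/-! ### Geodesics and the projective relation of the connections -/

section Polarization

variable {n : ℕ}

local notation "𝔼" => EuclideanSpace ℝ (Fin n)

/-- A symmetric bilinear map with `T v v` proportional to `v` for every `v` is of the form
`ψ ⊗ id + id ⊗ ψ`. -/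
lemma eq_smul_add_smul_of_forall_smul
    {T : EuclideanSpace ℝ (Fin n) →L[ℝ] EuclideanSpace ℝ (Fin n) →L[ℝ] EuclideanSpace ℝ (Fin n)}
    (hs : ∀ x y, T x y = T y x) (hT : ∀ v, ∃ c : ℝ, T v v = c • v)
    (x y : EuclideanSpace ℝ (Fin n)) :
    T x y = ((1 / ((n : ℝ) + 1)) • ((trL (E := EuclideanSpace ℝ (Fin n))) ∘L T)) x • y
      + ((1 / ((n : ℝ) + 1)) • ((trL (E := EuclideanSpace ℝ (Fin n))) ∘L T)) y • x := by
  have h1 : ∀ v j k, T v v j * v k - T v v k * v j = 0 := by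
    intro v j k
    obtain ⟨c, hc⟩ := hT v
    rw [hc]
    simp only [PiLp.smul_apply, smul_eq_mul]
    ring
  have h2 : ∀ v w j k, T v v j * w k - T v v k * w j
      + 2 * (T v w j * v k - T v w k * v j) = 0 := by
    intro v w j k
    have ha := h1 (v + w) j k
    have hb := h1 (v - w) j k
    have hc := h1 w j k
    simp only [map_add, map_sub, add_apply, sub_apply, PiLp.add_apply, PiLp.sub_apply, hs w v]
      at ha hb
    linear_combination (1 / 2) * ha - (1 / 2) * hb - hc
  have hn : (n : ℝ) + 1 ≠ 0 := by positivity
  have h3 : ∀ v, T v v = (2 * (1 / ((n : ℝ) + 1)) * trL (T v)) • v := by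
    intro v
    ext j
    have h := Finset.sum_eq_zero (s := Finset.univ) fun k _ => h2 v (stdVec k) j k
    have e1 : ∑ k, T v (stdVec k) j * v k = T v v j := by
      rw [clm_apply_eq_sum (T v) v]
      simp [mul_comm]
    have e2 : ∑ k, T v v k * (stdVec k : 𝔼) j = T v v j := by
      simp [stdVec_apply]
    have e3 : ∑ k, T v v j * (stdVec k : 𝔼) k = n * T v v j := by
      simp [stdVec_apply]
    rw [Finset.sum_add_distrib, Finset.sum_sub_distrib, e2, e3, ← Finset.mul_sum,
      Finset.sum_sub_distrib, e1, ← Finset.sum_mul, ← trL_eq_sum] at h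
    rw [PiLp.smul_apply, smul_eq_mul]
    refine mul_left_cancel₀ hn ?_
    linear_combination h - 2 * trL (T v) * v j * mul_one_div_cancel hn
  have ha := h3 (x + y)
  have hb := h3 x
  have hc := h3 y
  simp only [map_add, add_apply, hs y x] at ha
  simp only [smul_apply, ContinuousLinearMap.comp_apply, smul_eq_mul]
  rw [hb, hc] at ha
  linear_combination (norm := module) (1 / 2 : ℝ) • ha

end Polarization

section Geodesics

variable {n : ℕ} {M : Type*} [TopologicalSpace M] [ChartedSpace (EuclideanSpace ℝ (Fin n)) M]
  [IsManifold (𝓡 n) ∞ M] {g g' : Metric n M}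
  {e e' : OpenPartialHomeomorph M (EuclideanSpace ℝ (Fin n))}

local notation "𝔼" => EuclideanSpace ℝ (Fin n)

lemma geodesicLHS_eq {γ : ℝ → M} {t : ℝ} {q q₁ : ℝ → EuclideanSpace ℝ (Fin n)}
    {a : EuclideanSpace ℝ (Fin n)} (hq : (fun s => e (γ s)) =ᶠ[𝓝 t] q)
    (hq₁ : ∀ᶠ s in 𝓝 t, HasDerivAt q (q₁ s) s) (ha : HasDerivAt q₁ a t) (k : Fin n) :
    geodesicLHS g e γ t k = (a + conn (gram g e) (q t) (q₁ t) (q₁ t)) k := by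
  have h1 : ∀ i, deriv (fun s => e (γ s) i) =ᶠ[𝓝 t] fun s => q₁ s i := by
    intro i
    filter_upwards [hq.eventuallyEq_nhds, hq₁] with s hs hs₁
    have h : (fun s => e (γ s) i) =ᶠ[𝓝 s] fun s => q s i := hs.fun_comp fun v : 𝔼 => v i
    rw [h.deriv_eq]
    exact ((crd i).hasFDerivAt.comp_hasDerivAt s hs₁).deriv
  have h2 : deriv (deriv (fun s => e (γ s) k)) t = a k := by
    rw [(h1 k).deriv_eq]
    exact ((crd k).hasFDerivAt.comp_hasDerivAt t ha).deriv
  rw [geodesicLHS, h2, PiLp.add_apply, conn, mkConn_apply]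
  congr 1
  refine Finset.sum_congr rfl fun i _ => Finset.sum_congr rfl fun j _ => ?_
  have hqt : e (γ t) = q t := hq.self_of_nhds
  rw [(h1 i).self_of_nhds, (h1 j).self_of_nhds, hqt]
  rfl

lemma conn_transition (g : Metric n M) (he : e ∈ atlas (EuclideanSpace ℝ (Fin n)) M)
    (he' : e' ∈ atlas (EuclideanSpace ℝ (Fin n)) M) {z : EuclideanSpace ℝ (Fin n)}
    (hz : z ∈ overlap e e') (x y : EuclideanSpace ℝ (Fin n)) :
    fderiv ℝ (e' ∘ e.symm) z (conn (gram g e) z x y)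
      = fderiv ℝ (fderiv ℝ (e' ∘ e.symm)) z x y
        + conn (gram g e') ((e' ∘ e.symm) z) (fderiv ℝ (e' ∘ e.symm) z x)
          (fderiv ℝ (e' ∘ e.symm) z y) :=
  ((metricGeometry_gram g he).mono (isOpen_overlap (e := e) (e' := e'))
    Set.inter_subset_left).map_connection (metricGeometry_gram g he')
    (fun z hz => (contDiffAt_transition he he' hz).of_le two_le_infty) mapsTo_overlap
    (fun z hz => by
      obtain ⟨f, hf⟩ := isInvertible_transition he he' hz
      rw [← hf]; exact f.surjective)
    (fun z hz => bil_gram_transition he he' g hz) hz x y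

/-- A solution of the geodesic equation in one chart is a geodesic. -/
lemma isGeodesicOn_of_chart (g : Metric n M) (he : e ∈ atlas (EuclideanSpace ℝ (Fin n)) M)
    {J : Set ℝ} (hJ : IsOpen J) {c w : ℝ → EuclideanSpace ℝ (Fin n)}
    (hc : ∀ t ∈ J, c t ∈ e.target) (hcw : ∀ t ∈ J, HasDerivAt c (w t) t)
    (hw : ∀ t ∈ J, HasDerivAt w (-conn (gram g e) (c t) (w t) (w t)) t) :
    IsGeodesicOn g (e.symm ∘ c) J := by
  have hw1 : ContDiffOn ℝ 1 w J := by
    rw [show (1 : WithTop ℕ∞) = 0 + 1 by norm_num, contDiffOn_succ_iff_deriv_of_isOpen hJ]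
    refine ⟨fun t ht => (hw t ht).differentiableAt.differentiableWithinAt, by simp, ?_⟩
    rw [contDiffOn_zero]
    intro t ht
    have h1 : ContinuousAt (fun t => -conn (gram g e) (c t) (w t) (w t)) t :=
      (((((metricGeometry_gram g he).contDiffAt_Γ _ (hc t ht)).continuousAt.comp
        (hcw t ht).continuousAt).clm_apply (hw t ht).continuousAt).clm_apply
        (hw t ht).continuousAt).neg
    refine (h1.congr ?_).continuousWithinAt
    filter_upwards [hJ.mem_nhds ht] with s hs using (hw s hs).deriv.symm
  have hc2 : ContDiffOn ℝ 2 c J := by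
    rw [show (2 : WithTop ℕ∞) = 1 + 1 by norm_num, contDiffOn_succ_iff_deriv_of_isOpen hJ]
    exact ⟨fun t ht => (hcw t ht).differentiableAt.differentiableWithinAt, by simp,
      hw1.congr fun t ht => (hcw t ht).deriv⟩
  refine ⟨fun t ht => ?_, fun t ht k => ?_⟩
  · exact (((contMDiffAt_symm he (hc t ht)).of_le two_le_infty).comp t
      (hc2.contDiffAt (hJ.mem_nhds ht)).contMDiffAt).contMDiffWithinAt
  · set e₁ := chartAt (EuclideanSpace ℝ (Fin n)) ((e.symm ∘ c) t) with he₁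
    have hat : e₁ ∈ atlas (EuclideanSpace ℝ (Fin n)) M := chart_mem_atlas _ _
    have hov : c t ∈ overlap e e₁ := ⟨hc t ht, mem_chart_source _ _⟩
    have hovn : ∀ᶠ s in 𝓝 t, c s ∈ overlap e e₁ :=
      (hcw t ht).continuousAt.eventually (isOpen_overlap.mem_nhds hov)
    have hφ : ∀ s, c s ∈ overlap e e₁ → ContDiffAt ℝ 2 (e₁ ∘ e.symm) (c s) := fun s hs =>
      (contDiffAt_transition he hat hs).of_le two_le_infty
    have hJφ := (((hφ t hov).fderiv_right (m := 1) (by norm_num)).differentiableAt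
      (by norm_num)).hasFDerivAt
    have h2 := (hJφ.comp_hasDerivAt t (hcw t ht)).clm_apply (hw t ht)
    rw [geodesicLHS_eq (γ := e.symm ∘ c) (q := fun s => (e₁ ∘ e.symm) (c s))
      (q₁ := fun s => fderiv ℝ (e₁ ∘ e.symm) (c s) (w s)) (Filter.EventuallyEq.refl _ _) ?_ h2]
    · have h3 := conn_transition g he hat hov (w t) (w t)
      simp only [Function.comp_apply] at h3 ⊢
      rw [map_neg, h3]
      simp
    · filter_upwards [hovn, hJ.mem_nhds ht] with s hs hsJ
      exact ((hφ s hs).differentiableAt (by norm_num)).hasFDerivAt.comp_hasDerivAt s (hcw s hsJ)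

/-- Through every point there is a geodesic with prescribed velocity. -/
lemma exists_geodesic_chart (g : Metric n M) (he : e ∈ atlas (EuclideanSpace ℝ (Fin n)) M)
    {z : EuclideanSpace ℝ (Fin n)} (hz : z ∈ e.target) (v : EuclideanSpace ℝ (Fin n)) :
    ∃ ε > 0, ∃ c w : ℝ → EuclideanSpace ℝ (Fin n), c 0 = z ∧ w 0 = v ∧
      (∀ t ∈ Set.Ioo (-ε) ε, c t ∈ e.target) ∧ (∀ t ∈ Set.Ioo (-ε) ε, HasDerivAt c (w t) t) ∧
      ∀ t ∈ Set.Ioo (-ε) ε, HasDerivAt w (-conn (gram g e) (c t) (w t) (w t)) t := by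
  let F : 𝔼 × 𝔼 → 𝔼 × 𝔼 := fun p => (p.2, -conn (gram g e) p.1 p.2 p.2)
  have hF : ContDiffAt ℝ 1 F (z, v) := by
    have h1 : ContDiffAt ℝ 1 (fun p : 𝔼 × 𝔼 => conn (gram g e) p.1) (z, v) :=
      ContDiffAt.comp (g := conn (gram g e)) (z, v) ((metricGeometry_gram g he).contDiffAt_Γ z hz)
        contDiffAt_fst
    exact contDiffAt_snd.prodMk ((h1.clm_apply contDiffAt_snd).clm_apply contDiffAt_snd).neg
  obtain ⟨α, hα0, ε, hε, hα⟩ :=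
    hF.exists_forall_mem_closedBall_exists_eq_forall_mem_Ioo_hasDerivAt₀ 0
  simp only [zero_sub, zero_add] at hα
  have hcont : ContinuousAt (fun t => (α t).1) 0 :=
    (hα 0 ⟨by linarith, hε⟩).continuousAt.fst
  have hmem : ∀ᶠ t in 𝓝 (0 : ℝ), (α t).1 ∈ e.target := by
    refine hcont.eventually (e.open_target.mem_nhds ?_)
    simpa only [hα0] using hz
  obtain ⟨δ, hδ, hδ'⟩ := Metric.eventually_nhds_iff_ball.1 hmem
  have hsub : ∀ t ∈ Set.Ioo (-min ε δ) (min ε δ),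
      t ∈ Set.Ioo (-ε) ε ∧ t ∈ Metric.ball (0 : ℝ) δ := by
    intro t ht
    have h1 := min_le_left ε δ
    have h2 := min_le_right ε δ
    refine ⟨⟨by linarith [ht.1], by linarith [ht.2]⟩, ?_⟩
    rw [Metric.mem_ball, Real.dist_eq, sub_zero, abs_lt]
    exact ⟨by linarith [ht.1], by linarith [ht.2]⟩
  refine ⟨min ε δ, lt_min hε hδ, fun t => (α t).1, fun t => (α t).2, by simp only [hα0],
    by simp only [hα0],
    fun t ht => hδ' t (hsub t ht).2, fun t ht => ?_, fun t ht => ?_⟩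
  · exact (hα t (hsub t ht).1).fst
  · exact (hα t (hsub t ht).1).snd

/-- If the geodesics of `g` are geodesics of `g'` up to the parameter, then the difference of the
two connections maps `(v, v)` to a multiple of `v`. -/
lemma exists_conn_sub_conn_eq_smul (h : GeodesicsOfAreGeodesicsOf g g') (p : M)
    (v : EuclideanSpace ℝ (Fin n)) :
    ∃ a : ℝ, (conn (gram g' (chartAt (EuclideanSpace ℝ (Fin n)) p))
        (chartAt (EuclideanSpace ℝ (Fin n)) p p)
      - conn (gram g (chartAt (EuclideanSpace ℝ (Fin n)) p))
        (chartAt (EuclideanSpace ℝ (Fin n)) p p)) v v = a • v := by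
  set e := chartAt (EuclideanSpace ℝ (Fin n)) p with hedef
  have he : e ∈ atlas (EuclideanSpace ℝ (Fin n)) M := chart_mem_atlas _ _
  have hp : p ∈ e.source := mem_chart_source _ _
  obtain ⟨ε, hε, c, w, hc0, hw0, hct, hcw, hw⟩ := exists_geodesic_chart g he (e.map_source hp) v
  obtain ⟨J', τ, hJ', -, hbij, hτ, hτ', hgeo⟩ := h (e.symm ∘ c) _ isOpen_Ioo Set.ordConnected_Ioo
    (isGeodesicOn_of_chart g he isOpen_Ioo hct hcw hw)
  obtain ⟨s₀, hs₀, hτ0⟩ := hbij.surjOn (show (0 : ℝ) ∈ Set.Ioo (-ε) ε from ⟨by linarith, hε⟩)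
  have hpt : (e.symm ∘ c) (τ s₀) = p := by
    rw [hτ0, Function.comp, hc0, e.left_inv hp]
  have hJn := hJ'.mem_nhds hs₀
  have hτd : ∀ s ∈ J', HasDerivAt τ (deriv τ s) s := fun s hs =>
    ((hτ.contDiffAt (hJ'.mem_nhds hs)).differentiableAt (by norm_num)).hasDerivAt
  have hτ1 : ContDiffOn ℝ 1 (deriv τ) J' := by
    rw [show (2 : WithTop ℕ∞) = 1 + 1 by norm_num, contDiffOn_succ_iff_deriv_of_isOpen hJ'] at hτ
    exact hτ.2.2
  have hτ2 : HasDerivAt (deriv τ) (deriv (deriv τ) s₀) s₀ :=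
    ((hτ1.contDiffAt hJn).differentiableAt (by norm_num)).hasDerivAt
  have hq : (fun s => e (((e.symm ∘ c) ∘ τ) s)) =ᶠ[𝓝 s₀] fun s => c (τ s) := by
    filter_upwards [hJn] with s hs using e.right_inv (hct _ (hbij.mapsTo hs))
  have hq1 : ∀ᶠ s in 𝓝 s₀, HasDerivAt (fun s => c (τ s)) (deriv τ s • w (τ s)) s := by
    filter_upwards [hJn] with s hs
    exact (hcw _ (hbij.mapsTo hs)).scomp s (hτd s hs)
  have hq2 := hτ2.fun_smul ((hw _ (hbij.mapsTo hs₀)).scomp s₀ (hτd s₀ hs₀))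
  have hk := hgeo.2 s₀ hs₀
  have hchart : chartAt (EuclideanSpace ℝ (Fin n)) (((e.symm ∘ c) ∘ τ) s₀) = e := by
    rw [Function.comp_apply, hpt]
  rw [hchart] at hk
  have heq : ∀ k, (_ : 𝔼) k = (0 : 𝔼) k := fun k =>
    (geodesicLHS_eq (g := g') (e := e) hq hq1 hq2 k).symm.trans (hk k)
  have heq' := PiLp.ext heq
  simp only [Function.comp, hτ0, hc0, hw0] at heq'
  -- In the parameter `τ` the velocity is `τ' v`, so `τ'² (Γ' - Γ)(v, v) = -τ'' v`.
  set T := deriv τ s₀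
  have hT : T ≠ 0 := hτ' s₀ hs₀
  refine ⟨-(deriv (deriv τ) s₀ / T ^ 2), ?_⟩
  simp only [map_smul, smul_apply] at heq'
  rw [sub_apply, sub_apply]
  have hTT : (T ^ 2) • (conn (gram g' e) (e p) v v - conn (gram g e) (e p) v v)
      = (T ^ 2) • (-(deriv (deriv τ) s₀ / T ^ 2) • v) := by
    rw [smul_smul, mul_neg, mul_div_cancel₀ _ (pow_ne_zero 2 hT)]
    linear_combination (norm := module) heq'
  exact smul_right_injective _ (pow_ne_zero 2 hT) hTT

/-- Geodesically equivalent metrics have projectively related connections, in every chart. -/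
lemma exists_projective_form (h : GeodesicsOfAreGeodesicsOf g g')
    (he : e ∈ atlas (EuclideanSpace ℝ (Fin n)) M) :
    ∃ ψ : EuclideanSpace ℝ (Fin n) → EuclideanSpace ℝ (Fin n) →L[ℝ] ℝ,
      ∀ z ∈ e.target, ∀ x y,
        conn (gram g' e) z x y = conn (gram g e) z x y + ψ z x • y + ψ z y • x := by
  -- The trace of `ψ ⊗ id + id ⊗ ψ` is `(n + 1) ψ`, which determines `ψ`.
  refine ⟨fun z => (1 / ((n : ℝ) + 1)) • ((trL (E := EuclideanSpace ℝ (Fin n))) ∘L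
    (conn (gram g' e) z - conn (gram g e) z)), fun z hz x y => ?_⟩
  have hT := eq_smul_add_smul_of_forall_smul (T := conn (gram g' e) z - conn (gram g e) z) ?_ ?_ x y
  · rw [sub_apply, sub_apply, sub_eq_iff_eq_add'] at hT
    rw [hT, add_assoc]
  · intro x y
    simp only [sub_apply]
    rw [(metricGeometry_gram g he).torsion_free z hz, (metricGeometry_gram g' he).torsion_free z hz]
  · intro v
    set e₀ := chartAt (EuclideanSpace ℝ (Fin n)) (e.symm z)
    have hat : e₀ ∈ atlas (EuclideanSpace ℝ (Fin n)) M := chart_mem_atlas _ _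
    have hov : z ∈ overlap e e₀ := ⟨hz, mem_chart_source _ _⟩
    obtain ⟨f, hf⟩ := isInvertible_transition he hat hov
    obtain ⟨a, ha⟩ := exists_conn_sub_conn_eq_smul h (e.symm z) (fderiv ℝ (e₀ ∘ e.symm) z v)
    refine ⟨a, f.injective ?_⟩
    have h1 := conn_transition g he hat hov v v
    have h2 := conn_transition g' he hat hov v v
    rw [← hf] at h1 h2 ha
    rw [sub_apply, sub_apply] at ha ⊢
    simp only [ContinuousLinearEquiv.coe_coe, Function.comp_apply] at h1 h2 ha ⊢
    rw [map_sub, h1, h2, map_smul, ← ha]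
    abel

end Geodesics

/-! ### The Riemannian volume in charts -/

section Volume

variable {n : ℕ} {M : Type*} [TopologicalSpace M] [ChartedSpace (EuclideanSpace ℝ (Fin n)) M]
  [IsManifold (𝓡 n) ∞ M] [MeasurableSpace M] [BorelSpace M] (g : Metric n M)
  {e e' : OpenPartialHomeomorph M (EuclideanSpace ℝ (Fin n))}

local notation "𝔼" => EuclideanSpace ℝ (Fin n)

lemma measurableSet_symm_preimage (e : OpenPartialHomeomorph M (EuclideanSpace ℝ (Fin n)))
    {A : Set M} (hA : MeasurableSet A) : MeasurableSet (e.symm ⁻¹' A ∩ e.target) := by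
  have h := (continuousOn_iff_continuous_domRestrict.1 e.continuousOn_symm).measurable hA
  have h2 := MeasurableSet.subtype_image e.open_target.measurableSet h
  convert h2 using 1
  ext z
  simp [and_comm]

lemma aemeasurable_symm (e : OpenPartialHomeomorph M (EuclideanSpace ℝ (Fin n))) :
    AEMeasurable e.symm ((volume : Measure (EuclideanSpace ℝ (Fin n))).restrict e.target) :=
  e.continuousOn_symm.aemeasurable e.open_target.measurableSet

lemma aemeasurable_symm_withDensity (e : OpenPartialHomeomorph M (EuclideanSpace ℝ (Fin n))) :
    AEMeasurable e.symm (((volume : Measure (EuclideanSpace ℝ (Fin n))).restrict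
      e.target).withDensity
    (fun z => ENNReal.ofReal √(gram g e z).det)) :=
  (aemeasurable_symm e).mono_ac (withDensity_absolutelyContinuous _ _)

lemma chartVolume_apply (e : OpenPartialHomeomorph M (EuclideanSpace ℝ (Fin n))) {A : Set M}
    (hA : MeasurableSet A) : chartVolume g e A
      = ∫⁻ z in e.symm ⁻¹' A ∩ e.target, ENNReal.ofReal √(gram g e z).det := by
  rw [chartVolume, Measure.map_apply_of_aemeasurable (aemeasurable_symm_withDensity g e) hA,
    withDensity_apply', Measure.restrict_restrict' e.open_target.measurableSet]

variable (he : e ∈ atlas (EuclideanSpace ℝ (Fin n)) M)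
  (he' : e' ∈ atlas (EuclideanSpace ℝ (Fin n)) M)

include he he' in
lemma sqrt_det_gram_transition {z : EuclideanSpace ℝ (Fin n)} (hz : z ∈ overlap e e') :
    √(gram g e z).det = |(fderiv ℝ (e' ∘ e.symm) z).det| * √(gram g e' ((e' ∘ e.symm) z)).det := by
  rw [gram_transition he he' g hz, Matrix.det_mul, Matrix.det_mul, Matrix.det_transpose,
    ← endo_jac, det_endo, ← Real.sqrt_sq_eq_abs, ← Real.sqrt_mul (sq_nonneg _)]
  congr 1
  ring

include he he' in
/-- The densities `√det g dx` of two charts agree where both charts are defined. -/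
lemma chartVolume_eq_of_subset {A : Set M} (hA : MeasurableSet A) (h1 : A ⊆ e.source)
    (h2 : A ⊆ e'.source) : chartVolume g e A = chartVolume g e' A := by
  have hs := measurableSet_symm_preimage e hA
  have hov : e.symm ⁻¹' A ∩ e.target ⊆ overlap e e' := fun z hz => ⟨hz.2, h2 hz.1⟩
  have himg : (e' ∘ e.symm) '' (e.symm ⁻¹' A ∩ e.target) = e'.symm ⁻¹' A ∩ e'.target := by
    ext w
    constructor
    · rintro ⟨z, hz, rfl⟩
      refine ⟨?_, mapsTo_overlap (hov hz)⟩
      rw [Set.mem_preimage, symm_transition (hov hz)]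
      exact hz.1
    · rintro ⟨hw1, hw2⟩
      refine ⟨e (e'.symm w), ⟨?_, e.map_source (h1 hw1)⟩, ?_⟩
      · rw [Set.mem_preimage, e.left_inv (h1 hw1)]
        exact hw1
      · rw [Function.comp, e.left_inv (h1 hw1), e'.right_inv hw2]
  have hinj : Set.InjOn (e' ∘ e.symm) (e.symm ⁻¹' A ∩ e.target) := by
    intro z hz w hw hzw
    have h := congrArg e'.symm hzw
    rw [symm_transition (hov hz), symm_transition (hov hw)] at h
    exact e.symm.injOn hz.2 hw.2 h
  rw [chartVolume_apply g e hA, chartVolume_apply g e' hA, ← himg,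
    lintegral_image_eq_lintegral_abs_det_fderiv_mul volume hs
      (fun z hz => ((contDiffAt_transition he he' (hov hz)).differentiableAt
        (by simp)).hasFDerivAt.hasFDerivWithinAt) hinj]
  refine setLIntegral_congr_fun hs fun z hz => ?_
  rw [sqrt_det_gram_transition g he he' (hov hz), ENNReal.ofReal_mul (abs_nonneg _)]

lemma chartVolume_inter_source (e : OpenPartialHomeomorph M (EuclideanSpace ℝ (Fin n)))
    {A : Set M} (hA : MeasurableSet A) :
    chartVolume g e (A ∩ e.source) = chartVolume g e A := by
  rw [chartVolume_apply g e hA, chartVolume_apply g e (hA.inter e.open_source.measurableSet)]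
  congr 2
  ext z
  simp only [Set.mem_inter_iff, Set.mem_preimage]
  exact ⟨fun h => ⟨h.1.1, h.2⟩, fun h => ⟨⟨h.1, e.map_target h.2⟩, h.2⟩⟩

include he in
/-- On the domain of a chart the Riemannian volume is the volume of the chart. -/
lemma riemannianVolume_restrict : (riemannianVolume g).restrict e.source = chartVolume g e := by
  have hms := e.open_source.measurableSet
  have hself : (chartVolume g e).restrict e.source = chartVolume g e := by
    ext A hA
    rw [Measure.restrict_apply hA, chartVolume_inter_source g e hA]
  have hle : chartVolume g e ≤ riemannianVolume g := le_iSup₂_of_le e he le_rfl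
  have hge : riemannianVolume g
      ≤ chartVolume g e + (riemannianVolume g).restrict e.sourceᶜ := by
    refine iSup₂_le fun e₁ he₁ => ?_
    rw [← Measure.restrict_add_restrict_compl (μ := chartVolume g e₁) hms]
    refine add_le_add ?_ (Measure.restrict_mono le_rfl (le_iSup₂_of_le e₁ he₁ le_rfl))
    rw [Measure.le_iff]
    intro A hA
    rw [Measure.restrict_apply hA, ← chartVolume_inter_source g e₁ (hA.inter hms),
      chartVolume_eq_of_subset g he₁ he ((hA.inter hms).inter e₁.open_source.measurableSet)
        Set.inter_subset_right (Set.inter_subset_left.trans Set.inter_subset_right)]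
    exact measure_mono (Set.inter_subset_left.trans Set.inter_subset_left)
  refine le_antisymm ?_ ?_
  · refine (Measure.restrict_mono le_rfl hge).trans ?_
    rw [Measure.restrict_add, hself, Measure.restrict_restrict hms, Set.inter_compl_self,
      Measure.restrict_empty, add_zero]
  · rw [← hself]
    exact Measure.restrict_mono le_rfl hle

include he in
lemma continuousOn_sqrt_det_gram : ContinuousOn (fun z => √(gram g e z).det) e.target :=
  fun z hz => ((metricGeometry_gram g he).contDiffAt_ρ z hz).continuousAt.continuousWithinAt

include he in
/-- The integral of a function supported in the domain of a chart, in coordinates. -/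
lemma integral_riemannianVolume [CompactSpace M] {F : M → ℝ} (hF : Continuous F)
    (hs : tsupport F ⊆ e.source) :
    Integrable F (riemannianVolume g) ∧
    ∫ x, F x ∂(riemannianVolume g) = ∫ z in e.target, √(gram g e z).det * F (e.symm z) := by
  have hsupp : Function.support F ⊆ e.source := (subset_tsupport F).trans hs
  have hdens : AEMeasurable (fun z => ENNReal.ofReal √(gram g e z).det)
      ((volume : Measure (EuclideanSpace ℝ (Fin n))).restrict e.target) :=
    ((continuousOn_sqrt_det_gram g he).aemeasurable e.open_target.measurableSet).ennreal_ofReal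
  have hlt : ∀ᵐ z ∂((volume : Measure (EuclideanSpace ℝ (Fin n))).restrict e.target),
      ENNReal.ofReal √(gram g e z).det < ⊤ := Eventually.of_forall fun _ => ENNReal.ofReal_lt_top
  have hreal : ∀ z, (ENNReal.ofReal √(gram g e z).det).toReal = √(gram g e z).det := fun z =>
    ENNReal.toReal_ofReal (Real.sqrt_nonneg _)
  have hmeas := aemeasurable_symm_withDensity g e
  have hFm : AEStronglyMeasurable F (chartVolume g e) := hF.aestronglyMeasurable
  constructor
  · rw [← integrableOn_iff_integrable_of_support_subset hsupp, IntegrableOn,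
      riemannianVolume_restrict g he, chartVolume, integrable_map_measure hFm hmeas,
      integrable_withDensity_iff_integrable_smul₀' hdens hlt]
    simp only [hreal, smul_eq_mul, Function.comp]
    have hK : IsCompact (e '' tsupport F) :=
      (isClosed_tsupport F).isCompact.image_of_continuousOn (e.continuousOn.mono hs)
    have hKt : e '' tsupport F ⊆ e.target := by
      rintro _ ⟨x, hx, rfl⟩
      exact e.map_source (hs hx)
    have hcont : ContinuousOn (fun z => √(gram g e z).det * F (e.symm z)) e.target :=
      (continuousOn_sqrt_det_gram g he).mul (hF.comp_continuousOn e.continuousOn_symm)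
    have hint := integrable_of_compact_subset (μ := (volume : Measure 𝔼)) hK hKt
      (Y := e.target.indicator fun z => √(gram g e z).det * F (e.symm z)) ?_ ?_
    · exact (integrable_indicator_iff e.open_target.measurableSet).1 hint
    · intro z hz
      refine (hcont.continuousAt (e.open_target.mem_nhds hz)).congr ?_
      filter_upwards [e.open_target.mem_nhds hz] with w hw
      rw [Set.indicator_of_mem hw]
    · intro z hz
      by_cases hzt : z ∈ e.target
      · rw [Set.indicator_of_mem hzt]
        have : e.symm z ∉ tsupport F := fun h => hz ⟨_, h, e.right_inv hzt⟩
        rw [image_eq_zero_of_notMem_tsupport this, mul_zero]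
      · rw [Set.indicator_of_notMem hzt]
  · rw [← setIntegral_eq_integral_of_forall_compl_eq_zero (s := e.source) fun x hx => by
      by_contra h
      exact hx (hsupp h), riemannianVolume_restrict g he, chartVolume, integral_map hmeas hFm,
      integral_withDensity_eq_integral_toReal_smul₀ hdens hlt]
    simp only [hreal, smul_eq_mul]

end Volume

/-! ### Self-adjointness -/

section SelfAdjoint

variable {n : ℕ} {M : Type*} [TopologicalSpace M] [ChartedSpace (EuclideanSpace ℝ (Fin n)) M]
  [IsManifold (𝓡 n) ∞ M] (g g' : Metric n M) (k : ℕ)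
  {e : OpenPartialHomeomorph M (EuclideanSpace ℝ (Fin n))} {f h : M → ℝ}

local notation "𝔼" => EuclideanSpace ℝ (Fin n)

lemma continuous_opI (hf : IsC2 n f) : Continuous (opI g g' k f) := by
  rw [continuous_iff_continuousAt]
  intro x
  set e := chartAt (EuclideanSpace ℝ (Fin n)) x
  have he : e ∈ atlas (EuclideanSpace ℝ (Fin n)) M := chart_mem_atlas _ _
  have hx : x ∈ e.source := mem_chart_source _ _
  have h1 : ContinuousAt (chartOp g g' k e (f ∘ e.symm)) (e x) :=
    (metricGeometry_gram g he).continuousAt_divOp (e.map_source hx)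
      (contDiffAt_endo_matS g g' k he (e.map_source hx))
      (IsC2.contDiffAt he hf (e.map_source hx))
  refine (ContinuousAt.comp h1 (e.continuousAt hx)).congr ?_
  filter_upwards [e.open_source.mem_nhds hx] with y hy
  exact (opI_apply g g' k he hf hy).symm

lemma opI_eq_zero (hf : IsC2 n f) {x : M} (hx : x ∉ tsupport f) : opI g g' k f x = 0 := by
  set e := chartAt (EuclideanSpace ℝ (Fin n)) x
  have he : e ∈ atlas (EuclideanSpace ℝ (Fin n)) M := chart_mem_atlas _ _
  have hxs : x ∈ e.source := mem_chart_source _ _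
  rw [opI_apply g g' k he hf hxs]
  refine divOp_eq_zero _ _ _ ?_
  rw [notMem_tsupport_iff_eventuallyEq] at hx ⊢
  have h1 := e.continuousAt_symm (e.map_source hxs)
  rw [ContinuousAt, e.left_inv hxs] at h1
  exact h1.eventually hx

lemma tsupport_opI_subset (hf : IsC2 n f) : tsupport (opI g g' k f) ⊆ tsupport f :=
  closure_minimal (fun x hx => by
    by_contra h
    exact hx (opI_eq_zero g g' k hf h)) (isClosed_tsupport f)

lemma opI_add (hf : IsC2 n f) (hh : IsC2 n h) (x : M) :
    opI g g' k (fun y => f y + h y) x = opI g g' k f x + opI g g' k h x := by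
  set e := chartAt (EuclideanSpace ℝ (Fin n)) x
  have he : e ∈ atlas (EuclideanSpace ℝ (Fin n)) M := chart_mem_atlas _ _
  have hxs : x ∈ e.source := mem_chart_source _ _
  have hz := e.map_source hxs
  have hfh : IsC2 n fun y => f y + h y := ContMDiff.add hf hh
  rw [opI_apply g g' k he hf hxs, opI_apply g g' k he hh hxs, opI_apply g g' k he hfh hxs]
  have hG := metricGeometry_gram g he
  have hS := contDiffAt_endo_matS g g' k he hz
  have h1 := (hG.contDiffAt_divOp_field hz hS (IsC2.contDiffAt he hf hz)).differentiableAt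
    (by norm_num)
  have h2 := (hG.contDiffAt_divOp_field hz hS (IsC2.contDiffAt he hh hz)).differentiableAt
    (by norm_num)
  rw [chartOp, chartOp, chartOp, divOp, divOp, divOp, ← divC_add h1 h2]
  have hev : (fun y => endo (matS g g' k e y)
      (grad (fun z => bil (gram g e z)) ((fun y => f y + h y) ∘ e.symm) y)) =ᶠ[𝓝 (e x)]
      fun y => endo (matS g g' k e y) (grad (fun z => bil (gram g e z)) (f ∘ e.symm) y)
        + endo (matS g g' k e y) (grad (fun z => bil (gram g e z)) (h ∘ e.symm) y) := by
    filter_upwards [e.open_target.mem_nhds hz] with y hy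
    rw [← map_add, grad, grad, grad, ← map_add, ← fderiv_add
      ((IsC2.contDiffAt he hf hy).differentiableAt (by norm_num))
      ((IsC2.contDiffAt he hh hy).differentiableAt (by norm_num))]
    rfl
  rw [divC, divC, hev.fderiv_eq]
  congr 2
  exact congrArg _ hev.self_of_nhds

lemma opI_zero (x : M) : opI g g' k (fun _ => 0) x = 0 :=
  opI_eq_zero g g' k contMDiff_const (by
    rw [notMem_tsupport_iff_eventuallyEq]
    exact Filter.EventuallyEq.refl _ _)

lemma opI_sum {ι : Type*} (s : Finset ι) {f : ι → M → ℝ} (hf : ∀ i, IsC2 n (f i)) (x : M) :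
    opI g g' k (fun y => ∑ i ∈ s, f i y) x = ∑ i ∈ s, opI g g' k (f i) x := by
  classical
  induction s using Finset.induction_on with
  | empty => simpa using opI_zero g g' k x
  | insert a s ha ih =>
    simp only [Finset.sum_insert ha]
    rw [opI_add g g' k (hf a), ih]
    exact contMDiff_finsetSum fun i _ => hf i

variable [MeasurableSpace M] [BorelSpace M]

/-- Symmetry of `𝓘_k` when one of the functions is supported in a chart. -/
lemma integral_opI_mul_of_tsupport_subset [CompactSpace M]
    (he : e ∈ atlas (EuclideanSpace ℝ (Fin n)) M) (hf : IsC2 n f) (hh : IsC2 n h)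
    (hs : tsupport h ⊆ e.source) :
    Integrable (fun x => opI g g' k f x * h x) (riemannianVolume g) ∧
    Integrable (fun x => f x * opI g g' k h x) (riemannianVolume g) ∧
    ∫ x, opI g g' k f x * h x ∂(riemannianVolume g)
      = ∫ x, f x * opI g g' k h x ∂(riemannianVolume g) := by
  have hfc : Continuous f := hf.continuous
  have hhc : Continuous h := hh.continuous
  obtain ⟨i1, e1⟩ := integral_riemannianVolume g he ((continuous_opI g g' k hf).mul hhc)
    ((tsupport_mul_subset_right).trans hs)
  obtain ⟨i2, e2⟩ := integral_riemannianVolume g he (hfc.mul (continuous_opI g g' k hh))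
    ((tsupport_mul_subset_right).trans ((tsupport_opI_subset g g' k hh).trans hs))
  refine ⟨i1, i2, ?_⟩
  have e1' : ∫ x, opI g g' k f x * h x ∂(riemannianVolume g) = _ := e1
  have e2' : ∫ x, f x * opI g g' k h x ∂(riemannianVolume g) = _ := e2
  rw [e1', e2']
  have hG := metricGeometry_gram g he
  -- the function `h` in the chart, extended by zero
  set u : 𝔼 → ℝ := e.target.indicator (h ∘ e.symm) with hu
  set K : Set 𝔼 := e '' tsupport h with hKdef
  have hK : IsCompact K :=
    (isClosed_tsupport h).isCompact.image_of_continuousOn (e.continuousOn.mono hs)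
  have hKt : K ⊆ e.target := by
    rintro _ ⟨x, hx, rfl⟩
    exact e.map_source (hs hx)
  have hu0 : ∀ z ∉ K, u z = 0 := by
    intro z hz
    by_cases hzt : z ∈ e.target
    · rw [hu, Set.indicator_of_mem hzt]
      have h0 : e.symm z ∉ tsupport h := fun h' => hz ⟨_, h', e.right_inv hzt⟩
      exact image_eq_zero_of_notMem_tsupport (f := h) h0
    · rw [hu, Set.indicator_of_notMem hzt]
  have huc : HasCompactSupport u := HasCompactSupport.intro hK hu0
  have hut : tsupport u ⊆ e.target :=
    (closure_minimal (fun z hz => by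
      by_contra h
      exact hz (hu0 z h)) hK.isClosed).trans hKt
  have huev : ∀ z ∈ e.target, u =ᶠ[𝓝 z] h ∘ e.symm := fun z hz => by
    filter_upwards [e.open_target.mem_nhds hz] with y hy
    rw [hu, Set.indicator_of_mem hy]
  have hgreen := hG.green (volume : Measure 𝔼)
    (fun z hz => contDiffAt_endo_matS g g' k he hz) (fun z hz => symm_endo_matS g g' k he hz)
    (fun z hz => IsC2.contDiffAt he hf hz)
    (fun z hz => (IsC2.contDiffAt he hh hz).congr_of_eventuallyEq (huev z hz)) huc hut
  have hleft := setIntegral_eq_integral_of_forall_compl_eq_zero (s := e.target)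
    (μ := (volume : Measure 𝔼))
    (f := fun z => √(gram g e z).det * (divOp (fun z => bil (gram g e z)) (conn (gram g e))
      (fun y => endo (matS g g' k e y)) (f ∘ e.symm) z * u z)) fun z hz => by
        rw [hu, Set.indicator_of_notMem hz, mul_zero, mul_zero]
  have hright := setIntegral_eq_integral_of_forall_compl_eq_zero (s := e.target)
    (μ := (volume : Measure 𝔼))
    (f := fun z => √(gram g e z).det * ((f ∘ e.symm) z * divOp (fun z => bil (gram g e z))
      (conn (gram g e)) (fun y => endo (matS g g' k e y)) u z)) fun z hz => by
        rw [divOp_eq_zero _ _ _ fun h => hz (hut h), mul_zero, mul_zero]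
  refine Eq.trans ?_ ((hleft.trans (hgreen.trans hright.symm)).trans ?_)
  · refine setIntegral_congr_fun e.open_target.measurableSet fun z hz => ?_
    change _ * (opI g g' k f (e.symm z) * h (e.symm z)) = _
    rw [opI_symm g g' k he hf hz, (huev z hz).self_of_nhds]
    rfl
  · refine setIntegral_congr_fun e.open_target.measurableSet fun z hz => ?_
    change _ = _ * (f (e.symm z) * opI g g' k h (e.symm z))
    rw [opI_symm g g' k he hh hz, divOp_congr _ _ _ (huev z hz)]
    rfl

/-- On a closed manifold the operators `𝓘_k` are self-adjoint. -/
lemma isSelfAdjointOp_opI [T2Space M] [CompactSpace M] : IsSelfAdjointOp g (opI g g' k) := by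
  intro f h hf hh
  obtain ⟨t, ht⟩ := isCompact_univ.elim_finite_subcover
    (fun x : M => (chartAt (EuclideanSpace ℝ (Fin n)) x).source)
    (fun x => (chartAt _ x).open_source) fun x _ => Set.mem_iUnion.2 ⟨x, mem_chart_source _ x⟩
  obtain ⟨χ, hχ⟩ := SmoothPartitionOfUnity.exists_isSubordinate (𝓡 n) (isClosed_univ (X := M))
    (fun x : t => (chartAt (EuclideanSpace ℝ (Fin n)) (x : M)).source)
    (fun x => (chartAt _ (x : M)).open_source) fun x hx => by
      obtain ⟨i, hi, hxi⟩ := Set.mem_iUnion₂.1 (ht hx)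
      exact Set.mem_iUnion.2 ⟨⟨i, hi⟩, hxi⟩
  let w : t → M → ℝ := fun i y => χ i y * h y
  have hC : ∀ i, IsC2 n (w i) := fun i =>
    ContMDiff.mul ((χ i).contMDiff.of_le two_le_infty) hh
  have hsum : (fun y => ∑ i, w i y) = h := by
    funext y
    have h1 := χ.sum_eq_one (Set.mem_univ y)
    rw [finsum_eq_sum_of_fintype] at h1
    rw [← Finset.sum_mul, h1, one_mul]
  have hsup : ∀ i, tsupport (w i) ⊆ (chartAt (EuclideanSpace ℝ (Fin n)) (i : M)).source :=
    fun i => (tsupport_mul_subset_left).trans (hχ i)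
  have hloc := fun i : t => integral_opI_mul_of_tsupport_subset g g' k
    (chart_mem_atlas _ (i : M)) hf
    (hC i) (hsup i)
  have hL : (fun x => opI g g' k f x * h x) = fun x => ∑ i, opI g g' k f x * w i x := by
    funext x
    rw [← Finset.mul_sum, congrFun hsum x]
  have hR : (fun x => f x * opI g g' k h x) = fun x => ∑ i, f x * opI g g' k (w i) x := by
    funext x
    rw [← Finset.mul_sum, ← opI_sum g g' k Finset.univ hC, hsum]
  rw [hL, hR]
  refine ⟨integrable_finsetSum _ fun i _ => (hloc i).1,
    integrable_finsetSum _ fun i _ => (hloc i).2.1, ?_⟩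
  rw [integral_finsetSum _ fun i _ => (hloc i).1, integral_finsetSum _ fun i _ => (hloc i).2.1]
  exact Finset.sum_congr rfl fun i _ => (hloc i).2.2

end SelfAdjoint

end ProjEquiv

end

theorem theorem10 (n : ℕ) (M : Type*) [TopologicalSpace M] [T2Space M]
    [SecondCountableTopology M] [ChartedSpace (EuclideanSpace ℝ (Fin n)) M]
    [IsManifold (𝓡 n) ∞ M] [MeasurableSpace M] [BorelSpace M]
    (g g' : ProjEquiv.Metric n M) (hgg' : ProjEquiv.GeodesicallyEquivalent g g') :
    (∀ k l : Fin n,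
      ProjEquiv.OperatorsCommute n (ProjEquiv.opI g g' k) (ProjEquiv.opI g g' l)) ∧
    (∀ k : Fin n, (k : ℕ) + 1 = n → ∀ f : M → ℝ, ProjEquiv.IsC2 n f →
      ProjEquiv.opI g g' k f = ProjEquiv.laplaceBeltrami g f) ∧
    (∀ k : Fin n,
      ProjEquiv.OperatorsCommute n (ProjEquiv.opI g g' k) (ProjEquiv.laplaceBeltrami g)) ∧
    (CompactSpace M →
      ∀ k : Fin n, ProjEquiv.IsSelfAdjointOp g (ProjEquiv.opI g g' k)) := by
  have hcomm : ∀ k l : Fin n,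
      ProjEquiv.OperatorsCommute n (ProjEquiv.opI g g' k) (ProjEquiv.opI g g' l) := fun k l =>
    ProjEquiv.operatorsCommute_opI g g' k l fun e he => ProjEquiv.exists_projective_form hgg'.1 he
  refine ⟨hcomm, fun k hk f _ => ProjEquiv.opI_eq_laplaceBeltrami g g' hk f, fun k => ?_,
    fun _ k => ProjEquiv.isSelfAdjointOp_opI g g' k⟩
  have hn : n - 1 < n := Nat.sub_lt (Fin.pos k) one_pos
  have hlast : n - 1 + 1 = n := Nat.sub_add_cancel (Fin.pos k)
  rw [← funext (ProjEquiv.opI_eq_laplaceBeltrami g g' hlast)]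
  exact hcomm k ⟨n - 1, hn⟩
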